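/- Let $k$ be an uncountable algebraically closed field of characteristic $\neq 2$ with prime subfield $\mathbb F$, and let $K=k(u,v)$. For $\rho,\theta\in k^*$ let $\sigma,\tau=\tau(\rho,\theta)$ be the $k$-automorphisms of $K$ given by $\sigma(u)=uv$, $\sigma(v)=v$ and $$\tau(u)=\frac{\gamma u+\delta}{\delta u+\gamma},\qquad \tau(v)=\frac{\epsilon v+\zeta}{\zeta v+\epsilon},\qquad \gamma=\rho+1,\ \delta=\rho-1,\ \epsilon=\theta+1,\ \zeta=\theta-1,$$ and put $\varphi=\sigma\circ\tau$. Let $E=k+ku+kv+kuv$ and let $R=R(\tau)$ be the $k$-subalgebra of the skew Laurent ring $K[t,t^{-1};\varphi]$ (where $ta=\varphi(a)t$) generated by $Et$, graded by $R_n=R\cap Kt^n$. Write $r_1=t$, $r_2=ut$, $r_3=vt$, $r_4=uvt$. Let $S(\tau)$ be the quotient of the free algebra $k\langle x_1,x_2,x_3,x_4\rangle$ by the ideal generated by $$f_1=x_1(\zeta x_1-\epsilon x_3)+x_3(\epsilon x_1-\zeta x_3),\quad f_2=x_1(\zeta x_2-\epsilon x_4)+x_3(\epsilon x_2-\zeta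 x_4),$$ $$f_3=x_2(\zeta x_1-\epsilon x_3)+x_4(\epsilon x_1-\zeta x_3),\quad f_4=x_2(\zeta x_2-\epsilon x_4)+x_4(\epsilon x_2-\zeta x_4),$$ $$f_5=x_1(\delta x_1-\gamma x_2)+x_4(\gamma x_1-\delta x_2),\quad f_6=x_1(\delta x_3-\gamma x_4)+x_4(\gamma x_3-\delta x_4).$$ In $R_1$ put $z_1=(\zeta-\epsilon v)t$, $z_2=(\epsilon-\zeta v)t$, $z_3=(\zeta u-\epsilon uv)t$, $z_4=(\epsilon u-\zeta uv)t$, $z_5=(\delta-\gamma u)t$, $z_6=(\gamma-\delta u)t$, $z_7=(\delta v-\gamma uv)t$, $z_8=(\gamma v-\delta uv)t$, $z_9=(\gamma u-\delta)(-\zeta v+\epsilon)t$, $z_{10}=(\delta u-\gamma)(\epsilon v-\zeta)t$, and consider the sequence of right $R$-modules (column vectors, matrices acting by left multiplication) $$(\ast)\qquad 0\to R[-4]\xrightarrow{M}R[-3]^4\xrightarrow{N}R[-2]^6\xrightarrow{P}R[-1]^4\xrightarrow{Q}R\to k\to 0,$$ where $k=R/R_{\ge1}$ and $$M=\begin{pmatrix}0\\0\\z_9\\z_{10}\end{pmatrix},\quad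 N=\begin{pmatrix}z_9&0&0&0\\z_{10}&0&0&0\\0&z_9&0&0\\0&z_{10}&0&0\\0&0&z_1&z_3\\0&0&z_2&z_4\end{pmatrix},\quad P=\begin{pmatrix}z_1&z_3&0&0&z_5&z_7\\0&0&z_1&z_3&0&0\\z_2&z_4&0&0&0&0\\0&0&z_2&z_4&z_6&z_8\end{pmatrix},\quad Q=\begin{pmatrix}r_1&r_2&r_3&r_4\end{pmatrix}.$$ There is a general subset $U\subseteq\mathbb G=\{\tau(\rho,\theta)\}\cong k^*\times k^*$ (the complement of a countable union of proper closed subvarieties), containing $(1,1)$ and every pair $(\rho,\theta)$ algebraically independent over $\mathbb F$, such that for all $(\rho,\theta)\in U$ the algebra $R=R(\tau(\rho,\theta))$ has the following properties. (1) $R$ is connected graded, $(\ast)$ is exact, $R$ is Koszul, $R$ has (left and right) global dimension $4$, its Hilbert series is $h_R(s)=1/(1-s)^4$, and $x_i\mapsto r_i$ induces an isomorphism $S(\tau)\cong R$. (2) $\operatorname{Ext}^1_R(k,R)=0$ (right modules). (3) $\dim_k\operatorname{Ext}^i_R(k,R)=\infty$ for $i=2,3,4$. (4) $R$ is not Artin–Schelter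 Gorenstein and not Artin–Schelter regular; $R$ fails $\chi_2$ on the right, that is, there are a finitely generated graded right module $M$ and $j\le 2$ with $\dim_k\operatorname{Ext}^j_R(k,M)=\infty$; with $\operatorname{depth}M=\min\{i:\operatorname{Ext}^i_R(k,M)\ne0\}$ one has $\operatorname{depth}R=2$, while $\operatorname{depth}k_R=0$ and $\operatorname{pd}k_R=4$, so the Auslander–Buchsbaum formula $\operatorname{pd}M+\operatorname{depth}M=\operatorname{depth}R$ fails for $M=k_R$. -/

import Mathlib

open CategoryTheory MulOpposite

universe u

noncomputable section

namespace BirationalSurface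

/-! ### Graded algebras and their homological invariants

Right `R`-modules are modules over `Rᵐᵒᵖ`.  In this part `𝒜 n` is the degree-`n` piece of `R`. -/

section Graded

variable {k : Type u} [Field k] {R : Type u} [Ring R] [Algebra k R]

/-- `R = ⨁ 𝒜 n` is a connected graded `k`-algebra: `𝒜 0 = k` and every `𝒜 n` is
finite-dimensional. -/
structure IsConnectedGraded (𝒜 : ℕ → Submodule k R) : Prop where
  nontrivial : Nontrivial R
  internal : DirectSum.IsInternal 𝒜
  one_mem : (1 : R) ∈ 𝒜 0
  mul_mem : ∀ (m n : ℕ) (a b : R), a ∈ 𝒜 m → b ∈ 𝒜 n → a * b ∈ 𝒜 (m + n)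
  degree_zero : ∀ a ∈ 𝒜 0, ∃ c : k, a = algebraMap k R c
  finite : ∀ n, FiniteDimensional k (𝒜 n)

/-- The Hilbert series `∑ (dim R_n) s ^ n`. -/
def hilbertSeries (𝒜 : ℕ → Submodule k R) : PowerSeries ℚ :=
  PowerSeries.mk fun n => (Module.finrank k (𝒜 n) : ℚ)

/-- The augmentation ideal `R_{≥ 1}`, as a right ideal. -/
def augmentationIdeal (𝒜 : ℕ → Submodule k R) : Submodule Rᵐᵒᵖ R :=
  Submodule.span Rᵐᵒᵖ {a : R | ∃ n, 1 ≤ n ∧ a ∈ 𝒜 n}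

/-- The trivial right module `k = R / R_{≥ 1}`. -/
def trivialModule (𝒜 : ℕ → Submodule k R) : ModuleCat.{u} Rᵐᵒᵖ :=
  ModuleCat.of Rᵐᵒᵖ (R ⧸ augmentationIdeal 𝒜)

/-- `R` as a right module over itself. -/
def rightRegular (R : Type u) [Ring R] : ModuleCat.{u} Rᵐᵒᵖ := ModuleCat.of Rᵐᵒᵖ R

/-- `Ext^i_R(k, M)` for the trivial right module `k` and a right module `M`;
it is a `k`-vector space. -/
abbrev ExtTrivial (𝒜 : ℕ → Submodule k R) (M : ModuleCat.{u} Rᵐᵒᵖ) (i : ℕ) : Type u :=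
  Abelian.Ext (trivialModule 𝒜) M i

/-- Left multiplication by a matrix with entries in `R`, as a map of right modules
`R ^ n → R ^ m` between modules of column vectors. -/
def matrixMap {m n : ℕ} (A : Matrix (Fin m) (Fin n) R) : (Fin n → R) →ₗ[Rᵐᵒᵖ] (Fin m → R) :=
  Matrix.mulVecBilin R Rᵐᵒᵖ A

/-- `R` is Koszul: it is connected graded and the trivial right module has a linear free resolution
`⋯ → R[-2] ^ (b 2) → R[-1] ^ (b 1) → R → k → 0`.  A matrix describes a degree-preserving map
`R[-n-1] ^ (b (n+1)) → R[-n] ^ (b n)` precisely when its entries have degree `1`. -/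
def IsKoszul (𝒜 : ℕ → Submodule k R) : Prop :=
  IsConnectedGraded 𝒜 ∧
  ∃ (b : ℕ → ℕ) (d : ∀ n, Matrix (Fin (b n)) (Fin (b (n + 1))) R),
    b 0 = 1 ∧
    (∀ n i j, d n i j ∈ 𝒜 1) ∧
    (∀ x : Fin (b 0) → R,
      x ∈ LinearMap.range (matrixMap (d 0)) ↔ ∀ i, x i ∈ augmentationIdeal 𝒜) ∧
    ∀ n, Function.Exact (matrixMap (d (n + 1))) (matrixMap (d n))

/-- The supremum of the projective dimensions of all left modules. -/
def leftGlobalDimension (R : Type u) [Ring R] : WithBot ℕ∞ :=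
  ⨆ M : ModuleCat.{u} R, projectiveDimension M

/-- The supremum of the projective dimensions of all right modules. -/
def rightGlobalDimension (R : Type u) [Ring R] : WithBot ℕ∞ :=
  ⨆ M : ModuleCat.{u} Rᵐᵒᵖ, projectiveDimension M

/-- The Gelfand-Kirillov dimension of the `k`-algebra `R`: the supremum, over the
finite-dimensional subspaces `V`, of `limsup (log dim (k + V) ^ n / log n)`. -/
def gkDimension (k : Type u) [Field k] (R : Type u) [Ring R] [Algebra k R] : EReal :=
  ⨆ V : {V : Submodule k R // FiniteDimensional k V},
    Filter.limsup (fun n : ℕ =>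
      ((Real.log (Module.finrank k ((1 ⊔ V.1) ^ n : Submodule k R)) / Real.log n : ℝ) : EReal))
      Filter.atTop

/-- The Artin-Schelter Gorenstein condition in dimension `d`: the left and the right injective
dimension of `R` are `d`, `Ext^i_R(k, R) = 0` for `i ≠ d`, and `Ext^d_R(k, R)` is a shift of `k`,
that is, one-dimensional (a graded vector space is a shift of `k` if and only if it is
one-dimensional). -/
def IsASGorensteinOfDim (𝒜 : ℕ → Submodule k R) (d : ℕ) : Prop :=
  injectiveDimension (ModuleCat.of R R) = (d : ℕ∞) ∧
  injectiveDimension (rightRegular R) = (d : ℕ∞) ∧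
  (∀ i, i ≠ d → Subsingleton (ExtTrivial 𝒜 (rightRegular R) i)) ∧
  Module.finrank k (ExtTrivial 𝒜 (rightRegular R) d) = 1

def IsASGorenstein (𝒜 : ℕ → Submodule k R) : Prop := ∃ d, IsASGorensteinOfDim 𝒜 d

/-- Artin-Schelter regular: AS-Gorenstein, of finite global dimension (equal to the injective
dimension) and of finite GK-dimension. -/
def IsASRegular (𝒜 : ℕ → Submodule k R) : Prop :=
  ∃ d : ℕ, IsASGorensteinOfDim 𝒜 d ∧
    leftGlobalDimension R = (d : ℕ∞) ∧ rightGlobalDimension R = (d : ℕ∞) ∧ gkDimension k R ≠ ⊤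

/-- The right module `M` admits a grading by the integers that makes it a graded `R`-module. -/
def IsGradable (𝒜 : ℕ → Submodule k R) (M : ModuleCat.{u} Rᵐᵒᵖ) : Prop :=
  ∃ ℳ : ℤ → AddSubgroup M, DirectSum.IsInternal ℳ ∧
    ∀ (n : ℕ) (i : ℤ) (a : R) (x : M), a ∈ 𝒜 n → x ∈ ℳ i → op a • x ∈ ℳ (i + n)

/-- The condition `χ_i` on the right: `dim Ext^j_R(k, M) < ∞` for all `j ≤ i` and all finitely
generated graded right modules `M`. -/
def SatisfiesChi (𝒜 : ℕ → Submodule k R) (i : ℕ) : Prop :=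
  ∀ M : ModuleCat.{u} Rᵐᵒᵖ, Module.Finite Rᵐᵒᵖ M → IsGradable 𝒜 M →
    ∀ j ≤ i, FiniteDimensional k (ExtTrivial 𝒜 M j)

/-- The depth of `M`: the least `i` with `Ext^i_R(k, M) ≠ 0` (and `∞` if there is none). -/
def depth (𝒜 : ℕ → Submodule k R) (M : ModuleCat.{u} Rᵐᵒᵖ) : ℕ∞ :=
  sInf {e : ℕ∞ | ∃ i : ℕ, e = i ∧ Nontrivial (ExtTrivial 𝒜 M i)}

/-- The Auslander-Buchsbaum formula `pd M + depth M = depth R` for the right module `M`. -/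
def AuslanderBuchsbaumFormula (𝒜 : ℕ → Submodule k R) (M : ModuleCat.{u} Rᵐᵒᵖ) : Prop :=
  projectiveDimension M + ((depth 𝒜 M : ℕ∞) : WithBot ℕ∞) =
    ((depth 𝒜 (rightRegular R) : ℕ∞) : WithBot ℕ∞)

end Graded

/-! ### The function field `k(u, v)` and the automorphisms `σ`, `τ`, `φ` -/

section FunctionField

variable (k : Type u) [Field k]

/-- The rational function field `K = k(u, v)`. -/
abbrev FunctionField : Type u := FractionRing (MvPolynomial (Fin 2) k)

def coordU : FunctionField k := algebraMap (MvPolynomial (Fin 2) k) _ (MvPolynomial.X 0)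

def coordV : FunctionField k := algebraMap (MvPolynomial (Fin 2) k) _ (MvPolynomial.X 1)

variable {k}

lemma adjoin_coord (L : IntermediateField k (FunctionField k)) (hu : coordU k ∈ L)
    (hv : coordV k ∈ L) : L = ⊤ := by
  have hp : ∀ p : MvPolynomial (Fin 2) k, algebraMap _ (FunctionField k) p ∈ L := by
    intro p
    induction p using MvPolynomial.induction_on with
    | C a =>
      have : algebraMap (MvPolynomial (Fin 2) k) (FunctionField k) (MvPolynomial.C a)
          = algebraMap k (FunctionField k) a := by
        rw [IsScalarTower.algebraMap_apply k (MvPolynomial (Fin 2) k) (FunctionField k)]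
        rfl
      rw [this]
      exact L.algebraMap_mem a
    | add p q hp hq => rw [map_add]; exact L.add_mem hp hq
    | mul_X p i hp =>
      rw [map_mul]
      refine L.mul_mem hp ?_
      fin_cases i
      · exact hu
      · exact hv
  refine eq_top_iff.2 fun x _ => ?_
  obtain ⟨a, b, _, rfl⟩ := IsFractionRing.div_surjective (MvPolynomial (Fin 2) k) x
  exact L.div_mem (hp a) (hp b)

lemma algebraicIndependent_of_adjoin (a b : FunctionField k)
    (hu : coordU k ∈ IntermediateField.adjoin k {a, b})
    (hv : coordV k ∈ IntermediateField.adjoin k {a, b}) :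
    AlgebraicIndependent k ![a, b] := by
  have htop := adjoin_coord _ hu hv
  have halg : Algebra.IsAlgebraic (Algebra.adjoin k (Set.range ![a, b])) (FunctionField k) := by
    rw [Matrix.range_cons, Matrix.range_cons, Matrix.range_empty, Set.union_empty,
      Set.singleton_union]
    refine ⟨fun x => ?_⟩
    have hx : x ∈ IntermediateField.adjoin k {a, b} := by rw [htop]; trivial
    obtain ⟨r, hr, s, hs, rfl⟩ := IntermediateField.mem_adjoin_iff_div.1 hx
    have h1 := isAlgebraic_algebraMap (A := FunctionField k)
      (⟨r, hr⟩ : Algebra.adjoin k {a, b})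
    have h2 := isAlgebraic_algebraMap (A := FunctionField k)
      (⟨s, hs⟩ : Algebra.adjoin k {a, b})
    rw [div_eq_mul_inv]
    exact h1.mul h2.inv
  refine (Algebra.IsAlgebraic.isTranscendenceBasis_of_lift_le_trdeg_of_finite k _ ?_).1
  have : AlgebraicIndependent k fun i : Fin 2 =>
      algebraMap (MvPolynomial (Fin 2) k) (FunctionField k) (MvPolynomial.X i) :=
    (MvPolynomial.algebraicIndependent_X (Fin 2) k).map' (f := IsScalarTower.toAlgHom k _ _)
      (IsFractionRing.injective _ _)
  exact this.lift_cardinalMk_le_trdeg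

/-- The endomorphism of `k(u, v)` over `k` with `u ↦ a`, `v ↦ b`. -/
def substitutionHom (a b : FunctionField k) (h : AlgebraicIndependent k ![a, b]) :
    FunctionField k →ₐ[k] FunctionField k :=
  IsLocalization.liftAlgHom (M := nonZeroDivisors (MvPolynomial (Fin 2) k))
    (f := MvPolynomial.aeval ![a, b])
    fun y => IsUnit.mk0 _ fun h0 =>
      nonZeroDivisors.coe_ne_zero y (h (h0.trans (map_zero (MvPolynomial.aeval ![a, b])).symm))

lemma substitutionHom_X (a b : FunctionField k) (h : AlgebraicIndependent k ![a, b])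
    (i : Fin 2) :
    substitutionHom a b h (algebraMap (MvPolynomial (Fin 2) k) _ (MvPolynomial.X i)) =
      ![a, b] i := by
  refine (IsLocalization.lift_eq _ _).trans ?_
  simp

/-- The automorphism of `k(u, v)` over `k` with `u ↦ a`, `v ↦ b`, where `k(a, b) = k(u, v)`. -/
def substitution (a b : FunctionField k)
    (hu : coordU k ∈ IntermediateField.adjoin k {a, b})
    (hv : coordV k ∈ IntermediateField.adjoin k {a, b}) :
    FunctionField k ≃ₐ[k] FunctionField k :=
  AlgEquiv.ofBijective (substitutionHom a b (algebraicIndependent_of_adjoin a b hu hv)) <| by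
    refine ⟨(substitutionHom a b _).toRingHom.injective, ?_⟩
    rw [← AlgHom.fieldRange_eq_top]
    have h : IntermediateField.adjoin k {a, b} ≤
        (substitutionHom a b (algebraicIndependent_of_adjoin a b hu hv)).fieldRange := by
      rw [IntermediateField.adjoin_le_iff]
      rintro x (rfl | rfl)
      · exact ⟨coordU k, substitutionHom_X _ _ _ 0⟩
      · exact ⟨coordV k, substitutionHom_X _ _ _ 1⟩
    exact adjoin_coord _ (h hu) (h hv)

lemma substitution_coordU (a b : FunctionField k) (hu hv) :
    substitution a b hu hv (coordU k) = a :=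
  substitutionHom_X _ _ (algebraicIndependent_of_adjoin a b hu hv) 0

lemma substitution_coordV (a b : FunctionField k) (hu hv) :
    substitution a b hu hv (coordV k) = b :=
  substitutionHom_X _ _ (algebraicIndependent_of_adjoin a b hu hv) 1

/-- The fractional linear transformation
`x ↦ ((c + 1) x + (c - 1)) / ((c - 1) x + (c + 1))`. -/
def moebius (c : k) (x : FunctionField k) : FunctionField k :=
  (algebraMap k _ (c + 1) * x + algebraMap k _ (c - 1)) /
    (algebraMap k _ (c - 1) * x + algebraMap k _ (c + 1))

lemma coord_ne_zero (i : Fin 2) (p q : k) (h : p ≠ 0 ∨ q ≠ 0) :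
    algebraMap k (FunctionField k) p *
      algebraMap (MvPolynomial (Fin 2) k) (FunctionField k) (MvPolynomial.X i) +
      algebraMap k (FunctionField k) q ≠ 0 := by
  rw [IsScalarTower.algebraMap_apply k (MvPolynomial (Fin 2) k) (FunctionField k),
    IsScalarTower.algebraMap_apply k (MvPolynomial (Fin 2) k) (FunctionField k),
    ← map_mul, ← map_add]
  intro h0
  have h1 := (IsFractionRing.to_map_eq_zero_iff (K := FunctionField k)).1 h0
  have e0 := congrArg (MvPolynomial.eval (fun _ => (0 : k))) h1
  have e1 := congrArg (MvPolynomial.eval (fun _ => (1 : k))) h1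
  simp [MvPolynomial.algebraMap_eq] at e0 e1
  grind

lemma coord_mem_adjoin_moebius [NeZero (2 : k)] (c : kˣ) (i : Fin 2)
    (L : IntermediateField k (FunctionField k))
    (h : moebius (c : k)
      (algebraMap (MvPolynomial (Fin 2) k) (FunctionField k) (MvPolynomial.X i)) ∈ L) :
    algebraMap (MvPolynomial (Fin 2) k) (FunctionField k) (MvPolynomial.X i) ∈ L := by
  set x := algebraMap (MvPolynomial (Fin 2) k) (FunctionField k) (MvPolynomial.X i) with hx
  have h2 : (2 : k) ≠ 0 := NeZero.ne _
  have hc : (c : k) ≠ 0 := c.ne_zero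
  have hD : algebraMap k (FunctionField k) ((c : k) - 1) * x
      + algebraMap k (FunctionField k) ((c : k) + 1) ≠ 0 := by
    apply coord_ne_zero
    by_contra! hh
    apply h2
    linear_combination hh.2 - hh.1
  have h4 : algebraMap k (FunctionField k) (4 * (c : k)) ≠ 0 := by
    rw [Ne, map_eq_zero]
    have : (4 : k) = 2 * 2 := by norm_num
    rw [this]
    exact mul_ne_zero (mul_ne_zero h2 h2) hc
  set m := moebius (c : k) x with hm
  have hm' : m * (algebraMap k (FunctionField k) ((c : k) - 1) * x
      + algebraMap k (FunctionField k) ((c : k) + 1)) =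
      algebraMap k _ ((c : k) + 1) * x + algebraMap k _ ((c : k) - 1) := by
    rw [hm, moebius, div_mul_cancel₀ _ hD]
  have key : (algebraMap k (FunctionField k) ((c : k) + 1)
      - algebraMap k (FunctionField k) ((c : k) - 1) * m) * x =
      algebraMap k (FunctionField k) ((c : k) + 1) * m
        - algebraMap k (FunctionField k) ((c : k) - 1) := by
    linear_combination -hm'
  have hE : algebraMap k (FunctionField k) ((c : k) + 1)
      - algebraMap k (FunctionField k) ((c : k) - 1) * m ≠ 0 := by
    intro h0
    have hh : (algebraMap k (FunctionField k) ((c : k) + 1)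
      - algebraMap k (FunctionField k) ((c : k) - 1) * m) *
      (algebraMap k (FunctionField k) ((c : k) - 1) * x
      + algebraMap k (FunctionField k) ((c : k) + 1)) = algebraMap k _ (4 * (c : k)) := by
      have : algebraMap k (FunctionField k) (4 * (c : k)) =
          algebraMap k _ ((c : k) + 1) * algebraMap k _ ((c : k) + 1) -
          algebraMap k _ ((c : k) - 1) * algebraMap k _ ((c : k) - 1) := by
        rw [← map_mul, ← map_mul, ← map_sub]
        congr 1
        ring
      rw [this]
      linear_combination (-algebraMap k (FunctionField k) ((c : k) - 1)) * hm'
    rw [h0, zero_mul] at hh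
    exact h4 hh.symm
  have : x = (algebraMap k (FunctionField k) ((c : k) + 1) * m
        - algebraMap k (FunctionField k) ((c : k) - 1)) /
      (algebraMap k (FunctionField k) ((c : k) + 1)
      - algebraMap k (FunctionField k) ((c : k) - 1) * m) := by
    rw [eq_div_iff hE, ← key]
    ring
  rw [this]
  have ha : ∀ a : k, algebraMap k (FunctionField k) a ∈ L := L.algebraMap_mem
  exact L.div_mem (L.sub_mem (L.mul_mem (ha _) h) (ha _))
    (L.sub_mem (ha _) (L.mul_mem (ha _) h))

variable (k) in
/-- The automorphism `σ`: `u ↦ u v`, `v ↦ v`. -/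
def sigma : FunctionField k ≃ₐ[k] FunctionField k :=
  substitution (coordU k * coordV k) (coordV k)
    (by
      have hv : coordV k ≠ 0 := by simp [coordV]
      have := IntermediateField.subset_adjoin k {coordU k * coordV k, coordV k}
      have h := IntermediateField.div_mem _ (this (Or.inl rfl)) (this (Or.inr rfl))
      rwa [mul_div_cancel_right₀ _ hv] at h)
    (IntermediateField.subset_adjoin k _ (Or.inr rfl))

/-- The automorphism `τ(ρ, θ)`:
`u ↦ ((ρ + 1) u + (ρ - 1)) / ((ρ - 1) u + (ρ + 1))` and
`v ↦ ((θ + 1) v + (θ - 1)) / ((θ - 1) v + (θ + 1))`. -/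
def tau [NeZero (2 : k)] (ρ θ : kˣ) : FunctionField k ≃ₐ[k] FunctionField k :=
  substitution (moebius (ρ : k) (coordU k)) (moebius (θ : k) (coordV k))
    (coord_mem_adjoin_moebius ρ 0 _ (IntermediateField.subset_adjoin k _ (Or.inl rfl)))
    (coord_mem_adjoin_moebius θ 1 _ (IntermediateField.subset_adjoin k _ (Or.inr rfl)))

/-- `φ = σ ∘ τ(ρ, θ)`. -/
def phi [NeZero (2 : k)] (ρ θ : kˣ) : FunctionField k ≃ₐ[k] FunctionField k :=
  (tau ρ θ).trans (sigma k)

lemma phi_coordU [NeZero (2 : k)] (ρ θ : kˣ) :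
    phi ρ θ (coordU k) = moebius (ρ : k) (coordU k * coordV k) := by
  simp only [phi, AlgEquiv.trans_apply, tau, substitution_coordU, moebius, map_div₀, map_add,
    map_mul, AlgEquiv.commutes, sigma]

lemma phi_coordV [NeZero (2 : k)] (ρ θ : kˣ) :
    phi ρ θ (coordV k) = moebius (θ : k) (coordV k) := by
  simp only [phi, AlgEquiv.trans_apply, tau, substitution_coordV, moebius, map_div₀, map_add,
    map_mul, AlgEquiv.commutes, sigma]

end FunctionField

/-! ### Skew Laurent polynomial rings `K[t, t⁻¹; φ]` -/

section SkewLaurent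

variable {k : Type u} [Field k] {K : Type u} [Field K] [Algebra k K]

/-- A copy of the field `K`, on which `ℤ` acts through the powers of `φ`. -/
def Twisted (_φ : K ≃ₐ[k] K) : Type u := K

instance (φ : K ≃ₐ[k] K) : Field (Twisted φ) := inferInstanceAs (Field K)

instance (φ : K ≃ₐ[k] K) : Algebra k (Twisted φ) := inferInstanceAs (Algebra k K)

instance (φ : K ≃ₐ[k] K) : MulSemiringAction (Multiplicative ℤ) (Twisted φ) :=
  MulSemiringAction.compHom K (zpowersHom (K ≃ₐ[k] K) φ)

instance (φ : K ≃ₐ[k] K) : SMulCommClass (Multiplicative ℤ) k (Twisted φ) :=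
  ⟨fun n c x => map_smul (zpowersHom (K ≃ₐ[k] K) φ n) c (show K from x)⟩

/-- The skew Laurent polynomial ring `K[t, t⁻¹; φ]`, whose elements are the finite sums
`∑ a_n t ^ n` (`n ∈ ℤ`), with multiplication determined by `t a = φ(a) t`. -/
abbrev SkewLaurent (φ : K ≃ₐ[k] K) : Type u := SkewMonoidAlgebra (Twisted φ) (Multiplicative ℤ)

/-- The element `a t ^ n` of `K[t, t⁻¹; φ]`. -/
def monomial (φ : K ≃ₐ[k] K) (n : ℤ) (a : K) : SkewLaurent φ :=
  SkewMonoidAlgebra.single (Multiplicative.ofAdd n) (show Twisted φ from a)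

lemma monomial_mul_monomial (φ : K ≃ₐ[k] K) (m n : ℤ) (a b : K) :
    monomial φ m a * monomial φ n b = monomial φ (m + n) (a * (φ ^ m) b) :=
  SkewMonoidAlgebra.single_mul_single

lemma monomial_add (φ : K ≃ₐ[k] K) (n : ℤ) (a b : K) :
    monomial φ n (a + b) = monomial φ n a + monomial φ n b :=
  SkewMonoidAlgebra.single_add _ a b

lemma monomial_zero (φ : K ≃ₐ[k] K) (n : ℤ) : monomial φ n 0 = 0 :=
  SkewMonoidAlgebra.single_zero _

lemma monomial_smul (φ : K ≃ₐ[k] K) (n : ℤ) (c : k) (a : K) :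
    monomial φ n (c • a) = c • monomial φ n a :=
  (SkewMonoidAlgebra.smul_single (k := Twisted φ) c (Multiplicative.ofAdd n) a).symm

end SkewLaurent

/-! ### The algebras `R(τ)` and `S(τ)` and the complex -/

section Algebras

variable {k : Type u} [Field k]

variable (k) in
/-- `E = k + k u + k v + k u v`. -/
def spaceE : Submodule k (FunctionField k) :=
  Submodule.span k {1, coordU k, coordV k, coordU k * coordV k}

/-- The relations `f_1, …, f_6` of `S(τ)`. -/
def relations (ρ θ : kˣ) : Fin 6 → FreeAlgebra k (Fin 4) :=
  let x₁ := FreeAlgebra.ι k (0 : Fin 4)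
  let x₂ := FreeAlgebra.ι k (1 : Fin 4)
  let x₃ := FreeAlgebra.ι k (2 : Fin 4)
  let x₄ := FreeAlgebra.ι k (3 : Fin 4)
  let γ : k := ρ + 1
  let δ : k := ρ - 1
  let ε : k := θ + 1
  let ζ : k := θ - 1
  ![x₁ * (ζ • x₁ - ε • x₃) + x₃ * (ε • x₁ - ζ • x₃),
    x₁ * (ζ • x₂ - ε • x₄) + x₃ * (ε • x₂ - ζ • x₄),
    x₂ * (ζ • x₁ - ε • x₃) + x₄ * (ε • x₁ - ζ • x₃),
    x₂ * (ζ • x₂ - ε • x₄) + x₄ * (ε • x₂ - ζ • x₄),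
    x₁ * (δ • x₁ - γ • x₂) + x₄ * (γ • x₁ - δ • x₂),
    x₁ * (δ • x₃ - γ • x₄) + x₄ * (γ • x₃ - δ • x₄)]

/-- `S(τ) = k⟨x₁, x₂, x₃, x₄⟩ / (f₁, …, f₆)`. -/
abbrev algebraS (ρ θ : kˣ) : Type u :=
  RingQuot fun a b : FreeAlgebra k (Fin 4) => b = 0 ∧ ∃ i, a = relations ρ θ i

/-- The class of `x_{i+1}` in `S(τ)`. -/
def generatorS (ρ θ : kˣ) (i : Fin 4) : algebraS ρ θ :=
  RingQuot.mkAlgHom k _ (FreeAlgebra.ι k i)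

variable [NeZero (2 : k)]

/-- `R(τ) = k⟨E t⟩ ⊆ K[t, t⁻¹; φ]`. -/
def algebraR (ρ θ : kˣ) : Subalgebra k (SkewLaurent (phi ρ θ)) :=
  Algebra.adjoin k {x | ∃ f ∈ spaceE k, x = monomial (phi ρ θ) 1 f}

/-- The degree-`n` piece `R(τ)_n = R(τ) ∩ K t ^ n`. -/
def gradingR (ρ θ : kˣ) (n : ℕ) : Submodule k (algebraR ρ θ) where
  carrier := {x | ∃ a, (x : SkewLaurent (phi ρ θ)) = monomial (phi ρ θ) n a}
  zero_mem' := ⟨0, by simp [monomial_zero]⟩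
  add_mem' := by
    rintro x y ⟨a, ha⟩ ⟨b, hb⟩
    exact ⟨a + b, by rw [monomial_add, ← ha, ← hb]; rfl⟩
  smul_mem' := by
    rintro c x ⟨a, ha⟩
    exact ⟨c • a, by rw [monomial_smul, ← ha]; rfl⟩

/-- The generators `r₁ = t`, `r₂ = u t`, `r₃ = v t`, `r₄ = u v t` of `R(τ)`. -/
def generatorR (ρ θ : kˣ) (i : Fin 4) : algebraR ρ θ :=
  ⟨monomial (phi ρ θ) 1 (![1, coordU k, coordV k, coordU k * coordV k] i), by
    refine Algebra.subset_adjoin ⟨_, Submodule.subset_span ?_, rfl⟩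
    fin_cases i <;> simp⟩

/-- The elements `z₁, …, z₁₀` of `R(τ)_1`, at the indices `0, …, 9`; they are written as linear
combinations of `r₁ = t`, `r₂ = u t`, `r₃ = v t`, `r₄ = u v t`.  The last two are
`z₉ = (γ u - δ) (-ζ v + ε) t` and `z₁₀ = (δ u - γ) (ε v - ζ) t`, expanded. -/
def elementZ (ρ θ : kˣ) : Fin 10 → algebraR ρ θ :=
  let r₁ := generatorR ρ θ 0
  let r₂ := generatorR ρ θ 1
  let r₃ := generatorR ρ θ 2
  let r₄ := generatorR ρ θ 3
  let γ : k := ρ + 1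
  let δ : k := ρ - 1
  let ε : k := θ + 1
  let ζ : k := θ - 1
  ![ζ • r₁ - ε • r₃,
    ε • r₁ - ζ • r₃,
    ζ • r₂ - ε • r₄,
    ε • r₂ - ζ • r₄,
    δ • r₁ - γ • r₂,
    γ • r₁ - δ • r₂,
    δ • r₃ - γ • r₄,
    γ • r₃ - δ • r₄,
    -(γ * ζ) • r₄ + (γ * ε) • r₂ + (δ * ζ) • r₃ - (δ * ε) • r₁,
    (δ * ε) • r₄ - (δ * ζ) • r₂ - (γ * ε) • r₃ + (γ * ζ) • r₁]

def matrixM (ρ θ : kˣ) : Matrix (Fin 4) (Fin 1) (algebraR ρ θ) :=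
  let z := elementZ ρ θ
  !![0; 0; z 8; z 9]

def matrixN (ρ θ : kˣ) : Matrix (Fin 6) (Fin 4) (algebraR ρ θ) :=
  let z := elementZ ρ θ
  !![z 8, 0, 0, 0;
     z 9, 0, 0, 0;
     0, z 8, 0, 0;
     0, z 9, 0, 0;
     0, 0, z 0, z 2;
     0, 0, z 1, z 3]

def matrixP (ρ θ : kˣ) : Matrix (Fin 4) (Fin 6) (algebraR ρ θ) :=
  let z := elementZ ρ θ
  !![z 0, z 2, 0, 0, z 4, z 6;
     0, 0, z 0, z 2, 0, 0;
     z 1, z 3, 0, 0, 0, 0;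
     0, 0, z 1, z 3, z 5, z 7]

def matrixQ (ρ θ : kˣ) : Matrix (Fin 1) (Fin 4) (algebraR ρ θ) :=
  let r := generatorR ρ θ
  !![r 0, r 1, r 2, r 3]

/-- The projection `R → k = R / R_{≥ 1}` (on column vectors with one entry). -/
def augmentation (ρ θ : kˣ) :
    (Fin 1 → algebraR ρ θ) →ₗ[(algebraR ρ θ)ᵐᵒᵖ]
      (algebraR ρ θ ⧸ augmentationIdeal (gradingR ρ θ)) :=
  (augmentationIdeal (gradingR ρ θ)).mkQ ∘ₗ LinearMap.proj 0

/-- Exactness of the complex of right modules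
`0 → R[-4] → R[-3]⁴ → R[-2]⁶ → R[-1]⁴ → R → k → 0`, with maps `M`, `N`, `P`, `Q`. -/
def KoszulComplexExact (ρ θ : kˣ) : Prop :=
  Function.Injective (matrixMap (matrixM ρ θ)) ∧
  Function.Exact (matrixMap (matrixM ρ θ)) (matrixMap (matrixN ρ θ)) ∧
  Function.Exact (matrixMap (matrixN ρ θ)) (matrixMap (matrixP ρ θ)) ∧
  Function.Exact (matrixMap (matrixP ρ θ)) (matrixMap (matrixQ ρ θ)) ∧
  Function.Exact (matrixMap (matrixQ ρ θ)) (augmentation ρ θ) ∧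
  Function.Surjective (augmentation ρ θ)

end Algebras

/-! ### General subsets of `𝔾 = k* × k*` -/

section General

variable {k : Type u} [Field k]

/-- Zariski closed subsets of the torus `k* × k*`. -/
def IsZariskiClosed (Z : Set (kˣ × kˣ)) : Prop :=
  ∃ I : Set (MvPolynomial (Fin 2) k),
    Z = {p | ∀ f ∈ I, MvPolynomial.eval ![(p.1 : k), (p.2 : k)] f = 0}

/-- The complement of a countable union of proper closed subvarieties of `k* × k*`. -/
def IsGeneralSubset (U : Set (kˣ × kˣ)) : Prop :=
  ∃ Z : ℕ → Set (kˣ × kˣ),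
    (∀ n, IsZariskiClosed (Z n) ∧ Z n ≠ Set.univ) ∧ U = (⋃ n, Z n)ᶜ

end General

end BirationalSurface

end

/-! # The algebras `R(τ)` are Koszul of global dimension four, but not Gorenstein

Write `R_n = W_n t ^ n`, so that `W_{n+1} = E · φ(W_n)`.  A matrix whose entries have degree one acts
on columns of homogeneous elements by a `φ`-semilinear formula on coefficients (`twistMap`), and on
rows by `rowMap`.  All products of consecutive matrices `M`, `N`, `P`, `Q` vanish for all parameters;
this comes down to the two identities `phi_numU` and `phi_numV`, which say that `φ` maps `τ⁻¹(u)` to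
`u v` and `τ⁻¹(v)` to `v`.

*Exactness.*  Since the maps compose to zero, exactness in a given degree is a lower bound for ranks
(`mem_of_finrank_le`).  The spaces `W_n` are spanned by vectors that depend rationally on `(ρ, θ)`,
with integral coefficients.  So a given rank is at least its value at `(1, 1)` outside a closed set
that does not contain `(1, 1)` and is defined over the prime field (`holdsNearOne_finrank_span`);
removing these sets for the countably many ranks in question leaves the general subset of the
theorem (`exists_isGeneralSubset`).  At `(1, 1)` the automorphism is `u ↦ u v`, `v ↦ v`.  There `W_n`
is spanned by monomials with exponents in an explicit region with `(n + 3).choose 3` lattice points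
(`pieceW_one`, `exists_finset_exponents`), and the kernels of the four matrices are found by
intersecting such regions (`rankCol_one_shapeM`, `rankCol_one_shapeN`, `rankCol_one_shapeP`).  For
parameters in the general subset, induction on the degree shows that `dim W_n` has the value it has
at `(1, 1)`: the kernel of `Q` contains the image of `P`, which is large enough to bound `dim W_n`
from above (`finrank_pieceW`).  This gives the exactness of the complex, the Koszul property and the
Hilbert series.  The presentation follows by induction on the degree from exactness at the columns of
`P` (`eq_zero_of_homSR_eq_zero`).

*Ext groups.*  `Ext^i_R(k, R)` is the cohomology of the complex of rows.  It vanishes for `i = 1` by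
the same comparison of ranks (`rankRow_one_shapeP`, `exists_eq_mul_generatorR`).  For `i = 2, 3, 4`
there is in each positive degree a cocycle that is not a coboundary.  Indeed, with `U = τ⁻¹(u)` and
`V = τ⁻¹(v)`, coboundaries of the relevant kind have coefficients in `φ^n(U) W_n + φ^n(V) W_n`, up
to a common factor, or the same with `U⁻¹` and `V⁻¹`.  As these elements are algebraically
independent, Nakayama's lemma over a polynomial ring in two variables shows that this space does not
contain the nonzero finite-dimensional space `W_n` (`exists_forall_ne_mul_add_mul`).  Cocycles in
different degrees being independent modulo coboundaries, the three spaces are infinite-dimensional.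

*Global dimension.*  The matrices `Q`, `P`, `N`, `M` are the right-hand parts of the differentials
of a complex of free bimodules, whose left-hand parts are `sideQ`, `sideP`, `sideN`,
`sideM`.  Tensored with a right module it gives a complex with differentials `d ⊗ 1 + 1 ⊗ e`; since
`d` raises the degree in the first factor and `e` preserves it, exactness follows from that of the
complex with differentials `d` (`exact_mixedMap`).  So every right module has a free resolution of
length four (`hasProjectiveDimensionLT_five`), and `Ext^4_R(k, R) ≠ 0` shows that four is
attained.  On the left side, `R(ρ, θ)` is opposite to `R(ρ⁻¹, θ⁻¹)` (`exists_ringEquiv_opposite`),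
and the general subset is chosen so that the rank conditions hold at the inverse parameters too. -/

noncomputable section

namespace BirationalSurface

/-! ### Coefficients in skew Laurent rings and the graded pieces of `k⟨Et⟩` -/

section Coefficients

variable {k : Type u} [Field k] {K : Type u} [Field K] [Algebra k K] (φ : K ≃ₐ[k] K)

/-- The coefficient of `t ^ n` in an element of `K[t, t⁻¹; φ]`. -/
def coeffAt (n : ℤ) : SkewLaurent φ →ₗ[k] K where
  toFun x := show Twisted φ from x.coeff (Multiplicative.ofAdd n)
  map_add' x y := congrArg (fun f => f (Multiplicative.ofAdd n)) (SkewMonoidAlgebra.coeff_add x y)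
  map_smul' c x := congrArg (fun f => f (Multiplicative.ofAdd n)) (SkewMonoidAlgebra.coeff_smul c x)

lemma ext_coeffAt {x y : SkewLaurent φ} (h : ∀ n, coeffAt φ n x = coeffAt φ n y) : x = y :=
  SkewMonoidAlgebra.ext fun a => h a.toAdd

lemma coeffAt_monomial_same (n : ℤ) (a : K) : coeffAt φ n (monomial φ n a) = a := by
  exact (congrArg (fun f => f (Multiplicative.ofAdd n))
    (SkewMonoidAlgebra.coeff_single (Multiplicative.ofAdd n) (show Twisted φ from a))).trans
    Finsupp.single_eq_same

lemma coeffAt_monomial_of_ne {m n : ℤ} (h : m ≠ n) (a : K) :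
    coeffAt φ n (monomial φ m a) = 0 := by
  have : (Multiplicative.ofAdd m : Multiplicative ℤ) ≠ Multiplicative.ofAdd n :=
    fun e => h (Multiplicative.ofAdd.injective e)
  exact (congrArg (fun f => f (Multiplicative.ofAdd n))
    (SkewMonoidAlgebra.coeff_single (Multiplicative.ofAdd m) (show Twisted φ from a))).trans
    (Finsupp.single_eq_of_ne this.symm)

lemma coeffAt_monomial_mul (m n : ℤ) (a : K) (x : SkewLaurent φ) :
    coeffAt φ n (monomial φ m a * x) = a * (φ ^ m) (coeffAt φ (n - m) x) := by
  have h := SkewMonoidAlgebra.coeff_single_mul (k := Twisted φ) a (Multiplicative.ofAdd m) x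
    (Multiplicative.ofAdd n)
  have e : (Multiplicative.ofAdd m)⁻¹ * Multiplicative.ofAdd n = Multiplicative.ofAdd (n - m) := by
    rw [← ofAdd_neg, ← ofAdd_add]; congr 1; ring
  rw [e] at h
  exact h

lemma coeffAt_mul_monomial (m n : ℤ) (a : K) (x : SkewLaurent φ) :
    coeffAt φ n (x * monomial φ m a) = coeffAt φ (n - m) x * (φ ^ (n - m)) a := by
  have h := SkewMonoidAlgebra.coeff_mul_single (k := Twisted φ) x a (Multiplicative.ofAdd m)
    (Multiplicative.ofAdd n)
  have e : Multiplicative.ofAdd n * (Multiplicative.ofAdd m)⁻¹ = Multiplicative.ofAdd (n - m) := by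
    rw [← ofAdd_neg, ← ofAdd_add]; congr 1
  rw [e] at h
  exact h

lemma monomial_zero_one : monomial φ 0 1 = 1 := rfl

variable (E : Submodule k K)

/-- `E · φ(E) ⋯ φ^{n-1}(E)`, the space of coefficients of the degree-`n` part of `k⟨Et⟩`. -/
def twistedPower : ℕ → Submodule k K
  | 0 => 1
  | n + 1 => E * (twistedPower n).map φ.toLinearMap

lemma twistedPower_zero : twistedPower φ E 0 = 1 := rfl

lemma twistedPower_succ (n : ℕ) :
    twistedPower φ E (n + 1) = E * (twistedPower φ E n).map φ.toLinearMap := rfl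

lemma one_mem_twistedPower_zero : (1 : K) ∈ twistedPower φ E 0 := Submodule.one_le.1 le_rfl

lemma map_pow_mul (n : ℕ) (A B : Submodule k K) :
    (A * B).map (φ ^ n : K ≃ₐ[k] K).toLinearMap =
      A.map (φ ^ n : K ≃ₐ[k] K).toLinearMap * B.map (φ ^ n : K ≃ₐ[k] K).toLinearMap :=
  Submodule.map_mul A B (φ ^ n : K ≃ₐ[k] K).toAlgHom

lemma map_pow_succ (n : ℕ) (A : Submodule k K) :
    (A.map (φ ^ n : K ≃ₐ[k] K).toLinearMap).map φ.toLinearMap =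
      A.map (φ ^ (n + 1) : K ≃ₐ[k] K).toLinearMap := by
  rw [← Submodule.map_comp, pow_succ']
  rfl

lemma twistedPower_mul (m n : ℕ) :
    twistedPower φ E m * (twistedPower φ E n).map (φ ^ m : K ≃ₐ[k] K).toLinearMap =
      twistedPower φ E (m + n) := by
  induction m with
  | zero =>
    rw [twistedPower_zero, one_mul, zero_add]
    exact Submodule.map_id _
  | succ m ih =>
    have h : twistedPower φ E (m + 1 + n) =
        E * (twistedPower φ E (m + n)).map φ.toLinearMap := by
      rw [show m + 1 + n = (m + n) + 1 by ring, twistedPower_succ]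
    have h2 := map_pow_mul φ 1 (twistedPower φ E m)
      ((twistedPower φ E n).map (φ ^ m : K ≃ₐ[k] K).toLinearMap)
    rw [pow_one] at h2
    rw [h, ← ih, twistedPower_succ, mul_assoc, h2, map_pow_succ]

/-- The piece can also be enlarged on the right: `W_{n+1} = W_n · φ^n(E)`. -/
lemma twistedPower_succ' (n : ℕ) :
    twistedPower φ E (n + 1) =
      twistedPower φ E n * E.map (φ ^ n : K ≃ₐ[k] K).toLinearMap := by
  have h1 : twistedPower φ E 1 = E := by
    rw [twistedPower_succ, twistedPower_zero]
    have : (1 : Submodule k K).map φ.toLinearMap = 1 :=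
      Submodule.map_one (φ : K →ₐ[k] K)
    rw [this, mul_one]
  rw [← twistedPower_mul, h1]

lemma mul_mem_twistedPower {m n : ℕ} {a b : K} (ha : a ∈ twistedPower φ E m)
    (hb : b ∈ twistedPower φ E n) : a * (φ ^ m) b ∈ twistedPower φ E (m + n) := by
  rw [← twistedPower_mul]
  exact Submodule.mul_mem_mul ha (Submodule.mem_map_of_mem hb)

lemma finiteDimensional_twistedPower [FiniteDimensional k E] (n : ℕ) :
    FiniteDimensional k (twistedPower φ E n) := by
  induction n with
  | zero =>
    rw [twistedPower_zero]
    exact (Submodule.fg_iff_finiteDimensional _).1 (Submodule.one_eq_span (R := k) (A := K) ▸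
      Submodule.fg_span_singleton _)
  | succ n ih =>
    rw [twistedPower_succ]
    have hE := Submodule.fg_iff_finiteDimensional E |>.2 inferInstance
    rw [← Submodule.fg_iff_finiteDimensional] at ih ⊢
    exact hE.mul (ih.map _)

/-- The algebra `k⟨Et⟩`. -/
abbrev twistedAlgebra : Subalgebra k (SkewLaurent φ) :=
  Algebra.adjoin k {x | ∃ f ∈ E, x = monomial φ 1 f}

lemma monomial_mem_twistedAlgebra (n : ℕ) {a : K} (ha : a ∈ twistedPower φ E n) :
    monomial φ n a ∈ twistedAlgebra φ E := by
  induction n generalizing a with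
  | zero =>
    rw [twistedPower_zero] at ha
    obtain ⟨c, rfl⟩ := Submodule.mem_one.1 ha
    rw [Algebra.algebraMap_eq_smul_one, monomial_smul]
    exact Subalgebra.smul_mem _ (Subalgebra.one_mem _) c
  | succ n ih =>
    rw [twistedPower_succ] at ha
    induction ha using Submodule.mul_induction_on' with
    | mem_mul_mem e he b hb =>
      obtain ⟨w, hw, rfl⟩ := hb
      have := monomial_mul_monomial φ 1 n e w
      rw [zpow_one, add_comm (1 : ℤ)] at this
      push_cast
      erw [← this]
      exact Subalgebra.mul_mem _ (Algebra.subset_adjoin ⟨e, he, rfl⟩) (ih hw)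
    | add x _ y _ hx hy =>
      rw [monomial_add]
      exact Subalgebra.add_mem _ hx hy

lemma mem_twistedAlgebra_span {x : SkewLaurent φ} (hx : x ∈ twistedAlgebra φ E) :
    x ∈ Submodule.span k {x | ∃ (n : ℕ) (a : K), a ∈ twistedPower φ E n ∧ x = monomial φ n a} := by
  induction hx using Algebra.adjoin_induction with
  | mem x hx =>
    obtain ⟨f, hf, rfl⟩ := hx
    refine Submodule.subset_span ⟨1, f, ?_, rfl⟩
    have := twistedPower_succ' φ E 0
    rw [twistedPower_zero, one_mul] at this
    rw [zero_add] at this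
    rw [this]
    exact ⟨f, hf, rfl⟩
  | algebraMap c =>
    rw [Algebra.algebraMap_eq_smul_one]
    refine Submodule.smul_mem _ _ (Submodule.subset_span ⟨0, 1, ?_, rfl⟩)
    exact one_mem_twistedPower_zero φ E
  | add x y _ _ hx hy => exact Submodule.add_mem _ hx hy
  | mul x y _ _ hx hy =>
    have := Submodule.mul_mem_mul hx hy
    rw [Submodule.span_mul_span] at this
    refine Submodule.span_mono ?_ this
    rintro _ ⟨_, ⟨m, a, ha, rfl⟩, _, ⟨n, b, hb, rfl⟩, rfl⟩
    refine ⟨m + n, _, mul_mem_twistedPower φ E ha hb, ?_⟩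
    push_cast
    exact monomial_mul_monomial φ m n a b

lemma coeffAt_mem_twistedPower {x : SkewLaurent φ} (hx : x ∈ twistedAlgebra φ E) (n : ℕ) :
    coeffAt φ n x ∈ twistedPower φ E n := by
  have := mem_twistedAlgebra_span φ E hx
  clear hx
  induction this using Submodule.span_induction with
  | mem x h =>
    obtain ⟨m, a, ha, rfl⟩ := h
    by_cases h : m = n
    · subst h; rwa [coeffAt_monomial_same]
    · rw [coeffAt_monomial_of_ne φ (by exact_mod_cast h)]; exact zero_mem _
  | zero => rw [map_zero]; exact zero_mem _
  | add x y _ _ hx hy => rw [map_add]; exact add_mem hx hy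
  | smul c x _ hx => rw [map_smul]; exact Submodule.smul_mem _ _ hx

/-- An element of `k⟨Et⟩` is the finite sum of its homogeneous parts. -/
lemma eq_sum_monomial {x : SkewLaurent φ} (hx : x ∈ twistedAlgebra φ E) :
    ∃ N : ℕ, ∀ n ≥ N, x = ∑ i ∈ Finset.range n, monomial φ i (coeffAt φ i x) := by
  have := mem_twistedAlgebra_span φ E hx
  clear hx
  induction this using Submodule.span_induction with
  | mem x h =>
    obtain ⟨m, a, ha, rfl⟩ := h
    refine ⟨m + 1, fun n hn => ?_⟩
    rw [Finset.sum_eq_single_of_mem m (Finset.mem_range.2 (by omega)), coeffAt_monomial_same]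
    intro b _ hb
    rw [coeffAt_monomial_of_ne φ (by exact_mod_cast hb.symm), monomial_zero]
  | zero => exact ⟨0, fun n _ => by simp [monomial_zero]⟩
  | add x y _ _ hx hy =>
    obtain ⟨N, hN⟩ := hx
    obtain ⟨M, hM⟩ := hy
    refine ⟨max N M, fun n hn => ?_⟩
    conv_lhs => rw [hN n (le_trans (le_max_left _ _) hn), hM n (le_trans (le_max_right _ _) hn)]
    simp only [map_add, monomial_add, Finset.sum_add_distrib]
  | smul c x _ hx =>
    obtain ⟨N, hN⟩ := hx
    refine ⟨N, fun n hn => ?_⟩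
    conv_lhs => rw [hN n hn]
    simp only [map_smul, monomial_smul, Finset.smul_sum]

end Coefficients

/-! ### The grading of `R(τ)` -/

/-- Submodules are the pieces of a grading if there are projections to them that are orthogonal and
of which finitely many sum up to the identity on any given element. -/
lemma isInternal_of_proj {k V : Type*} [Field k] [AddCommGroup V] [Module k V]
    (𝒜 : ℕ → Submodule k V) (p : ℕ → V →ₗ[k] V) (hp : ∀ n x, p n x ∈ 𝒜 n)
    (hp₁ : ∀ n, ∀ x ∈ 𝒜 n, p n x = x) (hp₀ : ∀ m n, ∀ x, m ≠ n → x ∈ 𝒜 m → p n x = 0)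
    (hs : ∀ x, ∃ N, x = ∑ i ∈ Finset.range N, p i x) : DirectSum.IsInternal 𝒜 := by
  constructor
  · intro f g h
    refine DFinsupp.ext fun n => Subtype.ext ?_
    have key : ∀ f : DirectSum ℕ fun n => 𝒜 n,
        p n (DirectSum.coeAddMonoidHom 𝒜 f) = f n := by
      intro f
      induction f using DirectSum.induction_on with
      | zero => simp
      | of i x =>
        rw [DirectSum.coeAddMonoidHom_of]
        by_cases hi : i = n
        · subst hi; rw [DirectSum.of_eq_same, hp₁ _ _ x.2]
        · rw [DirectSum.of_eq_of_ne _ _ _ (Ne.symm hi), hp₀ i n x hi x.2]; rfl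
      | add x y hx hy => rw [map_add, map_add, hx, hy]; rfl
    rw [← key, ← key, h]
  · intro x
    obtain ⟨N, hN⟩ := hs x
    refine ⟨∑ i ∈ Finset.range N, DirectSum.of (fun n => 𝒜 n) i ⟨p i x, hp i x⟩, ?_⟩
    rw [map_sum]
    conv_rhs => rw [hN]
    exact Finset.sum_congr rfl fun i _ => DirectSum.coeAddMonoidHom_of _ _ _

section Grading

variable {k : Type u} [Field k] [NeZero (2 : k)] (ρ θ : kˣ)

/-- The space of all `a ∈ K` with `a t ^ n ∈ R(τ)`. -/
abbrev pieceW (n : ℕ) : Submodule k (FunctionField k) := twistedPower (phi ρ θ) (spaceE k) n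

instance finiteDimensional_spaceE : FiniteDimensional k (spaceE k) :=
  FiniteDimensional.span_of_finite k (by simp)

instance finiteDimensional_pieceW (n : ℕ) : FiniteDimensional k (pieceW ρ θ n) :=
  finiteDimensional_twistedPower _ _ n

/-- The coefficient of `t ^ n` in an element of `R(τ)`. -/
def coeffR (n : ℤ) : algebraR ρ θ →ₗ[k] FunctionField k :=
  (coeffAt (phi ρ θ) n).comp (algebraR ρ θ).val.toLinearMap

lemma coeffR_apply (n : ℤ) (x : algebraR ρ θ) :
    coeffR ρ θ n x = coeffAt (phi ρ θ) n (x : SkewLaurent (phi ρ θ)) := rfl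

/-- The element `a t ^ n` of `R(τ)`. -/
def ofPiece (n : ℕ) : pieceW ρ θ n →ₗ[k] algebraR ρ θ where
  toFun a := ⟨monomial (phi ρ θ) n a, monomial_mem_twistedAlgebra _ _ n a.2⟩
  map_add' _ _ := Subtype.ext (monomial_add _ _ _ _)
  map_smul' _ _ := Subtype.ext (monomial_smul _ _ _ _)

variable {ρ θ}

lemma coe_ofPiece (n : ℕ) (a : pieceW ρ θ n) :
    (ofPiece ρ θ n a : SkewLaurent (phi ρ θ)) = monomial (phi ρ θ) n a := rfl

lemma ext_coeffR {x y : algebraR ρ θ} (h : ∀ n, coeffR ρ θ n x = coeffR ρ θ n y) : x = y :=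
  Subtype.ext (ext_coeffAt _ h)

lemma coeffR_mem (x : algebraR ρ θ) (n : ℕ) : coeffR ρ θ n x ∈ pieceW ρ θ n :=
  coeffAt_mem_twistedPower _ _ x.2 n

lemma coeffR_ofPiece_same (n : ℕ) (a : pieceW ρ θ n) : coeffR ρ θ n (ofPiece ρ θ n a) = a :=
  coeffAt_monomial_same _ _ _

lemma coeffR_ofPiece_of_ne {m : ℕ} {n : ℤ} (h : (m : ℤ) ≠ n) (a : pieceW ρ θ m) :
    coeffR ρ θ n (ofPiece ρ θ m a) = 0 :=
  coeffAt_monomial_of_ne _ h _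

lemma ofPiece_mem (n : ℕ) (a : pieceW ρ θ n) : ofPiece ρ θ n a ∈ gradingR ρ θ n := ⟨a, rfl⟩

lemma eq_ofPiece_of_mem {n : ℕ} {x : algebraR ρ θ} (hx : x ∈ gradingR ρ θ n) :
    x = ofPiece ρ θ n ⟨coeffR ρ θ n x, coeffR_mem x n⟩ := by
  obtain ⟨a, ha⟩ := hx
  apply Subtype.ext
  rw [coe_ofPiece]
  simp only [coeffR_apply]
  rw [ha, coeffAt_monomial_same]

lemma coeffR_of_mem_of_ne {m : ℕ} {n : ℤ} {x : algebraR ρ θ} (hx : x ∈ gradingR ρ θ m)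
    (h : (m : ℤ) ≠ n) : coeffR ρ θ n x = 0 := by
  rw [eq_ofPiece_of_mem hx, coeffR_ofPiece_of_ne h]

variable (ρ θ) in
/-- The projection of `R(τ)` to its degree-`n` piece. -/
def projR (n : ℕ) : algebraR ρ θ →ₗ[k] algebraR ρ θ :=
  (ofPiece ρ θ n).comp ((coeffR ρ θ n).codRestrict (pieceW ρ θ n) fun x => coeffR_mem x n)

lemma projR_apply (n : ℕ) (x : algebraR ρ θ) :
    projR ρ θ n x = ofPiece ρ θ n ⟨coeffR ρ θ n x, coeffR_mem x n⟩ := rfl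

lemma projR_mem (n : ℕ) (x : algebraR ρ θ) : projR ρ θ n x ∈ gradingR ρ θ n := ofPiece_mem n _

lemma coeffR_projR_same (n : ℕ) (x : algebraR ρ θ) :
    coeffR ρ θ n (projR ρ θ n x) = coeffR ρ θ n x := by
  rw [projR_apply, coeffR_ofPiece_same]

lemma coeffR_projR_of_ne {m : ℕ} {n : ℤ} (h : (m : ℤ) ≠ n) (x : algebraR ρ θ) :
    coeffR ρ θ n (projR ρ θ m x) = 0 := by
  rw [projR_apply, coeffR_ofPiece_of_ne h]

lemma exists_eq_sum_projR (x : algebraR ρ θ) :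
    ∃ N : ℕ, ∀ n ≥ N, x = ∑ i ∈ Finset.range n, projR ρ θ i x := by
  obtain ⟨N, hN⟩ := eq_sum_monomial _ _ x.2
  refine ⟨N, fun n hn => Subtype.ext ?_⟩
  conv_lhs => rw [hN n hn]
  rw [AddSubmonoidClass.coe_finsetSum]
  rfl

lemma coeffR_of_neg {n : ℤ} (hn : n < 0) (x : algebraR ρ θ) : coeffR ρ θ n x = 0 := by
  obtain ⟨N, hN⟩ := exists_eq_sum_projR x
  rw [hN N le_rfl, map_sum]
  exact Finset.sum_eq_zero fun i _ => coeffR_projR_of_ne (by omega) x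

lemma ext_coeffR_nat {x y : algebraR ρ θ} (h : ∀ n : ℕ, coeffR ρ θ n x = coeffR ρ θ n y) :
    x = y := by
  refine ext_coeffR fun n => ?_
  obtain ⟨m, rfl⟩ | hn := (lt_or_ge n 0).symm.imp_left Int.eq_ofNat_of_zero_le
  · exact h m
  · rw [coeffR_of_neg hn, coeffR_of_neg hn]

lemma coeffR_one : coeffR ρ θ 0 1 = 1 := coeffAt_monomial_same (phi ρ θ) 0 1

lemma coeffR_zero_mul (x y : algebraR ρ θ) :
    coeffR ρ θ 0 (x * y) = coeffR ρ θ 0 x * coeffR ρ θ 0 y := by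
  obtain ⟨N, hN⟩ := exists_eq_sum_projR x
  have hN := hN (N + 1) (by omega)
  conv_lhs => rw [hN, Finset.sum_mul, map_sum]
  have key : ∀ i : ℕ, coeffR ρ θ 0 (projR ρ θ i x * y) =
      coeffR ρ θ i x * ((phi ρ θ) ^ (i : ℤ)) (coeffR ρ θ (0 - i) y) := fun i =>
    coeffAt_monomial_mul (phi ρ θ) i 0 _ _
  rw [Finset.sum_eq_single 0]
  · rw [key]; simp
  · intro b _ hb
    rw [key, coeffR_of_neg (n := 0 - (b : ℤ)) (by omega), map_zero, mul_zero]
  · simp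

/-- The augmentation ideal consists of the elements without constant term. -/
lemma mem_augmentationIdeal_iff (x : algebraR ρ θ) :
    x ∈ augmentationIdeal (gradingR ρ θ) ↔ coeffR ρ θ 0 x = 0 := by
  constructor
  · intro h
    induction h using Submodule.span_induction with
    | mem x h =>
      obtain ⟨n, hn, hx⟩ := h
      exact coeffR_of_mem_of_ne hx (by omega)
    | zero => exact map_zero _
    | add x y _ _ hx hy => rw [map_add, hx, hy, add_zero]
    | smul r x _ hx =>
      obtain ⟨r, rfl⟩ := op_surjective r
      rw [op_smul_eq_mul, coeffR_zero_mul, hx, zero_mul]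
  · intro h
    obtain ⟨N, hN⟩ := exists_eq_sum_projR x
    rw [hN N le_rfl]
    refine Submodule.sum_mem _ fun i _ => ?_
    obtain rfl | hi := Nat.eq_zero_or_pos i
    · have : projR ρ θ 0 x = 0 := by
        refine ext_coeffR fun n => ?_
        by_cases hn : (0 : ℤ) = n
        · subst hn
          exact (coeffR_projR_same 0 x).trans (h.trans (map_zero _).symm)
        · rw [coeffR_projR_of_ne (by exact_mod_cast hn), map_zero]
      rw [this]
      exact zero_mem _
    · exact Submodule.subset_span ⟨i, hi, projR_mem i x⟩

variable (ρ θ) in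
/-- The degree-`n` piece of `R(τ)` is `W_n t ^ n`. -/
def gradingEquiv (n : ℕ) : pieceW ρ θ n ≃ₗ[k] gradingR ρ θ n :=
  LinearEquiv.ofBijective ((ofPiece ρ θ n).codRestrict _ fun a => ofPiece_mem n a)
    ⟨fun a b h => by
      have := congrArg (fun x : gradingR ρ θ n => coeffR ρ θ n x) h
      apply Subtype.ext
      simpa only [LinearMap.codRestrict_apply, coeffR_ofPiece_same] using this,
    fun x => ⟨_, Subtype.ext (eq_ofPiece_of_mem x.2).symm⟩⟩

lemma finrank_gradingR (n : ℕ) :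
    Module.finrank k (gradingR ρ θ n) = Module.finrank k (pieceW ρ θ n) :=
  (gradingEquiv ρ θ n).finrank_eq.symm

lemma mul_mem_gradingR {m n : ℕ} {a b : algebraR ρ θ} (ha : a ∈ gradingR ρ θ m)
    (hb : b ∈ gradingR ρ θ n) : a * b ∈ gradingR ρ θ (m + n) := by
  obtain ⟨a', ha⟩ := ha
  obtain ⟨b', hb⟩ := hb
  refine ⟨a' * (phi ρ θ ^ (m : ℤ)) b', ?_⟩
  push_cast
  rw [← monomial_mul_monomial, ← ha, ← hb]

variable (ρ θ) in
theorem isConnectedGraded_gradingR : IsConnectedGraded (gradingR ρ θ) where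
  nontrivial := ⟨⟨0, 1, fun h => by
    have := congrArg (coeffR ρ θ 0) h
    rw [coeffR_one, map_zero] at this
    exact zero_ne_one this⟩⟩
  internal := isInternal_of_proj _ (projR ρ θ) projR_mem
    (fun n x hx => (eq_ofPiece_of_mem hx).symm)
    (fun m n x hmn hx => by
      rw [projR_apply]
      have : coeffR ρ θ n x = 0 := coeffR_of_mem_of_ne hx (by exact_mod_cast hmn)
      exact Subtype.ext (by rw [coe_ofPiece]; simp only [this, monomial_zero]; rfl))
    (fun x => (exists_eq_sum_projR x).imp fun N hN => hN N le_rfl)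
  one_mem := ⟨1, rfl⟩
  mul_mem _ _ _ _ := mul_mem_gradingR
  degree_zero a ha := by
    have h := eq_ofPiece_of_mem ha
    obtain ⟨c, hc⟩ := Submodule.mem_one.1 (coeffR_mem a 0)
    refine ⟨c, h.trans (Subtype.ext ?_)⟩
    rw [coe_ofPiece]
    simp only [← hc]
    rw [Algebra.algebraMap_eq_smul_one, Nat.cast_zero, monomial_smul, monomial_zero_one,
      Algebra.algebraMap_eq_smul_one]
    rfl
  finite n := (gradingEquiv ρ θ n).finiteDimensional

end Grading

/-! ### Matrices with entries of degree one -/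

section Matrices

variable {k : Type u} [Field k] {K : Type u} [Field K] [Algebra k K]

/-- For a matrix with entries `c i j t`, the map `y ↦ ∑ c i j φ(y j)` describes its action on
columns of homogeneous elements, through their coefficients. -/
def twistMap (φ : K ≃ₐ[k] K) {m n : ℕ} (c : Matrix (Fin m) (Fin n) K) :
    (Fin n → K) →ₗ[k] (Fin m → K) where
  toFun y i := ∑ j, c i j * φ (y j)
  map_add' x y := by ext i; simp [mul_add, Finset.sum_add_distrib]
  map_smul' a x := by ext i; simp [Finset.smul_sum]

/-- For a matrix with entries `c i j t`, the map `y ↦ ∑ y i φ^n(c i j)` describes its action on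
rows of homogeneous elements of degree `n`, through their coefficients. -/
def rowMap (φ : K ≃ₐ[k] K) (d : ℕ) {m n : ℕ} (c : Matrix (Fin m) (Fin n) K) :
    (Fin m → K) →ₗ[k] (Fin n → K) where
  toFun y j := ∑ i, y i * (φ ^ d) (c i j)
  map_add' x y := by ext i; simp [add_mul, Finset.sum_add_distrib]
  map_smul' a x := by ext i; simp [Finset.smul_sum]

lemma twistMap_apply (φ : K ≃ₐ[k] K) {m n : ℕ} (c : Matrix (Fin m) (Fin n) K) (y : Fin n → K)
    (i : Fin m) : twistMap φ c y i = ∑ j, c i j * φ (y j) := rfl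

lemma rowMap_apply (φ : K ≃ₐ[k] K) (d : ℕ) {m n : ℕ} (c : Matrix (Fin m) (Fin n) K)
    (y : Fin m → K) (j : Fin n) : rowMap φ d c y j = ∑ i, y i * (φ ^ d) (c i j) := rfl

variable [NeZero (2 : k)] {ρ θ : kˣ}

lemma matrixMap_apply {R : Type u} [Ring R] {m n : ℕ} (A : Matrix (Fin m) (Fin n) R)
    (x : Fin n → R) (i : Fin m) : matrixMap A x i = ∑ j, A i j * x j := rfl

/-- The matrix of coefficients of a matrix with entries of degree one. -/
def coeffMatrix {m n : ℕ} (A : Matrix (Fin m) (Fin n) (algebraR ρ θ)) :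
    Matrix (Fin m) (Fin n) (FunctionField k) := A.map (coeffR ρ θ 1)

lemma coeffR_mul_left {a : algebraR ρ θ} (ha : a ∈ gradingR ρ θ 1) (x : algebraR ρ θ) (n : ℤ) :
    coeffR ρ θ n (a * x) = coeffR ρ θ 1 a * phi ρ θ (coeffR ρ θ (n - 1) x) := by
  obtain ⟨b, hb⟩ := ha
  have hb' : coeffR ρ θ 1 a = b := by
    rw [coeffR_apply, hb]; exact coeffAt_monomial_same _ 1 b
  rw [hb', coeffR_apply, Subalgebra.coe_mul, hb]
  refine (coeffAt_monomial_mul (phi ρ θ) 1 n _ _).trans ?_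
  rw [zpow_one]
  rfl

lemma coeffR_mul_right {a : algebraR ρ θ} (ha : a ∈ gradingR ρ θ 1) (x : algebraR ρ θ) (n : ℤ) :
    coeffR ρ θ n (x * a) = coeffR ρ θ (n - 1) x * (phi ρ θ ^ (n - 1)) (coeffR ρ θ 1 a) := by
  obtain ⟨b, hb⟩ := ha
  have hb' : coeffR ρ θ 1 a = b := by
    rw [coeffR_apply, hb]; exact coeffAt_monomial_same _ 1 b
  rw [hb', coeffR_apply, Subalgebra.coe_mul, hb]
  exact coeffAt_mul_monomial (phi ρ θ) 1 n _ _

lemma coeffR_matrixMap {m n : ℕ} {A : Matrix (Fin m) (Fin n) (algebraR ρ θ)}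
    (hA : ∀ i j, A i j ∈ gradingR ρ θ 1) (x : Fin n → algebraR ρ θ) (d : ℤ) (i : Fin m) :
    coeffR ρ θ d (matrixMap A x i) =
      twistMap (phi ρ θ) (coeffMatrix A) (fun j => coeffR ρ θ (d - 1) (x j)) i := by
  rw [matrixMap_apply, map_sum, twistMap_apply]
  exact Finset.sum_congr rfl fun j _ => coeffR_mul_left (hA i j) _ _

lemma coeffR_vecMul {m n : ℕ} {A : Matrix (Fin m) (Fin n) (algebraR ρ θ)}
    (hA : ∀ i j, A i j ∈ gradingR ρ θ 1) (x : Fin m → algebraR ρ θ) (d : ℕ) (j : Fin n) :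
    coeffR ρ θ (d + 1 : ℕ) (Matrix.vecMul x A j) =
      rowMap (phi ρ θ) d (coeffMatrix A) (fun i => coeffR ρ θ d (x i)) j := by
  rw [Matrix.vecMul, dotProduct, map_sum, rowMap_apply]
  refine Finset.sum_congr rfl fun i _ => ?_
  rw [coeffR_mul_right (hA i j)]
  push_cast
  rw [add_sub_cancel_right, zpow_natCast]
  rfl

lemma exists_coeffR_bound {b : ℕ} (x : Fin b → algebraR ρ θ) :
    ∃ T : ℕ, ∀ n : ℕ, T ≤ n → ∀ j, coeffR ρ θ n (x j) = 0 := by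
  choose N hN using fun j => exists_eq_sum_projR (x j)
  refine ⟨Finset.univ.sup N, fun n hn j => ?_⟩
  rw [hN j _ (Finset.le_sup (Finset.mem_univ j)), map_sum]
  refine Finset.sum_eq_zero fun i hi => coeffR_projR_of_ne ?_ _
  have := Finset.mem_range.1 hi
  exact_mod_cast (by omega : i ≠ n)

/-- Tuples of elements with prescribed coefficients in the degrees below `T`. -/
lemma exists_coeffR_eq {c : ℕ} (T : ℕ) (z : ℕ → Fin c → FunctionField k)
    (hz : ∀ n j, z n j ∈ pieceW ρ θ n) :
    ∃ w : Fin c → algebraR ρ θ, (∀ n < T, ∀ j, coeffR ρ θ n (w j) = z n j) ∧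
      ∀ n ≥ T, ∀ j, coeffR ρ θ n (w j) = 0 := by
  refine ⟨fun j => ∑ n ∈ Finset.range T, ofPiece ρ θ n ⟨z n j, hz n j⟩,
    fun n hn j => ?_, fun n hn j => ?_⟩
  · rw [map_sum, Finset.sum_eq_single_of_mem n (Finset.mem_range.2 hn), coeffR_ofPiece_same]
    intro m _ hm
    exact coeffR_ofPiece_of_ne (by exact_mod_cast hm) _
  · rw [map_sum]
    refine Finset.sum_eq_zero fun i hi => coeffR_ofPiece_of_ne ?_ _
    have := Finset.mem_range.1 hi
    exact_mod_cast (by omega : i ≠ n)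

/-- Exactness of matrices with entries of degree one may be checked degree by degree. -/
theorem exact_of_graded {a b c : ℕ} {A : Matrix (Fin b) (Fin c) (algebraR ρ θ)}
    {B : Matrix (Fin a) (Fin b) (algebraR ρ θ)} (hA : ∀ i j, A i j ∈ gradingR ρ θ 1)
    (hB : ∀ i j, B i j ∈ gradingR ρ θ 1) (hBA : B * A = 0)
    (h0 : ∀ y : Fin b → FunctionField k, (∀ j, y j ∈ pieceW ρ θ 0) →
      twistMap (phi ρ θ) (coeffMatrix B) y = 0 → y = 0)
    (h1 : ∀ n, ∀ y : Fin b → FunctionField k, (∀ j, y j ∈ pieceW ρ θ (n + 1)) →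
      twistMap (phi ρ θ) (coeffMatrix B) y = 0 → ∃ z : Fin c → FunctionField k,
        (∀ j, z j ∈ pieceW ρ θ n) ∧ twistMap (phi ρ θ) (coeffMatrix A) z = y) :
    Function.Exact (matrixMap A) (matrixMap B) := by
  intro x
  constructor
  · intro hx
    have hx' : ∀ n : ℕ, twistMap (phi ρ θ) (coeffMatrix B) (fun j => coeffR ρ θ n (x j)) = 0 := by
      intro n
      ext i
      have := coeffR_matrixMap hB x (n + 1 : ℕ) i
      push_cast at this
      rw [add_sub_cancel_right] at this
      rw [← this, hx]
      simp
    choose z hz hz' using fun n : ℕ => h1 n (fun j => coeffR ρ θ (n + 1 : ℕ) (x j))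
      (fun j => coeffR_mem _ _) (hx' (n + 1))
    obtain ⟨T, hN⟩ := exists_coeffR_bound x
    obtain ⟨w, hw, hw'⟩ := exists_coeffR_eq T z hz
    refine ⟨w, funext fun i => ext_coeffR_nat fun n => ?_⟩
    rw [coeffR_matrixMap hA]
    obtain _ | n := n
    · have e1 : (fun j => coeffR ρ θ ((0 : ℕ) - 1) (w j)) = 0 :=
        funext fun j => coeffR_of_neg (by norm_num) _
      have e2 := h0 (fun j => coeffR ρ θ (0 : ℕ) (x j)) (fun j => coeffR_mem _ _) (hx' 0)
      rw [e1, map_zero]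
      exact (congrFun e2 i).symm
    · push_cast
      rw [add_sub_cancel_right]
      by_cases hn : n < T
      · have e1 : (fun j => coeffR ρ θ n (w j)) = z n := funext fun j => hw n hn j
        rw [e1, hz']
        push_cast
        rfl
      · have e1 : (fun j => coeffR ρ θ n (w j)) = 0 := funext fun j => hw' n (by omega) j
        rw [e1, map_zero]
        have := hN (n + 1) (by omega) i
        push_cast at this
        exact this.symm
  · rintro ⟨z, rfl⟩
    have : matrixMap B (matrixMap A z) = (B * A).mulVec z :=
      Matrix.mulVec_mulVec z B A
    rw [this, hBA, Matrix.zero_mulVec]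

end Matrices

/-! ### The matrices `M`, `N`, `P`, `Q` through their coefficients -/

section Shapes

variable {X Y : Type u}

/-- The matrix `Q` built from four elements of an arbitrary type.  The same formulas are used for
elements of `R(τ)`, for their coefficients, for families of those and in the free algebra; maps and
predicates are transported along them. -/
def shapeQ (r : Fin 4 → X) : Matrix (Fin 1) (Fin 4) X := !![r 0, r 1, r 2, r 3]

/-- The matrix `P` built from ten elements of an arbitrary type. -/
def shapeP [Zero X] (z : Fin 10 → X) : Matrix (Fin 4) (Fin 6) X :=
  !![z 0, z 2, 0, 0, z 4, z 6;
     0, 0, z 0, z 2, 0, 0;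
     z 1, z 3, 0, 0, 0, 0;
     0, 0, z 1, z 3, z 5, z 7]

/-- The matrix `N` built from ten elements of an arbitrary type. -/
def shapeN [Zero X] (z : Fin 10 → X) : Matrix (Fin 6) (Fin 4) X :=
  !![z 8, 0, 0, 0;
     z 9, 0, 0, 0;
     0, z 8, 0, 0;
     0, z 9, 0, 0;
     0, 0, z 0, z 2;
     0, 0, z 1, z 3]

/-- The matrix `M` built from ten elements of an arbitrary type. -/
def shapeM [Zero X] (z : Fin 10 → X) : Matrix (Fin 4) (Fin 1) X := !![0; 0; z 8; z 9]

lemma shapeQ_map (f : X → Y) (r : Fin 4 → X) :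
    (shapeQ r).map f = shapeQ (fun i => f (r i)) := by
  ext i j; fin_cases i; fin_cases j <;> rfl

lemma shapeP_map [Zero X] [Zero Y] (f : X → Y) (hf : f 0 = 0) (z : Fin 10 → X) :
    (shapeP z).map f = shapeP (fun i => f (z i)) := by
  ext i j; fin_cases i <;> fin_cases j <;> first | rfl | exact hf

lemma shapeN_map [Zero X] [Zero Y] (f : X → Y) (hf : f 0 = 0) (z : Fin 10 → X) :
    (shapeN z).map f = shapeN (fun i => f (z i)) := by
  ext i j; fin_cases i <;> fin_cases j <;> first | rfl | exact hf

lemma shapeM_map [Zero X] [Zero Y] (f : X → Y) (hf : f 0 = 0) (z : Fin 10 → X) :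
    (shapeM z).map f = shapeM (fun i => f (z i)) := by
  ext i j; fin_cases i <;> fin_cases j <;> first | rfl | exact hf

lemma shapeQ_forall (p : X → Prop) {r : Fin 4 → X} (hr : ∀ i, p (r i)) (i j) :
    p (shapeQ r i j) := by
  fin_cases i; fin_cases j <;> exact hr _

lemma shapeP_forall [Zero X] (p : X → Prop) (h0 : p 0) {z : Fin 10 → X} (hz : ∀ i, p (z i))
    (i j) : p (shapeP z i j) := by
  fin_cases i <;> fin_cases j <;> first | exact h0 | exact hz _

lemma shapeN_forall [Zero X] (p : X → Prop) (h0 : p 0) {z : Fin 10 → X} (hz : ∀ i, p (z i))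
    (i j) : p (shapeN z i j) := by
  fin_cases i <;> fin_cases j <;> first | exact h0 | exact hz _

lemma shapeM_forall [Zero X] (p : X → Prop) (h0 : p 0) {z : Fin 10 → X} (hz : ∀ i, p (z i))
    (i j) : p (shapeM z i j) := by
  fin_cases i <;> fin_cases j <;> first | exact h0 | exact hz _

variable {k : Type u} [Field k] [AddCommGroup X] [Module k X] [AddCommGroup Y] [Module k Y]

/-- The linear combinations of four vectors by which `z₁, …, z₁₀` are obtained from
`r₁, …, r₄`. -/
def shapeZ (ρ θ : kˣ) (r : Fin 4 → X) : Fin 10 → X :=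
  let γ : k := ρ + 1
  let δ : k := ρ - 1
  let ε : k := θ + 1
  let ζ : k := θ - 1
  ![ζ • r 0 - ε • r 2,
    ε • r 0 - ζ • r 2,
    ζ • r 1 - ε • r 3,
    ε • r 1 - ζ • r 3,
    δ • r 0 - γ • r 1,
    γ • r 0 - δ • r 1,
    δ • r 2 - γ • r 3,
    γ • r 2 - δ • r 3,
    -(γ * ζ) • r 3 + (γ * ε) • r 1 + (δ * ζ) • r 2 - (δ * ε) • r 0,
    (δ * ε) • r 3 - (δ * ζ) • r 1 - (γ * ε) • r 2 + (γ * ζ) • r 0]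

lemma map_shapeZ (ρ θ : kˣ) (f : X →ₗ[k] Y) (r : Fin 4 → X) (i : Fin 10) :
    f (shapeZ ρ θ r i) = shapeZ ρ θ (fun i => f (r i)) i := by
  fin_cases i <;> simp only [shapeZ] <;> simp

lemma shapeZ_mem (ρ θ : kˣ) (S : Submodule k X) {r : Fin 4 → X} (hr : ∀ i, r i ∈ S)
    (i : Fin 10) : shapeZ ρ θ r i ∈ S := by
  have := map_shapeZ ρ θ S.subtype (fun i => ⟨r i, hr i⟩) i
  simp only [Submodule.subtype_apply] at this
  rw [← this]
  exact Submodule.coe_mem _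

end Shapes

section Coordinates

variable {k : Type u} [Field k]

/-- The constant `c + 1`, which is `γ` for `c = ρ` and `ε` for `c = θ`. -/
def cplus (c : kˣ) : FunctionField k := algebraMap k _ ((c : k) + 1)

/-- The constant `c - 1`, which is `δ` for `c = ρ` and `ζ` for `c = θ`. -/
def cminus (c : kˣ) : FunctionField k := algebraMap k _ ((c : k) - 1)

lemma coordU_ne_zero : coordU k ≠ 0 := by simp [coordU]

lemma coordV_ne_zero : coordV k ≠ 0 := by simp [coordV]

lemma sigma_coordU : sigma k (coordU k) = coordU k * coordV k := substitution_coordU _ _ _ _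

lemma monomial_eq_zero_or {a b : k} (h : a ≠ 0 ∨ b ≠ 0) :
    algebraMap k (FunctionField k) a * coordU k + algebraMap k (FunctionField k) b ≠ 0 ∧
    algebraMap k (FunctionField k) a * coordV k + algebraMap k (FunctionField k) b ≠ 0 :=
  ⟨coord_ne_zero 0 a b h, coord_ne_zero 1 a b h⟩

variable [NeZero (2 : k)]

lemma plus_ne_zero_or_minus_ne_zero (c : kˣ) : (c : k) + 1 ≠ 0 ∨ (c : k) - 1 ≠ 0 := by
  by_contra! h
  apply NeZero.ne (2 : k)
  linear_combination h.1 - h.2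

lemma four_ne_zero_of_two : (4 : k) ≠ 0 := by
  rw [show (4 : k) = 2 * 2 by norm_num]
  exact mul_ne_zero (NeZero.ne _) (NeZero.ne _)

lemma cplus_sq_sub (c : kˣ) : cplus c ^ 2 - cminus c ^ 2 ≠ 0 := by
  have : cplus c ^ 2 - cminus c ^ 2 = algebraMap k (FunctionField k) (4 * c) := by
    rw [cplus, cminus, ← map_pow, ← map_pow, ← map_sub]
    congr 1
    ring
  rw [this, Ne, map_eq_zero]
  exact mul_ne_zero four_ne_zero_of_two c.ne_zero

lemma minus_mul_u_ne_zero (c : kˣ) : cminus c * coordU k + cplus c ≠ 0 :=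
  (monomial_eq_zero_or (plus_ne_zero_or_minus_ne_zero c).symm).1

lemma minus_mul_v_ne_zero (c : kˣ) : cminus c * coordV k + cplus c ≠ 0 :=
  (monomial_eq_zero_or (plus_ne_zero_or_minus_ne_zero c).symm).2

lemma plus_sub_u_ne_zero (c : kˣ) : cplus c - cminus c * coordU k ≠ 0 := by
  have := (monomial_eq_zero_or (k := k) (a := -((c : k) - 1)) (b := (c : k) + 1)
    (by simpa only [ne_eq, neg_eq_zero] using (plus_ne_zero_or_minus_ne_zero c).symm)).1
  rw [map_neg] at this
  intro h
  apply this
  linear_combination (norm := (simp only [cplus, cminus]; ring)) h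

lemma plus_sub_v_ne_zero (c : kˣ) : cplus c - cminus c * coordV k ≠ 0 := by
  have := (monomial_eq_zero_or (k := k) (a := -((c : k) - 1)) (b := (c : k) + 1)
    (by simpa only [ne_eq, neg_eq_zero] using (plus_ne_zero_or_minus_ne_zero c).symm)).2
  rw [map_neg] at this
  intro h
  apply this
  linear_combination (norm := (simp only [cplus, cminus]; ring)) h

lemma minus_mul_uv_ne_zero (c : kˣ) : cminus c * (coordU k * coordV k) + cplus c ≠ 0 := by
  have : cminus c * (coordU k * coordV k) + cplus c =
      sigma k (cminus c * coordU k + cplus c) := by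
    rw [map_add, map_mul, sigma_coordU, cminus, cplus, AlgEquiv.commutes, AlgEquiv.commutes]
  rw [this]
  exact (map_ne_zero _).2 (minus_mul_u_ne_zero c)

variable (ρ θ : kˣ)

lemma phi_cplus (c : kˣ) : phi ρ θ (cplus c) = cplus c := AlgEquiv.commutes _ _

lemma phi_cminus (c : kˣ) : phi ρ θ (cminus c) = cminus c := AlgEquiv.commutes _ _

lemma phi_u_eq : phi ρ θ (coordU k) * (cminus ρ * (coordU k * coordV k) + cplus ρ) =
    cplus ρ * (coordU k * coordV k) + cminus ρ := by
  rw [phi_coordU, moebius]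
  exact div_mul_cancel₀ _ (minus_mul_uv_ne_zero ρ)

lemma phi_v_eq : phi ρ θ (coordV k) * (cminus θ * coordV k + cplus θ) =
    cplus θ * coordV k + cminus θ := by
  rw [phi_coordV, moebius]
  exact div_mul_cancel₀ _ (minus_mul_v_ne_zero θ)

/-- The fundamental identity for `u`: it says that `φ` sends `τ⁻¹(u)` to `uv`. -/
lemma phi_numU : cplus ρ * phi ρ θ (coordU k) - cminus ρ =
    coordU k * coordV k * (cplus ρ - cminus ρ * phi ρ θ (coordU k)) := by
  linear_combination phi_u_eq ρ θ

/-- The fundamental identity for `v`: it says that `φ` sends `τ⁻¹(v)` to `v`. -/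
lemma phi_numV : cplus θ * phi ρ θ (coordV k) - cminus θ =
    coordV k * (cplus θ - cminus θ * phi ρ θ (coordV k)) := by
  linear_combination phi_v_eq ρ θ

/-- The coefficients of `r₁, …, r₄`. -/
def coordE (k : Type u) [Field k] : Fin 4 → FunctionField k :=
  ![1, coordU k, coordV k, coordU k * coordV k]

/-- The coefficients of `z₁, …, z₁₀`. -/
def coeffZ : Fin 10 → FunctionField k :=
  ![cminus θ - cplus θ * coordV k, cplus θ - cminus θ * coordV k,
    (cminus θ - cplus θ * coordV k) * coordU k, (cplus θ - cminus θ * coordV k) * coordU k,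
    cminus ρ - cplus ρ * coordU k, cplus ρ - cminus ρ * coordU k,
    (cminus ρ - cplus ρ * coordU k) * coordV k, (cplus ρ - cminus ρ * coordU k) * coordV k,
    (cplus ρ * coordU k - cminus ρ) * (cplus θ - cminus θ * coordV k),
    (cminus ρ * coordU k - cplus ρ) * (cplus θ * coordV k - cminus θ)]

variable {ρ θ}

lemma generatorR_mem (i : Fin 4) : generatorR ρ θ i ∈ gradingR ρ θ 1 := ⟨_, rfl⟩

lemma coeffR_generatorR (i : Fin 4) : coeffR ρ θ 1 (generatorR ρ θ i) = coordE k i :=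
  coeffAt_monomial_same (phi ρ θ) 1 _

lemma elementZ_eq : elementZ ρ θ = shapeZ ρ θ (generatorR ρ θ) := by
  simp only [elementZ, shapeZ]

lemma elementZ_mem (i : Fin 10) : elementZ ρ θ i ∈ gradingR ρ θ 1 := by
  have := shapeZ_mem ρ θ (gradingR ρ θ 1) (r := generatorR ρ θ) (fun i => generatorR_mem i) i
  rwa [← elementZ_eq] at this

omit [NeZero (2 : k)] in
variable (ρ θ) in
lemma shapeZ_coordE (i : Fin 10) : shapeZ ρ θ (coordE k) i = coeffZ ρ θ i := by
  fin_cases i <;>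
    simp [shapeZ, coordE, coeffZ, Algebra.smul_def, cplus, cminus] <;> ring

lemma coeffR_elementZ (i : Fin 10) : coeffR ρ θ 1 (elementZ ρ θ i) = coeffZ ρ θ i := by
  have h : (fun i => coeffR ρ θ 1 (generatorR ρ θ i)) = coordE k := funext coeffR_generatorR
  have := map_shapeZ ρ θ (coeffR ρ θ 1) (generatorR ρ θ) i
  rw [h, shapeZ_coordE] at this
  exact this

lemma matrixQ_eq : matrixQ ρ θ = shapeQ (generatorR ρ θ) := rfl

lemma matrixP_eq : matrixP ρ θ = shapeP (elementZ ρ θ) := rfl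

lemma matrixN_eq : matrixN ρ θ = shapeN (elementZ ρ θ) := rfl

lemma matrixM_eq : matrixM ρ θ = shapeM (elementZ ρ θ) := rfl

lemma matrixQ_mem (i j) : matrixQ ρ θ i j ∈ gradingR ρ θ 1 :=
  shapeQ_forall (· ∈ gradingR ρ θ 1) generatorR_mem i j

lemma matrixP_mem (i j) : matrixP ρ θ i j ∈ gradingR ρ θ 1 :=
  shapeP_forall (· ∈ gradingR ρ θ 1) (zero_mem _) elementZ_mem i j

lemma matrixN_mem (i j) : matrixN ρ θ i j ∈ gradingR ρ θ 1 :=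
  shapeN_forall (· ∈ gradingR ρ θ 1) (zero_mem _) elementZ_mem i j

lemma matrixM_mem (i j) : matrixM ρ θ i j ∈ gradingR ρ θ 1 :=
  shapeM_forall (· ∈ gradingR ρ θ 1) (zero_mem _) elementZ_mem i j

lemma coeffMatrix_matrixQ : coeffMatrix (matrixQ ρ θ) = shapeQ (coordE k) := by
  rw [coeffMatrix, matrixQ_eq, shapeQ_map]
  simp only [coeffR_generatorR]

lemma coeffMatrix_matrixP : coeffMatrix (matrixP ρ θ) = shapeP (coeffZ ρ θ) := by
  rw [coeffMatrix, matrixP_eq, shapeP_map _ (map_zero _)]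
  simp only [coeffR_elementZ]

lemma coeffMatrix_matrixN : coeffMatrix (matrixN ρ θ) = shapeN (coeffZ ρ θ) := by
  rw [coeffMatrix, matrixN_eq, shapeN_map _ (map_zero _)]
  simp only [coeffR_elementZ]

lemma coeffMatrix_matrixM : coeffMatrix (matrixM ρ θ) = shapeM (coeffZ ρ θ) := by
  rw [coeffMatrix, matrixM_eq, shapeM_map _ (map_zero _)]
  simp only [coeffR_elementZ]

lemma coeffR_two_mul {a b : algebraR ρ θ} (ha : a ∈ gradingR ρ θ 1) :
    coeffR ρ θ 2 (a * b) = coeffR ρ θ 1 a * phi ρ θ (coeffR ρ θ 1 b) :=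
  coeffR_mul_left ha b 2

lemma eq_zero_of_mem_two {a : algebraR ρ θ} (ha : a ∈ gradingR ρ θ 2)
    (h : coeffR ρ θ 2 a = 0) : a = 0 := by
  rw [eq_ofPiece_of_mem ha]
  apply Subtype.ext
  rw [coe_ofPiece]
  have h' : coeffR ρ θ (2 : ℕ) a = 0 := h
  simp only [h', monomial_zero]
  rfl

/-- A product of two matrices with entries of degree one can be computed on coefficients, where it
is twisted by `φ`. -/
lemma mul_eq_zero_of_coeffMatrix {l m n : ℕ} {A : Matrix (Fin l) (Fin m) (algebraR ρ θ)}
    {B : Matrix (Fin m) (Fin n) (algebraR ρ θ)} (hA : ∀ i j, A i j ∈ gradingR ρ θ 1)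
    (hB : ∀ i j, B i j ∈ gradingR ρ θ 1)
    (h : coeffMatrix A * (coeffMatrix B).map (phi ρ θ) = 0) : A * B = 0 := by
  ext1 i j
  refine eq_zero_of_mem_two ?_ ?_
  · rw [Matrix.mul_apply]
    exact Submodule.sum_mem _ fun l _ => mul_mem_gradingR (hA i l) (hB l j)
  · rw [Matrix.mul_apply, map_sum]
    have := congrFun (congrFun h i) j
    rw [Matrix.mul_apply] at this
    rw [← this.trans (Matrix.zero_apply i j)]
    exact Finset.sum_congr rfl fun l _ => coeffR_two_mul (hA i l)

lemma coeffQ_mul_coeffP : shapeQ (coordE k) * (shapeP (coeffZ ρ θ)).map (phi ρ θ) = 0 := by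
  have hu := phi_numU ρ θ
  have hv := phi_numV ρ θ
  ext i j
  fin_cases i; fin_cases j <;>
    simp [shapeQ, coordE, shapeP, coeffZ, Matrix.mul_apply, Fin.sum_univ_succ, phi_cplus,
      phi_cminus]
  · linear_combination -hv
  · linear_combination -phi ρ θ (coordU k) * hv
  · linear_combination -coordU k * hv
  · linear_combination -phi ρ θ (coordU k) * coordU k * hv
  · linear_combination -hu
  · linear_combination -phi ρ θ (coordV k) * hu

lemma coeffP_mul_coeffN : shapeP (coeffZ ρ θ) * (shapeN (coeffZ ρ θ)).map (phi ρ θ) = 0 := by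
  have hu := phi_numU ρ θ
  have hv := phi_numV ρ θ
  set a := phi ρ θ (coordU k) with ha
  set b := phi ρ θ (coordV k) with hb
  have key : (cplus ρ * a - cminus ρ) * (cplus θ - cminus θ * b) +
      coordU k * ((cminus ρ * a - cplus ρ) * (cplus θ * b - cminus θ)) = 0 := by
    linear_combination (cplus θ - cminus θ * b) * hu + coordU k * (cminus ρ * a - cplus ρ) * hv
  ext i j
  fin_cases i <;> fin_cases j <;>
    simp [shapeP, shapeN, coeffZ, Matrix.mul_apply, Fin.sum_univ_succ, phi_cplus, phi_cminus,
      ← ha, ← hb]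
  · linear_combination (cminus θ - cplus θ * coordV k) * key
  · linear_combination -(cminus ρ - cplus ρ * coordU k) * hv
  · linear_combination -(cminus ρ - cplus ρ * coordU k) * a * hv
  · linear_combination (cminus θ - cplus θ * coordV k) * key
  · linear_combination (cplus θ - cminus θ * coordV k) * key
  · linear_combination (cplus θ - cminus θ * coordV k) * key
  · linear_combination -(cplus ρ - cminus ρ * coordU k) * hv
  · linear_combination -(cplus ρ - cminus ρ * coordU k) * a * hv

lemma coeffN_mul_coeffM : shapeN (coeffZ ρ θ) * (shapeM (coeffZ ρ θ)).map (phi ρ θ) = 0 := by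
  have hu := phi_numU ρ θ
  have hv := phi_numV ρ θ
  set a := phi ρ θ (coordU k) with ha
  set b := phi ρ θ (coordV k) with hb
  have key : (cplus ρ * a - cminus ρ) * (cplus θ - cminus θ * b) +
      coordU k * ((cminus ρ * a - cplus ρ) * (cplus θ * b - cminus θ)) = 0 := by
    linear_combination (cplus θ - cminus θ * b) * hu + coordU k * (cminus ρ * a - cplus ρ) * hv
  ext i j
  fin_cases i <;> fin_cases j <;>
    simp [shapeN, shapeM, coeffZ, Matrix.mul_apply, Fin.sum_univ_succ, phi_cplus, phi_cminus,
      ← ha, ← hb]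
  · linear_combination (cminus θ - cplus θ * coordV k) * key
  · linear_combination (cplus θ - cminus θ * coordV k) * key

lemma matrixQ_mul_matrixP : matrixQ ρ θ * matrixP ρ θ = 0 :=
  mul_eq_zero_of_coeffMatrix matrixQ_mem matrixP_mem
    (by rw [coeffMatrix_matrixQ, coeffMatrix_matrixP, coeffQ_mul_coeffP])

lemma matrixP_mul_matrixN : matrixP ρ θ * matrixN ρ θ = 0 :=
  mul_eq_zero_of_coeffMatrix matrixP_mem matrixN_mem
    (by rw [coeffMatrix_matrixP, coeffMatrix_matrixN, coeffP_mul_coeffN])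

lemma matrixN_mul_matrixM : matrixN ρ θ * matrixM ρ θ = 0 :=
  mul_eq_zero_of_coeffMatrix matrixN_mem matrixM_mem
    (by rw [coeffMatrix_matrixN, coeffMatrix_matrixM, coeffN_mul_coeffM])

end Coordinates

/-! ### Rational families and semicontinuity of ranks -/

section Semicontinuity

variable {k : Type u} [Field k]

/-- The value at `p ∈ k* × k*` of a polynomial in two variables with integral coefficients. -/
def evalParam (p : kˣ × kˣ) : MvPolynomial (Fin 2) ℤ →+* k :=
  MvPolynomial.eval₂Hom (Int.castRingHom k) ![(p.1 : k), (p.2 : k)]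

/-- The specialization at the parameters `p` of a polynomial in `u`, `v` whose coefficients are
integral polynomials in the parameters. -/
def specialize (p : kˣ × kˣ) :
    MvPolynomial (Fin 2) (MvPolynomial (Fin 2) ℤ) →+* MvPolynomial (Fin 2) k :=
  MvPolynomial.map (evalParam p)

/-- The specialization, as an element of `k(u, v)`. -/
def specializeK (p : kˣ × kˣ) :
    MvPolynomial (Fin 2) (MvPolynomial (Fin 2) ℤ) →+* FunctionField k :=
  (algebraMap (MvPolynomial (Fin 2) k) (FunctionField k)).comp (specialize p)

/-- A family of elements of `k(u, v)`, indexed by the parameters, is rational if it is a quotient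
of two specialized polynomials, the denominator vanishing for no value of the parameters. -/
def IsRationalFamily (F : kˣ × kˣ → FunctionField k) : Prop :=
  ∃ G D, ∀ p, specializeK p D ≠ 0 ∧ F p * specializeK p D = specializeK p G

namespace IsRationalFamily

lemma specialize (G) : IsRationalFamily fun p : kˣ × kˣ => specializeK p G :=
  ⟨G, 1, fun p => ⟨by rw [map_one]; exact one_ne_zero, by rw [map_one, mul_one]⟩⟩

lemma add {F F' : kˣ × kˣ → FunctionField k} (h : IsRationalFamily F)
    (h' : IsRationalFamily F') : IsRationalFamily fun p => F p + F' p := by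
  obtain ⟨G, D, h⟩ := h
  obtain ⟨G', D', h'⟩ := h'
  refine ⟨G * D' + G' * D, D * D', fun p => ⟨?_, ?_⟩⟩
  · rw [map_mul]; exact mul_ne_zero (h p).1 (h' p).1
  · rw [map_add, map_mul, map_mul, map_mul, ← (h p).2, ← (h' p).2]; ring

lemma mul {F F' : kˣ × kˣ → FunctionField k} (h : IsRationalFamily F)
    (h' : IsRationalFamily F') : IsRationalFamily fun p => F p * F' p := by
  obtain ⟨G, D, h⟩ := h
  obtain ⟨G', D', h'⟩ := h'
  refine ⟨G * G', D * D', fun p => ⟨?_, ?_⟩⟩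
  · rw [map_mul]; exact mul_ne_zero (h p).1 (h' p).1
  · rw [map_mul, map_mul, ← (h p).2, ← (h' p).2]; ring

lemma inv {F : kˣ × kˣ → FunctionField k} (h : IsRationalFamily F) (h0 : ∀ p, F p ≠ 0) :
    IsRationalFamily fun p => (F p)⁻¹ := by
  obtain ⟨G, D, h⟩ := h
  refine ⟨D, G, fun p => ⟨?_, ?_⟩⟩
  · rw [← (h p).2]; exact mul_ne_zero (h0 p) (h p).1
  · rw [← (h p).2, inv_mul_cancel_left₀ (h0 p)]

lemma congr {F F' : kˣ × kˣ → FunctionField k} (h : IsRationalFamily F) (e : ∀ p, F p = F' p) :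
    IsRationalFamily F' := by
  rwa [← show F = F' from funext e]

lemma const (c : MvPolynomial (Fin 2) ℤ) :
    IsRationalFamily fun p : kˣ × kˣ => algebraMap k (FunctionField k) (evalParam p c) := by
  refine (specialize (MvPolynomial.C c)).congr fun p => ?_
  rw [specializeK, RingHom.comp_apply, BirationalSurface.specialize, MvPolynomial.map_C,
    IsScalarTower.algebraMap_apply k (MvPolynomial (Fin 2) k) (FunctionField k)]
  rfl

lemma zero : IsRationalFamily fun _ : kˣ × kˣ => (0 : FunctionField k) :=
  (specialize 0).congr fun _ => map_zero _

lemma one : IsRationalFamily fun _ : kˣ × kˣ => (1 : FunctionField k) :=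
  (specialize 1).congr fun _ => map_one _

lemma coordU : IsRationalFamily fun _ : kˣ × kˣ => coordU k := by
  refine (specialize (MvPolynomial.X 0)).congr fun p => ?_
  rw [specializeK, RingHom.comp_apply, BirationalSurface.specialize, MvPolynomial.map_X]
  rfl

lemma coordV : IsRationalFamily fun _ : kˣ × kˣ => coordV k := by
  refine (specialize (MvPolynomial.X 1)).congr fun p => ?_
  rw [specializeK, RingHom.comp_apply, BirationalSurface.specialize, MvPolynomial.map_X]
  rfl

lemma neg {F : kˣ × kˣ → FunctionField k} (h : IsRationalFamily F) :
    IsRationalFamily fun p => -F p :=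
  ((const (-1)).mul h).congr fun p => by simp

lemma sub {F F' : kˣ × kˣ → FunctionField k} (h : IsRationalFamily F)
    (h' : IsRationalFamily F') : IsRationalFamily fun p => F p - F' p :=
  (h.add h'.neg).congr fun _ => (sub_eq_add_neg _ _).symm

lemma cplus_fst : IsRationalFamily fun p : kˣ × kˣ => cplus p.1 :=
  (const (MvPolynomial.X 0 + 1)).congr fun p => by simp [evalParam, cplus]

lemma cminus_fst : IsRationalFamily fun p : kˣ × kˣ => cminus p.1 :=
  (const (MvPolynomial.X 0 - 1)).congr fun p => by simp [evalParam, cminus]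

lemma cplus_snd : IsRationalFamily fun p : kˣ × kˣ => cplus p.2 :=
  (const (MvPolynomial.X 1 + 1)).congr fun p => by simp [evalParam, cplus]

lemma cminus_snd : IsRationalFamily fun p : kˣ × kˣ => cminus p.2 :=
  (const (MvPolynomial.X 1 - 1)).congr fun p => by simp [evalParam, cminus]

variable [NeZero (2 : k)]

lemma phi_coordU : IsRationalFamily fun p : kˣ × kˣ =>
    phi p.1 p.2 (BirationalSurface.coordU k) := by
  refine (((cplus_fst.mul (coordU.mul coordV)).add cminus_fst).mul
    (((cminus_fst.mul (coordU.mul coordV)).add cplus_fst).inv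
      fun p => minus_mul_uv_ne_zero p.1)).congr fun p => ?_
  rw [BirationalSurface.phi_coordU, moebius, div_eq_mul_inv]
  rfl

lemma phi_coordV : IsRationalFamily fun p : kˣ × kˣ =>
    phi p.1 p.2 (BirationalSurface.coordV k) := by
  refine (((cplus_snd.mul coordV).add cminus_snd).mul
    (((cminus_snd.mul coordV).add cplus_snd).inv
      fun p => minus_mul_v_ne_zero p.2)).congr fun p => ?_
  rw [BirationalSurface.phi_coordV, moebius, div_eq_mul_inv]
  rfl

lemma phi_specialize (G) :
    IsRationalFamily fun p : kˣ × kˣ => phi p.1 p.2 (specializeK p G) := by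
  induction G using MvPolynomial.induction_on with
  | C c =>
    refine (const c).congr fun p => ?_
    rw [specializeK, RingHom.comp_apply, BirationalSurface.specialize, MvPolynomial.map_C]
    have : algebraMap (MvPolynomial (Fin 2) k) (FunctionField k)
        (MvPolynomial.C (evalParam p c)) = algebraMap k (FunctionField k) (evalParam p c) := by
      rw [IsScalarTower.algebraMap_apply k (MvPolynomial (Fin 2) k) (FunctionField k)]
      rfl
    rw [this, AlgEquiv.commutes]
  | add G G' h h' => exact (h.add h').congr fun p => by rw [map_add, map_add]
  | mul_X G i h =>
    have hi : IsRationalFamily fun p : kˣ × kˣ =>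
        phi p.1 p.2 (specializeK p (MvPolynomial.X i)) := by
      fin_cases i
      · refine phi_coordU.congr fun p => ?_
        rw [specializeK, RingHom.comp_apply, BirationalSurface.specialize, MvPolynomial.map_X]
        rfl
      · refine phi_coordV.congr fun p => ?_
        rw [specializeK, RingHom.comp_apply, BirationalSurface.specialize, MvPolynomial.map_X]
        rfl
    exact (h.mul hi).congr fun p => by rw [map_mul, map_mul]

lemma phi {F : kˣ × kˣ → FunctionField k} (h : IsRationalFamily F) :
    IsRationalFamily fun p => phi p.1 p.2 (F p) := by
  obtain ⟨G, D, h⟩ := h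
  have hD : ∀ p, BirationalSurface.phi p.1 p.2 (specializeK p D) ≠ 0 :=
    fun p => (map_ne_zero _).2 (h p).1
  refine ((phi_specialize G).mul ((phi_specialize D).inv hD)).congr fun p => ?_
  rw [← (h p).2, map_mul, mul_inv_cancel_right₀ (hD p)]

lemma phi_pow {F : kˣ × kˣ → FunctionField k} (h : IsRationalFamily F) (n : ℕ) :
    IsRationalFamily fun p => (BirationalSurface.phi p.1 p.2 ^ n) (F p) := by
  induction n with
  | zero => exact h
  | succ n ih => exact ih.phi.congr fun p => by rw [pow_succ']; rfl

omit [NeZero (2 : k)] in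
lemma exists_common_denominator {ι : Type} [Fintype ι] (F : ι → kˣ × kˣ → FunctionField k)
    (h : ∀ i, IsRationalFamily (F i)) :
    ∃ D, (∀ p : kˣ × kˣ, specializeK p D ≠ 0) ∧
      ∃ G : ι → _, ∀ i p, F i p * specializeK p D = specializeK p (G i) := by
  classical
  choose G D h using h
  refine ⟨∏ i, D i, fun p => ?_, fun i => G i * ∏ j ∈ Finset.univ.erase i, D j, fun i p => ?_⟩
  · rw [map_prod]
    exact Finset.prod_ne_zero_iff.2 fun i _ => (h i p).1
  · rw [← Finset.mul_prod_erase _ _ (Finset.mem_univ i), map_mul, map_mul, ← (h i p).2, mul_assoc]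

end IsRationalFamily

/-- A property of the parameters holds on a nonempty open set defined over the prime field and
containing `(1, 1)`. -/
def HoldsNearOne (P : kˣ × kˣ → Prop) : Prop :=
  ∃ f, evalParam (1 : kˣ × kˣ) f ≠ 0 ∧ ∀ p, evalParam p f ≠ 0 → P p

lemma HoldsNearOne.and {P P' : kˣ × kˣ → Prop} (h : HoldsNearOne P) (h' : HoldsNearOne P') :
    HoldsNearOne fun p => P p ∧ P' p := by
  obtain ⟨f, h1, h⟩ := h
  obtain ⟨f', h1', h'⟩ := h'
  refine ⟨f * f', by rw [map_mul]; exact mul_ne_zero h1 h1', fun p hp => ?_⟩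
  rw [map_mul] at hp
  exact ⟨h p (left_ne_zero_of_mul hp), h' p (right_ne_zero_of_mul hp)⟩

lemma HoldsNearOne.mono {P P' : kˣ × kˣ → Prop} (h : HoldsNearOne P) (h' : ∀ p, P p → P' p) :
    HoldsNearOne P' := by
  obtain ⟨f, h1, h⟩ := h
  exact ⟨f, h1, fun p hp => h' p (h p hp)⟩

/-- A matrix with independent rows has a nonzero maximal minor. -/
lemma exists_minor_ne_zero {κ J : Type} [Fintype κ] [DecidableEq κ] [Fintype J]
    (A : Matrix κ J k) (h : LinearIndependent k A.row) :
    ∃ s : κ → J, (A.submatrix id s).det ≠ 0 := by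
  have hr : A.rank = Fintype.card κ := h.rank_matrix
  have htop : Submodule.span k (Set.range A.col) = ⊤ := by
    apply Submodule.eq_top_of_finrank_eq
    rw [← Matrix.rank_eq_finrank_span_cols, hr, Module.finrank_fintype_fun_eq_card]
  obtain ⟨κ', a, _, hspan, hli⟩ := exists_linearIndependent' k A.col
  rw [htop] at hspan
  let b := Module.Basis.mk hli hspan.ge
  haveI : Finite κ' := Module.Finite.finite_basis b
  haveI := Fintype.ofFinite κ'
  have hcard : Fintype.card κ = Fintype.card κ' := by
    rw [← Module.finrank_eq_card_basis b, Module.finrank_fintype_fun_eq_card]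
  let e := Fintype.equivOfCardEq hcard
  refine ⟨a ∘ e, ?_⟩
  have : LinearIndependent k (A.submatrix id (a ∘ e)).col := hli.comp e e.injective
  rw [Matrix.linearIndependent_cols_iff_isUnit, Matrix.isUnit_iff_isUnit_det] at this
  exact this.ne_zero

/-- Linear independence of the rows of a matrix is an open condition on the parameters. -/
lemma holdsNearOne_linearIndependent_row {κ J : Type} [Fintype κ] [DecidableEq κ] [Fintype J]
    (C : Matrix κ J (MvPolynomial (Fin 2) ℤ))
    (h : LinearIndependent k (C.map (evalParam (1 : kˣ × kˣ))).row) :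
    HoldsNearOne fun p : kˣ × kˣ => LinearIndependent k (C.map (evalParam p)).row := by
  obtain ⟨s, hs⟩ := exists_minor_ne_zero _ h
  have key : ∀ p : kˣ × kˣ, evalParam p (C.submatrix id s).det =
      ((C.map (evalParam p)).submatrix id s).det := fun p => by
    rw [RingHom.map_det]
    rfl
  -- the minor, as a polynomial in the parameters, is the equation of the exceptional set
  refine ⟨(C.submatrix id s).det, by rwa [key], fun p hp => ?_⟩
  rw [key, ← isUnit_iff_ne_zero, ← Matrix.isUnit_iff_isUnit_det,
    ← Matrix.linearIndependent_rows_iff_isUnit] at hp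
  exact LinearIndependent.of_comp (LinearMap.funLeft k k s) hp

/-- Linear independence of finitely many rational vectors is an open condition. -/
lemma holdsNearOne_linearIndependent {κ m : Type} [Fintype κ] [Fintype m]
    (W : κ → kˣ × kˣ → m → FunctionField k)
    (hW : ∀ i j, IsRationalFamily fun p => W i p j)
    (h : LinearIndependent k fun i => W i 1) :
    HoldsNearOne fun p => LinearIndependent k fun i => W i p := by
  classical
  obtain ⟨D, hD, G, hG⟩ := IsRationalFamily.exists_common_denominator
    (fun ij : κ × m => fun p => W ij.1 p ij.2) (fun ij => hW ij.1 ij.2)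
  let T : Finset (Fin 2 →₀ ℕ) := Finset.univ.biUnion fun ij => (G ij).support
  let C : Matrix κ (m × T) (MvPolynomial (Fin 2) ℤ) := fun i jt => (G (i, jt.1)).coeff jt.2
  -- a relation among the vectors is a relation among the rows of the matrix of coefficients
  have key : ∀ (p : kˣ × kˣ) (c : κ → k), ∑ i, c i • W i p = 0 ↔
      ∑ i, c i • (C.map (evalParam p)).row i = 0 := by
    intro p c
    have e1 : ∑ i, c i • W i p = 0 ↔
        ∀ j, ∑ i, MvPolynomial.C (c i) * specialize p (G (i, j)) = 0 := by
      rw [funext_iff]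
      refine forall_congr' fun j => ?_
      have : algebraMap (MvPolynomial (Fin 2) k) (FunctionField k)
          (∑ i, MvPolynomial.C (c i) * specialize p (G (i, j))) =
          (∑ i, c i • W i p) j * specializeK p D := by
        rw [Finset.sum_apply, Finset.sum_mul, map_sum]
        refine Finset.sum_congr rfl fun i _ => ?_
        rw [Pi.smul_apply, smul_mul_assoc, hG (i, j) p, map_mul, Algebra.smul_def,
          IsScalarTower.algebraMap_apply k (MvPolynomial (Fin 2) k) (FunctionField k)]
        rfl
      rw [← IsFractionRing.to_map_eq_zero_iff (K := FunctionField k), this, Pi.zero_apply]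
      exact ⟨fun h => by rw [h, zero_mul], fun h => (mul_eq_zero.1 h).resolve_right (hD p)⟩
    rw [e1, funext_iff, Prod.forall]
    refine forall_congr' fun j => ?_
    rw [MvPolynomial.ext_iff]
    have e2 : ∀ t, MvPolynomial.coeff t (∑ i, MvPolynomial.C (c i) * specialize p (G (i, j))) =
        ∑ i, c i * evalParam p ((G (i, j)).coeff t) := by
      intro t
      rw [MvPolynomial.coeff_sum]
      exact Finset.sum_congr rfl fun i _ => by
        rw [MvPolynomial.coeff_C_mul, specialize, MvPolynomial.coeff_map]
    constructor
    · intro h t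
      have := h t
      rw [e2] at this
      rw [Finset.sum_apply]
      exact this
    · intro h t
      rw [e2, MvPolynomial.coeff_zero]
      by_cases ht : t ∈ T
      · have := h ⟨t, ht⟩
        rw [Finset.sum_apply] at this
        exact this
      · refine Finset.sum_eq_zero fun i _ => ?_
        have : (G (i, j)).coeff t = 0 := by
          rw [← MvPolynomial.notMem_support_iff]
          exact fun h => ht (Finset.mem_biUnion.2 ⟨(i, j), Finset.mem_univ _, h⟩)
        rw [this, map_zero, mul_zero]
  have key' : ∀ p, LinearIndependent k (fun i => W i p) ↔
      LinearIndependent k (C.map (evalParam p)).row := by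
    intro p
    rw [Fintype.linearIndependent_iff, Fintype.linearIndependent_iff]
    exact forall_congr' fun c => imp_congr_left (key p c)
  exact (holdsNearOne_linearIndependent_row C ((key' 1).1 h)).mono fun p => (key' p).2

/-- Semicontinuity: the dimension of the span of finitely many rational vectors can only drop on
a closed set not containing `(1, 1)`. -/
lemma holdsNearOne_finrank_span {ι m : Type} [Fintype ι] [Fintype m]
    (W : ι → kˣ × kˣ → m → FunctionField k)
    (hW : ∀ i j, IsRationalFamily fun p => W i p j) :
    HoldsNearOne fun p => Module.finrank k (Submodule.span k (Set.range fun i => W i 1)) ≤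
      Module.finrank k (Submodule.span k (Set.range fun i => W i p)) := by
  obtain ⟨κ, a, ha, hspan, hli⟩ := exists_linearIndependent' k fun i => W i 1
  haveI : Finite κ := Finite.of_injective a ha
  haveI := Fintype.ofFinite κ
  refine (holdsNearOne_linearIndependent (fun i => W (a i)) (fun i j => hW (a i) j) hli).mono
    fun p hp => ?_
  rw [← hspan, finrank_span_eq_card hli, ← finrank_span_eq_card hp]
  haveI : FiniteDimensional k (Submodule.span k (Set.range fun i => W i p)) :=
    FiniteDimensional.span_of_finite k (Set.finite_range _)
  refine Submodule.finrank_mono (Submodule.span_mono ?_)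
  rintro _ ⟨i, rfl⟩
  exact ⟨a i, rfl⟩

end Semicontinuity

/-! ### General subsets -/

section GeneralSubsets

variable {k : Type u} [Field k]

/-- The substitution `p ↦ p⁻¹` in a polynomial, after multiplication with a monomial. -/
lemma exists_evalParam_inv (f : MvPolynomial (Fin 2) ℤ) :
    ∃ (g : MvPolynomial (Fin 2) ℤ) (N : ℕ), ∀ p : kˣ × kˣ,
      evalParam p g = ((p.1 : k) * p.2) ^ N * evalParam p⁻¹ f := by
  have hX : ∀ (p : kˣ × kˣ) (N : ℕ),
      evalParam p ((MvPolynomial.X 0 * MvPolynomial.X 1) ^ N) = ((p.1 : k) * p.2) ^ N := by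
    intro p N
    simp [evalParam]
  induction f using MvPolynomial.induction_on with
  | C a => exact ⟨MvPolynomial.C a, 0, fun p => by simp [evalParam]⟩
  | add f f' h h' =>
    obtain ⟨g, N, h⟩ := h
    obtain ⟨g', N', h'⟩ := h'
    refine ⟨(MvPolynomial.X 0 * MvPolynomial.X 1) ^ N' * g +
      (MvPolynomial.X 0 * MvPolynomial.X 1) ^ N * g', N + N', fun p => ?_⟩
    rw [map_add, map_mul, map_mul, hX, hX, h, h', map_add]
    ring
  | mul_X f i h =>
    obtain ⟨g, N, h⟩ := h
    fin_cases i
    · refine ⟨MvPolynomial.X 1 * g, N + 1, fun p => ?_⟩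
      have h1 : evalParam p (MvPolynomial.X 1) = (p.2 : k) := by simp [evalParam]
      have h2 : evalParam p⁻¹ (MvPolynomial.X 0) = (p.1 : k)⁻¹ := by simp [evalParam]
      have h3 := p.1.ne_zero
      simp only [Fin.zero_eta, map_mul, h, h1, h2]
      field_simp
      ring
    · refine ⟨MvPolynomial.X 0 * g, N + 1, fun p => ?_⟩
      have h1 : evalParam p (MvPolynomial.X 0) = (p.1 : k) := by simp [evalParam]
      have h2 : evalParam p⁻¹ (MvPolynomial.X 1) = (p.2 : k)⁻¹ := by simp [evalParam]
      have h3 := p.2.ne_zero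
      simp only [Fin.mk_one, map_mul, h, h1, h2]
      field_simp
      ring

lemma HoldsNearOne.inv {P : kˣ × kˣ → Prop} (h : HoldsNearOne P) :
    HoldsNearOne fun p => P p⁻¹ := by
  obtain ⟨f, h1, h⟩ := h
  obtain ⟨g, N, hg⟩ := exists_evalParam_inv (k := k) f
  have hu : ∀ p : kˣ × kˣ, evalParam p g ≠ 0 ↔ evalParam p⁻¹ f ≠ 0 := by
    intro p
    have : ((p.1 : k) * p.2) ^ N ≠ 0 := pow_ne_zero _ (mul_ne_zero p.1.ne_zero p.2.ne_zero)
    rw [hg, mul_ne_zero_iff, and_iff_right this]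
  exact ⟨g, (hu 1).2 (by rwa [inv_one]), fun p hp => h _ ((hu p).1 hp)⟩

/-- A polynomial that does not vanish at `(1, 1)` does not vanish at algebraically independent
parameters either: some coefficient of it is nonzero in the prime field. -/
lemma evalParam_ne_zero_of_algebraicIndependent {f : MvPolynomial (Fin 2) ℤ}
    (hf : evalParam (1 : kˣ × kˣ) f ≠ 0) (ρ θ : kˣ)
    (h : AlgebraicIndependent (⊥ : Subfield k) ![(ρ : k), (θ : k)]) :
    evalParam (ρ, θ) f ≠ 0 := by
  let f' : MvPolynomial (Fin 2) (⊥ : Subfield k) :=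
    MvPolynomial.map (Int.castRingHom (⊥ : Subfield k)) f
  have key : ∀ p : kˣ × kˣ, evalParam p f = MvPolynomial.aeval ![(p.1 : k), (p.2 : k)] f' := by
    intro p
    rw [MvPolynomial.aeval_def, MvPolynomial.eval₂_map, evalParam, MvPolynomial.coe_eval₂Hom]
    congr 1
  have hne : f' ≠ 0 := by
    intro h0
    apply hf
    rw [key, h0, map_zero]
  rw [key]
  intro h0
  exact hne (h (h0.trans (map_zero _).symm))

/-- Countably many properties, each of which holds on a nonempty open set over the prime field
containing `(1, 1)`, hold on a general subset; so do their analogues for the inverse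
parameters. -/
theorem exists_isGeneralSubset (P : ℕ → kˣ × kˣ → Prop) (hP : ∀ n, HoldsNearOne (P n)) :
    ∃ U : Set (kˣ × kˣ), IsGeneralSubset U ∧ (1, 1) ∈ U ∧
      (∀ ρ θ : kˣ, AlgebraicIndependent (⊥ : Subfield k) ![(ρ : k), (θ : k)] → (ρ, θ) ∈ U) ∧
      ∀ p ∈ U, ∀ n, P n p ∧ P n p⁻¹ := by
  choose f h1 h using fun n => (hP n).and (hP n).inv
  have hmem : ∀ p : kˣ × kˣ, p ∈ (⋃ n, {p : kˣ × kˣ | evalParam p (f n) = 0})ᶜ ↔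
      ∀ n, evalParam p (f n) ≠ 0 := by
    intro p
    simp
  refine ⟨(⋃ n, {p : kˣ × kˣ | evalParam p (f n) = 0})ᶜ, ⟨_, fun n => ⟨?_, ?_⟩, rfl⟩,
    (hmem _).2 h1, fun ρ θ hi => (hmem _).2 fun n =>
      evalParam_ne_zero_of_algebraicIndependent (h1 n) ρ θ hi,
    fun p hp n => h n p ((hmem p).1 hp n)⟩
  · refine ⟨{MvPolynomial.map (Int.castRingHom k) (f n)}, ?_⟩
    ext p
    simp [evalParam, MvPolynomial.eval_map, MvPolynomial.coe_eval₂Hom]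
  · intro hu
    have : (1 : kˣ × kˣ) ∈ {p : kˣ × kˣ | evalParam p (f n) = 0} := by rw [hu]; trivial
    exact h1 n this

end GeneralSubsets

/-! ### Ranks in a given degree -/

section Ranks

variable {k : Type u} [Field k]

/-- Columns (or rows) of length `m` with entries in the subspace `W`. -/
abbrev tuples {K : Type u} [AddCommGroup K] [Module k K] (m : ℕ) (W : Submodule k K) :
    Submodule k (Fin m → K) := Submodule.pi Set.univ fun _ => W

lemma mem_tuples {K : Type u} [AddCommGroup K] [Module k K] {m : ℕ} {W : Submodule k K}
    {y : Fin m → K} : y ∈ tuples m W ↔ ∀ j, y j ∈ W := by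
  simp [tuples, Submodule.mem_pi]

lemma tuples_span {K : Type u} [AddCommGroup K] [Module k K] {m : ℕ} {ι : Type} (w : ι → K) :
    tuples m (Submodule.span k (Set.range w)) =
      Submodule.span k (Set.range fun ji : Fin m × ι => Pi.single ji.1 (w ji.2)) := by
  apply le_antisymm
  · intro y hy
    rw [mem_tuples] at hy
    rw [← Finset.univ_sum_single y]
    refine Submodule.sum_mem _ fun j _ => ?_
    have h : ∀ z ∈ Submodule.span k (Set.range w), (Pi.single j z : Fin m → K) ∈
        Submodule.span k (Set.range fun ji : Fin m × ι => Pi.single ji.1 (w ji.2)) := by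
      intro z hz
      induction hz using Submodule.span_induction with
      | mem x hx => obtain ⟨i, rfl⟩ := hx; exact Submodule.subset_span ⟨(j, i), rfl⟩
      | zero => rw [Pi.single_zero]; exact zero_mem _
      | add x y _ _ hx hy => rw [Pi.single_add]; exact add_mem hx hy
      | smul c x _ hx => rw [Pi.single_smul]; exact Submodule.smul_mem _ _ hx
    exact h _ (hy j)
  · rw [Submodule.span_le]
    rintro _ ⟨⟨j, i⟩, rfl⟩
    refine mem_tuples.2 fun j' => ?_
    by_cases h : j' = j
    · subst h; simp only [Pi.single_eq_same]; exact Submodule.subset_span ⟨i, rfl⟩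
    · simp only [Pi.single_eq_of_ne h]; exact zero_mem _

lemma finrank_tuples {K : Type u} [AddCommGroup K] [Module k K] (m : ℕ) (W : Submodule k K)
    [FiniteDimensional k W] :
    Module.finrank k (tuples m W) = m * Module.finrank k W := by
  let e : tuples m W ≃ₗ[k] (Fin m → W) :=
    { toFun := fun y j => ⟨y.1 j, mem_tuples.1 y.2 j⟩
      invFun := fun y => ⟨fun j => y j, mem_tuples.2 fun j => (y j).2⟩
      map_add' := fun _ _ => rfl
      map_smul' := fun _ _ => rfl
      left_inv := fun _ => rfl
      right_inv := fun _ => rfl }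
  rw [e.finrank_eq, Module.finrank_pi_fintype]
  simp

instance finiteDimensional_tuples {K : Type u} [AddCommGroup K] [Module k K] (m : ℕ)
    (W : Submodule k K) [FiniteDimensional k W] : FiniteDimensional k (tuples m W) := by
  let f : tuples m W →ₗ[k] (Fin m → W) :=
    { toFun := fun y j => ⟨y.1 j, mem_tuples.1 y.2 j⟩
      map_add' := fun _ _ => rfl
      map_smul' := fun _ _ => rfl }
  refine FiniteDimensional.of_injective f fun x y h => Subtype.ext (funext fun j => ?_)
  exact congrArg Subtype.val (congrFun h j)

lemma isRationalFamily_coordE (i : Fin 4) : IsRationalFamily fun _ : kˣ × kˣ => coordE k i := by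
  fin_cases i
  · exact .one
  · exact .coordU
  · exact .coordV
  · exact .mul .coordU .coordV

lemma span_coordE : Submodule.span k (Set.range (coordE k)) = spaceE k := by
  rw [spaceE, coordE]
  congr 1
  ext x
  simp only [Set.mem_range, Fin.exists_fin_succ, Set.mem_insert_iff, Set.mem_singleton_iff]
  simp [eq_comm]

lemma isRationalFamily_single {a : ℕ} {F : kˣ × kˣ → FunctionField k}
    (hF : IsRationalFamily F) (j j' : Fin a) :
    IsRationalFamily fun p => (Pi.single j (F p) : Fin a → FunctionField k) j' := by
  by_cases h : j' = j
  · subst h; simpa using hF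
  · simpa [Pi.single_eq_of_ne h] using IsRationalFamily.zero

lemma IsRationalFamily.sum {ι : Type} (s : Finset ι) {F : ι → kˣ × kˣ → FunctionField k}
    (h : ∀ i, IsRationalFamily (F i)) : IsRationalFamily fun p => ∑ i ∈ s, F i p := by
  classical
  induction s using Finset.induction_on with
  | empty => simpa using IsRationalFamily.zero
  | insert i s hi ih => simpa [Finset.sum_insert hi] using (h i).add ih

lemma isRationalFamily_coeffZ (i : Fin 10) :
    IsRationalFamily fun p : kˣ × kˣ => coeffZ p.1 p.2 i := by
  have γ := IsRationalFamily.cplus_fst (k := k)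
  have δ := IsRationalFamily.cminus_fst (k := k)
  have ε := IsRationalFamily.cplus_snd (k := k)
  have ζ := IsRationalFamily.cminus_snd (k := k)
  have u := IsRationalFamily.coordU (k := k)
  have v := IsRationalFamily.coordV (k := k)
  fin_cases i
  · exact ζ.sub (ε.mul v)
  · exact ε.sub (ζ.mul v)
  · exact (ζ.sub (ε.mul v)).mul u
  · exact (ε.sub (ζ.mul v)).mul u
  · exact δ.sub (γ.mul u)
  · exact γ.sub (δ.mul u)
  · exact (δ.sub (γ.mul u)).mul v
  · exact (γ.sub (δ.mul u)).mul v
  · exact ((γ.mul u).sub δ).mul (ε.sub (ζ.mul v))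
  · exact ((δ.mul u).sub γ).mul ((ε.mul v).sub ζ)

variable [NeZero (2 : k)]

/-- The space `W_n` is spanned by the coefficients of the words of length `n`, which are rational
families. -/
lemma exists_rational_spanning (n : ℕ) :
    ∃ (ι : Type) (_ : Fintype ι) (w : ι → kˣ × kˣ → FunctionField k),
      (∀ i, IsRationalFamily (w i)) ∧
      ∀ p : kˣ × kˣ, pieceW p.1 p.2 n = Submodule.span k (Set.range fun i => w i p) := by
  induction n with
  | zero =>
    refine ⟨Unit, inferInstance, fun _ _ => 1, fun _ => .one, fun p => ?_⟩
    rw [pieceW, twistedPower_zero, Submodule.one_eq_span]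
    simp
  | succ n ih =>
    obtain ⟨ι, _, w, hw, hspan⟩ := ih
    refine ⟨Fin 4 × ι, inferInstance, fun ji p => coordE k ji.1 * phi p.1 p.2 (w ji.2 p),
      fun ji => (isRationalFamily_coordE ji.1).mul (hw ji.2).phi, fun p => ?_⟩
    rw [pieceW, twistedPower_succ]
    have h := hspan p
    rw [pieceW] at h
    rw [h, ← span_coordE, Submodule.map_span, Submodule.span_mul_span]
    congr 1
    ext x
    simp only [Set.mem_mul, Set.mem_range, Set.mem_image, Prod.exists]
    constructor
    · rintro ⟨_, ⟨j, rfl⟩, _, ⟨_, ⟨i, rfl⟩, rfl⟩, rfl⟩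
      exact ⟨j, i, rfl⟩
    · rintro ⟨j, i, rfl⟩
      exact ⟨_, ⟨j, rfl⟩, _, ⟨_, ⟨i, rfl⟩, rfl⟩, rfl⟩

/-- The rank, in degree `n`, of the action on columns of a matrix with coefficients `c`. -/
def rankCol (ρ θ : kˣ) {a b : ℕ} (n : ℕ) (c : Matrix (Fin b) (Fin a) (FunctionField k)) : ℕ :=
  Module.finrank k ((tuples a (pieceW ρ θ n)).map (twistMap (phi ρ θ) c))

/-- The rank, in degree `n`, of the action on rows of a matrix with coefficients `c`. -/
def rankRow (ρ θ : kˣ) {a b : ℕ} (n : ℕ) (c : Matrix (Fin a) (Fin b) (FunctionField k)) : ℕ :=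
  Module.finrank k ((tuples a (pieceW ρ θ n)).map (rowMap (phi ρ θ) n c))

lemma holdsNearOne_finrank_map {a b : ℕ} (n : ℕ)
    (L : ∀ _ : kˣ × kˣ, (Fin a → FunctionField k) →ₗ[k] (Fin b → FunctionField k))
    (hL : ∀ F : kˣ × kˣ → FunctionField k, IsRationalFamily F → ∀ j i,
      IsRationalFamily fun p => L p (Pi.single j (F p)) i) :
    HoldsNearOne fun p : kˣ × kˣ =>
      Module.finrank k ((tuples a (pieceW (1 : kˣ × kˣ).1 (1 : kˣ × kˣ).2 n)).map (L 1)) ≤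
        Module.finrank k ((tuples a (pieceW p.1 p.2 n)).map (L p)) := by
  obtain ⟨ι, _, w, hw, hspan⟩ := exists_rational_spanning (k := k) n
  have key : ∀ p : kˣ × kˣ, (tuples a (pieceW p.1 p.2 n)).map (L p) =
      Submodule.span k (Set.range fun ji : Fin a × ι => L p (Pi.single ji.1 (w ji.2 p))) := by
    intro p
    rw [hspan p, tuples_span, Submodule.map_span, ← Set.range_comp]
    rfl
  refine (holdsNearOne_finrank_span (fun (ji : Fin a × ι) p => L p (Pi.single ji.1 (w ji.2 p)))
    fun ji i => hL _ (hw ji.2) _ _).mono fun p hp => ?_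
  rw [key p, key 1]
  exact hp

/-- The rank in a given degree of the action on columns of a matrix with rational coefficients is
semicontinuous at `(1, 1)`. -/
lemma holdsNearOne_finrank_twistMap {a b : ℕ} (n : ℕ)
    (c : kˣ × kˣ → Matrix (Fin b) (Fin a) (FunctionField k))
    (hc : ∀ i j, IsRationalFamily fun p => c p i j) :
    HoldsNearOne fun p : kˣ × kˣ =>
      rankCol (1 : kˣ × kˣ).1 (1 : kˣ × kˣ).2 n (c 1) ≤ rankCol p.1 p.2 n (c p) := by
  let L : kˣ × kˣ → (Fin a → FunctionField k) →ₗ[k] (Fin b → FunctionField k) :=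
    fun p => twistMap (phi p.1 p.2) (c p)
  refine holdsNearOne_finrank_map (k := k) n L fun F hF j i => ?_
  have h : ∀ l, IsRationalFamily fun p : kˣ × kˣ =>
      c p i l * phi p.1 p.2 ((Pi.single j (F p) : Fin a → FunctionField k) l) :=
    fun l => (hc i l).mul (isRationalFamily_single hF j l).phi
  have hs := IsRationalFamily.sum Finset.univ h
  refine hs.congr fun p => ?_
  rw [twistMap_apply]

/-- The rank in a given degree of the action on rows of a matrix with rational coefficients is
semicontinuous at `(1, 1)`. -/
lemma holdsNearOne_finrank_rowMap {a b : ℕ} (n : ℕ)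
    (c : kˣ × kˣ → Matrix (Fin a) (Fin b) (FunctionField k))
    (hc : ∀ i j, IsRationalFamily fun p => c p i j) :
    HoldsNearOne fun p : kˣ × kˣ =>
      rankRow (1 : kˣ × kˣ).1 (1 : kˣ × kˣ).2 n (c 1) ≤ rankRow p.1 p.2 n (c p) := by
  let L : kˣ × kˣ → (Fin a → FunctionField k) →ₗ[k] (Fin b → FunctionField k) :=
    fun p => rowMap (phi p.1 p.2) n (c p)
  refine holdsNearOne_finrank_map (k := k) n L fun F hF j i => ?_
  have h : ∀ l, IsRationalFamily fun p : kˣ × kˣ =>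
      (Pi.single j (F p) : Fin a → FunctionField k) l * (phi p.1 p.2 ^ n) (c p l i) :=
    fun l => (isRationalFamily_single hF j l).mul ((hc l i).phi_pow n)
  have hs := IsRationalFamily.sum Finset.univ h
  refine hs.congr fun p => ?_
  rw [rowMap_apply]

/-- No rank relevant for the complex of `R(τ)` or its dual in degree `n` is smaller than the
corresponding rank at the parameters `(1, 1)`. -/
def RanksAtLeast (n : ℕ) (ρ θ : kˣ) : Prop :=
  rankCol 1 1 n (shapeQ (coordE k)) ≤ rankCol ρ θ n (shapeQ (coordE k)) ∧
  rankCol 1 1 n (shapeP (coeffZ (1 : kˣ) 1)) ≤ rankCol ρ θ n (shapeP (coeffZ ρ θ)) ∧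
  rankCol 1 1 n (shapeN (coeffZ (1 : kˣ) 1)) ≤ rankCol ρ θ n (shapeN (coeffZ ρ θ)) ∧
  rankCol 1 1 n (shapeM (coeffZ (1 : kˣ) 1)) ≤ rankCol ρ θ n (shapeM (coeffZ ρ θ)) ∧
  rankRow 1 1 n (shapeP (coeffZ (1 : kˣ) 1)) ≤ rankRow ρ θ n (shapeP (coeffZ ρ θ))

lemma holdsNearOne_ranksAtLeast (n : ℕ) :
    HoldsNearOne fun p : kˣ × kˣ => RanksAtLeast n p.1 p.2 := by
  have hz : ∀ i, IsRationalFamily ((fun i (p : kˣ × kˣ) => coeffZ p.1 p.2 i) i) :=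
    isRationalFamily_coeffZ
  have hP : ∀ i j, IsRationalFamily fun p : kˣ × kˣ => shapeP (coeffZ p.1 p.2) i j := by
    intro i j
    have := shapeP_forall IsRationalFamily IsRationalFamily.zero hz i j
    exact this.congr fun p =>
      congrFun (congrFun (shapeP_map (fun f : kˣ × kˣ → FunctionField k => f p) rfl
        fun i (p : kˣ × kˣ) => coeffZ p.1 p.2 i) i) j
  have hN : ∀ i j, IsRationalFamily fun p : kˣ × kˣ => shapeN (coeffZ p.1 p.2) i j := by
    intro i j
    have := shapeN_forall IsRationalFamily IsRationalFamily.zero hz i j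
    exact this.congr fun p =>
      congrFun (congrFun (shapeN_map (fun f : kˣ × kˣ → FunctionField k => f p) rfl
        fun i (p : kˣ × kˣ) => coeffZ p.1 p.2 i) i) j
  have hM : ∀ i j, IsRationalFamily fun p : kˣ × kˣ => shapeM (coeffZ p.1 p.2) i j := by
    intro i j
    have := shapeM_forall IsRationalFamily IsRationalFamily.zero hz i j
    exact this.congr fun p =>
      congrFun (congrFun (shapeM_map (fun f : kˣ × kˣ → FunctionField k => f p) rfl
        fun i (p : kˣ × kˣ) => coeffZ p.1 p.2 i) i) j
  have hQ : ∀ i j, IsRationalFamily fun _ : kˣ × kˣ => shapeQ (coordE k) i j :=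
    fun i j => shapeQ_forall (fun x => IsRationalFamily fun _ : kˣ × kˣ => x)
      isRationalFamily_coordE i j
  have := (holdsNearOne_finrank_twistMap n (fun _ => shapeQ (coordE k)) hQ).and
    ((holdsNearOne_finrank_twistMap n (fun p => shapeP (coeffZ p.1 p.2)) hP).and
      ((holdsNearOne_finrank_twistMap n (fun p => shapeN (coeffZ p.1 p.2)) hN).and
        ((holdsNearOne_finrank_twistMap n (fun p => shapeM (coeffZ p.1 p.2)) hM).and
          (holdsNearOne_finrank_rowMap n (fun p => shapeP (coeffZ p.1 p.2)) hP))))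
  simp only [Prod.fst_one, Prod.snd_one] at this
  exact this

end Ranks

/-! ### The exponents of the monomials in `W_n` at the parameters `(1, 1)` -/

section Exponents

/-- The exponents `(a, b)` of the monomials `u ^ a v ^ b` in `W_n` at `(1, 1)`: these are the pairs
with `a ≤ n` and `a (a - 1) / 2 ≤ b ≤ a (a - 1) / 2 + a (n - a) + n`. -/
def exponents (n : ℕ) : Set (ℕ × ℕ) :=
  {x | x.1 ≤ n ∧ x.1 * x.1 ≤ 2 * x.2 + x.1 ∧
    2 * x.2 + x.1 + x.1 * x.1 ≤ 2 * x.1 * n + 2 * n}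

lemma mem_exponents {n a b : ℕ} : (a, b) ∈ exponents n ↔
    a ≤ n ∧ a * a ≤ 2 * b + a ∧ 2 * b + a + a * a ≤ 2 * a * n + 2 * n := Iff.rfl

lemma two_mul_choose_two_add (a : ℕ) : 2 * a.choose 2 + a = a * a := by
  induction a with
  | zero => rfl
  | succ a ih => rw [Nat.choose_succ_succ' a 1, Nat.choose_one_right]; linarith

lemma sum_range_mul_sub (n : ℕ) :
    ∑ a ∈ Finset.range (n + 1), a * (n - a) = (n + 1).choose 3 := by
  induction n with
  | zero => rfl
  | succ n ih =>
    have h : ∀ a ∈ Finset.range (n + 1), a * (n + 1 - a) = a + a * (n - a) := by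
      intro a ha
      rw [Nat.sub_add_comm (Nat.lt_succ_iff.1 (Finset.mem_range.1 ha)), mul_add, mul_one, add_comm]
    rw [Finset.sum_range_succ, Nat.sub_self, mul_zero, add_zero, Finset.sum_congr rfl h,
      Finset.sum_add_distrib, ih, Finset.sum_range_id, ← Nat.choose_two_right]
    exact (Nat.choose_succ_succ' (n + 1) 2).symm

/-- The exponents form a finite set with `dim k[x₁, …, x₄]_n` elements. -/
lemma exists_finset_exponents (n : ℕ) :
    ∃ s : Finset (ℕ × ℕ), (s : Set (ℕ × ℕ)) = exponents n ∧ s.card = (n + 3).choose 3 := by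
  classical
  let I : ℕ → Finset ℕ := fun a => Finset.Icc (a.choose 2) (a.choose 2 + a * (n - a) + n)
  refine ⟨((Finset.range (n + 1)).sigma I).map (Equiv.sigmaEquivProd ℕ ℕ).toEmbedding, ?_, ?_⟩
  · ext ⟨a, b⟩
    have ht := two_mul_choose_two_add a
    rw [Finset.coe_map, Equiv.coe_toEmbedding, Equiv.image_eq_preimage_symm]
    simp only [Set.mem_preimage, Equiv.sigmaEquivProd_symm_apply, Finset.mem_coe,
      Finset.mem_sigma, Finset.mem_range, mem_exponents, I, Finset.mem_Icc]
    constructor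
    · rintro ⟨ha, hb, hb'⟩
      obtain ⟨c, rfl⟩ := Nat.exists_eq_add_of_le (Nat.lt_succ_iff.1 ha)
      rw [Nat.add_sub_cancel_left] at hb'
      exact ⟨by omega, by omega, by nlinarith⟩
    · rintro ⟨ha, h1, h2⟩
      obtain ⟨c, rfl⟩ := Nat.exists_eq_add_of_le ha
      rw [Nat.add_sub_cancel_left]
      exact ⟨by omega, by omega, by nlinarith⟩
  · rw [Finset.card_map, Finset.card_sigma]
    have : ∀ a ∈ Finset.range (n + 1), (I a).card = a * (n - a) + (n + 1) := by
      intro a _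
      simp only [I, Nat.card_Icc]
      omega
    rw [Finset.sum_congr rfl this, Finset.sum_add_distrib, sum_range_mul_sub, Finset.sum_const,
      Finset.card_range, smul_eq_mul]
    have h1 : (n + 3).choose 3 = (n + 2).choose 2 + (n + 2).choose 3 := Nat.choose_succ_succ' _ _
    have h2 : (n + 2).choose 3 = (n + 1).choose 2 + (n + 1).choose 3 := Nat.choose_succ_succ' _ _
    have h3 : (n + 2).choose 2 = (n + 1).choose 1 + (n + 1).choose 2 := Nat.choose_succ_succ' _ _
    have h4 := two_mul_choose_two_add (n + 1)
    rw [Nat.choose_one_right] at h3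
    omega

/-- Multiplication by `u ^ i v ^ j t` on the left, on exponents. -/
def shiftExp (i j : ℕ) (x : ℕ × ℕ) : ℕ × ℕ := (x.1 + i, x.1 + x.2 + j)

lemma shiftExp_injective (i j : ℕ) : Function.Injective (shiftExp i j) := by
  rintro ⟨a, b⟩ ⟨c, d⟩ h
  simp only [shiftExp, Prod.mk.injEq] at h
  ext <;> simp only <;> omega

lemma shiftExp_mem {n i j : ℕ} (hi : i ≤ 1) (hj : j ≤ 1) {x : ℕ × ℕ} (hx : x ∈ exponents n) :
    shiftExp i j x ∈ exponents (n + 1) := by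
  obtain ⟨a, b⟩ := x
  rw [mem_exponents] at hx
  obtain ⟨h1, h2, h3⟩ := hx
  simp only [shiftExp, mem_exponents]
  interval_cases i <;> interval_cases j <;> refine ⟨by omega, by nlinarith, by nlinarith⟩

/-- Multiplication by `t`, `u t`, `v t`, `u v t` takes the monomials of `W_n t ^ n` to all of those
of `W_{n+1} t ^ (n+1)`.  The case distinction separates the exponents reached without and with a
factor `u`, and then those reached without and with a factor `v`. -/
lemma exists_shiftExp {n : ℕ} {x : ℕ × ℕ} (hx : x ∈ exponents (n + 1)) :
    ∃ i ≤ 1, ∃ j ≤ 1, ∃ y ∈ exponents n, shiftExp i j y = x := by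
  obtain ⟨a, b⟩ := x
  obtain ⟨h1, h2, h3⟩ := mem_exponents.1 hx
  by_cases hA : a ≤ n ∧ a * a + a ≤ 2 * b
  · obtain ⟨hA1, hA2⟩ := hA
    by_cases hB : 2 * b + a * a ≤ 2 * a * n + 2 * n + a
    · refine ⟨0, by omega, 0, by omega, (a, b - a), ?_, ?_⟩
      · have : a ≤ b := by nlinarith
        obtain ⟨c, rfl⟩ := Nat.exists_eq_add_of_le this
        rw [Nat.add_sub_cancel_left, mem_exponents]
        exact ⟨hA1, by nlinarith, by nlinarith⟩
      · have : a ≤ b := by nlinarith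
        simp only [shiftExp, Prod.mk.injEq]; omega
    · have hab : a + 1 ≤ b := by
        obtain rfl | h := Nat.eq_zero_or_pos a
        · omega
        · nlinarith
      obtain ⟨c, rfl⟩ := Nat.exists_eq_add_of_le hab
      refine ⟨0, by omega, 1, by omega, (a, c), ?_, ?_⟩
      · rw [mem_exponents]
        refine ⟨hA1, ?_, by nlinarith⟩
        obtain ⟨d, rfl⟩ := Nat.exists_eq_add_of_le hA1
        obtain rfl | h := Nat.eq_zero_or_pos a
        · omega
        · nlinarith
      · simp only [shiftExp, Prod.mk.injEq]; omega
  · obtain _ | a := a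
    · omega
    have hC : a ≤ b := by nlinarith
    by_cases hB : 2 * b + a * a ≤ 2 * a * n + 2 * n + a
    · obtain ⟨c, rfl⟩ := Nat.exists_eq_add_of_le hC
      refine ⟨1, by omega, 0, by omega, (a, c), ?_, ?_⟩
      · rw [mem_exponents]
        exact ⟨Nat.le_of_succ_le_succ h1, by nlinarith, by nlinarith⟩
      · exact Prod.ext rfl (by simp only [shiftExp]; omega)
    · have han : a ≤ n := Nat.le_of_succ_le_succ h1
      have hab : a * a + a + 2 ≤ 2 * b := by
        obtain ⟨d, rfl⟩ := Nat.exists_eq_add_of_le han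
        obtain h | h := Nat.eq_zero_or_pos (a + d)
        · have h4 : a = 0 := by omega
          have h5 : d = 0 := by omega
          subst h4 h5; omega
        · nlinarith
      have hab' : a + 1 ≤ b := by nlinarith
      obtain ⟨c, rfl⟩ := Nat.exists_eq_add_of_le hab'
      refine ⟨1, by omega, 1, by omega, (a, c), ?_, ?_⟩
      · rw [mem_exponents]
        refine ⟨han, by nlinarith, ?_⟩
        by_cases h : a + 1 ≤ n
        · have : 2 * (a + 1 + c) < (a + 1) * (a + 1) + (a + 1) := by
            by_contra h'
            exact hA ⟨h, by omega⟩
          obtain ⟨d, rfl⟩ := Nat.exists_eq_add_of_le h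
          nlinarith
        · have : a = n := by omega
          subst this
          nlinarith
      · exact Prod.ext rfl (by simp only [shiftExp]; omega)

/-- `t W ∩ ut W` is contained in `t u t W`, on exponents. -/
lemma shift_inter_subset (n : ℕ) :
    shiftExp 0 0 '' exponents (n + 1) ∩ shiftExp 1 0 '' exponents (n + 1) ⊆
      shiftExp 0 0 '' (shiftExp 1 0 '' exponents n) := by
  rintro _ ⟨⟨⟨a, b⟩, h, rfl⟩, ⟨⟨c, d⟩, h', e⟩⟩
  simp only [shiftExp, Prod.mk.injEq, add_zero] at e
  obtain ⟨rfl, e⟩ := e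
  rw [mem_exponents] at h h'
  obtain ⟨h1, h2, h3⟩ := h
  obtain ⟨h4, h5, h6⟩ := h'
  have hcb : c ≤ b := by nlinarith
  obtain ⟨f, rfl⟩ := Nat.exists_eq_add_of_le hcb
  have hd : d = c + f + 1 := by omega
  subst hd
  refine ⟨(c + 1, c + f), ⟨(c, f), ?_, rfl⟩, rfl⟩
  rw [mem_exponents]
  exact ⟨by omega, by nlinarith, by nlinarith⟩

lemma shift_inter_subset_zero :
    shiftExp 0 0 '' exponents 0 ∩ shiftExp 1 0 '' exponents 0 = ∅ := by
  ext ⟨x, y⟩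
  constructor
  · rintro ⟨⟨⟨a, b⟩, h, e⟩, ⟨⟨c, d⟩, h', e'⟩⟩
    simp only [shiftExp, Prod.mk.injEq] at e e'
    have := (mem_exponents.1 h).1
    omega
  · exact fun h => h.elim

/-- `t W ∩ vt W` is contained in `t (vt W + uvt W)`, on exponents. -/
lemma shift_inter_subset' (n : ℕ) :
    shiftExp 0 0 '' exponents (n + 1) ∩ shiftExp 0 1 '' exponents (n + 1) ⊆
      shiftExp 0 0 '' (shiftExp 0 1 '' exponents n ∪ shiftExp 1 1 '' exponents n) := by
  rintro _ ⟨⟨⟨a, b⟩, h, rfl⟩, ⟨⟨c, d⟩, h', e⟩⟩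
  simp only [shiftExp, Prod.mk.injEq, add_zero] at e
  obtain ⟨rfl, e⟩ := e
  have hd : b = d + 1 := by omega
  subst hd
  rw [mem_exponents] at h h'
  obtain ⟨h1, h2, h3⟩ := h
  obtain ⟨h4, h5, h6⟩ := h'
  refine ⟨(c, d + 1), ?_, rfl⟩
  by_cases hA : c ≤ n ∧ c * c + c ≤ 2 * d
  · left
    have hcd : c ≤ d := by nlinarith
    obtain ⟨f, rfl⟩ := Nat.exists_eq_add_of_le hcd
    refine ⟨(c, f), ?_, rfl⟩
    rw [mem_exponents]
    exact ⟨by omega, by nlinarith, by nlinarith⟩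
  · right
    obtain _ | c := c
    · omega
    have hcd : c ≤ d := by nlinarith
    obtain ⟨f, rfl⟩ := Nat.exists_eq_add_of_le hcd
    refine ⟨(c, f), ?_, rfl⟩
    rw [mem_exponents]
    refine ⟨by omega, by nlinarith, ?_⟩
    by_cases h : c + 1 ≤ n
    · have : 2 * (c + f) < (c + 1) * (c + 1) + (c + 1) := by
        by_contra h'
        exact hA ⟨h, by omega⟩
      obtain ⟨e, rfl⟩ := Nat.exists_eq_add_of_le h
      nlinarith
    · have : c = n := by omega
      subst this
      nlinarith

lemma shift_inter_subset_zero' :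
    shiftExp 0 0 '' exponents 0 ∩ shiftExp 0 1 '' exponents 0 = ∅ := by
  ext ⟨x, y⟩
  constructor
  · rintro ⟨⟨⟨a, b⟩, h, e⟩, ⟨⟨c, d⟩, h', e'⟩⟩
    simp only [shiftExp, Prod.mk.injEq] at e e'
    have h1 := mem_exponents.1 h
    have h2 := mem_exponents.1 h'
    have h3 : a = 0 := by omega
    have h4 : c = 0 := by omega
    subst h3 h4
    omega
  · exact fun h => h.elim

lemma mem_exponents_of_succ {n a b : ℕ} (h : (a, b) ∈ exponents (n + 1))
    (h' : (a + 1, b + (n + 1)) ∈ exponents (n + 1)) : (a, b) ∈ exponents n := by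
  obtain ⟨h1, h2, h3⟩ := mem_exponents.1 h
  obtain ⟨h4, h5, h6⟩ := mem_exponents.1 h'
  exact mem_exponents.2 ⟨by omega, h2, by nlinarith⟩

end Exponents

/-! ### Spaces spanned by monomials, and ranks at the parameters `(1, 1)` -/

section MonomialSpaces

variable (k : Type u) [Field k]

/-- The monomial `u ^ a v ^ b`. -/
def uvMonomial (x : ℕ × ℕ) : FunctionField k := coordU k ^ x.1 * coordV k ^ x.2

lemma linearIndependent_uvMonomial : LinearIndependent k (uvMonomial k) := by
  have h := (MvPolynomial.basisMonomials (Fin 2) k).linearIndependent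
  have h2 := h.map' (IsScalarTower.toAlgHom k (MvPolynomial (Fin 2) k)
    (FunctionField k)).toLinearMap
    (LinearMap.ker_eq_bot.2 (IsFractionRing.injective (MvPolynomial (Fin 2) k) _))
  have hinj : Function.Injective
      fun x : ℕ × ℕ => (Finsupp.single 0 x.1 + Finsupp.single 1 x.2 : Fin 2 →₀ ℕ) := by
    intro x y hxy
    have h0 := DFunLike.congr_fun hxy 0
    have h1 := DFunLike.congr_fun hxy 1
    simp at h0 h1
    exact Prod.ext h0 h1
  have h3 := h2.comp _ hinj
  have hfun : uvMonomial k = ((IsScalarTower.toAlgHom k (MvPolynomial (Fin 2) k)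
      (FunctionField k)).toLinearMap ∘ MvPolynomial.basisMonomials (Fin 2) k) ∘
      fun x : ℕ × ℕ => (Finsupp.single 0 x.1 + Finsupp.single 1 x.2 : Fin 2 →₀ ℕ) := by
    ext x
    simp only [Function.comp_apply, MvPolynomial.coe_basisMonomials, uvMonomial, coordU, coordV,
      AlgHom.toLinearMap_apply, IsScalarTower.coe_toAlgHom', ← map_pow, ← map_mul]
    congr 1
    rw [MvPolynomial.X_pow_eq_monomial, MvPolynomial.X_pow_eq_monomial,
      MvPolynomial.monomial_mul, one_mul]
  rw [hfun]
  exact h3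

/-- The span of the monomials with exponents in `S`. -/
def monoSpan (S : Set (ℕ × ℕ)) : Submodule k (FunctionField k) :=
  (Finsupp.supported k k S).map (Finsupp.linearCombination k (uvMonomial k))

lemma monoSpan_eq (S : Set (ℕ × ℕ)) :
    monoSpan k S = Submodule.span k (uvMonomial k '' S) :=
  (Finsupp.span_image_eq_map_linearCombination k S).symm

variable {k}

lemma monoSpan_mono {S T : Set (ℕ × ℕ)} (h : S ⊆ T) : monoSpan k S ≤ monoSpan k T :=
  Submodule.map_mono (Finsupp.supported_mono h)

lemma mem_monoSpan_inter {S T : Set (ℕ × ℕ)} {x : FunctionField k} (hS : x ∈ monoSpan k S)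
    (hT : x ∈ monoSpan k T) : x ∈ monoSpan k (S ∩ T) := by
  rw [monoSpan, Finsupp.supported_inter, Submodule.map_inf _ (linearIndependent_uvMonomial k)]
  exact ⟨hS, hT⟩

instance finiteDimensional_monoSpan (s : Finset (ℕ × ℕ)) :
    FiniteDimensional k (monoSpan k (s : Set (ℕ × ℕ))) := by
  rw [monoSpan_eq]
  exact FiniteDimensional.span_of_finite k (s.finite_toSet.image _)

lemma finrank_monoSpan (s : Finset (ℕ × ℕ)) :
    Module.finrank k (monoSpan k (s : Set (ℕ × ℕ))) = s.card := by
  classical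
  have h := finrank_span_finset_eq_card (R := k) (s := s.image (uvMonomial k))
    (by
      rw [Finset.coe_image]
      exact ((linearIndependent_uvMonomial k).linearIndepOn (s := (s : Set _))).id_image)
  rw [monoSpan_eq, ← Finset.coe_image, h,
    Finset.card_image_of_injective _ (linearIndependent_uvMonomial k).injective]

lemma spaceE_eq_monoSpan :
    spaceE k = monoSpan k {x | x.1 ≤ 1 ∧ x.2 ≤ 1} := by
  rw [monoSpan_eq, spaceE]
  congr 1
  ext y
  simp only [Set.mem_insert_iff, Set.mem_singleton_iff, Set.mem_image, Set.mem_ofPred_eq]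
  constructor
  · rintro (rfl | rfl | rfl | rfl)
    · exact ⟨(0, 0), by simp, by simp [uvMonomial]⟩
    · exact ⟨(1, 0), by simp, by simp [uvMonomial]⟩
    · exact ⟨(0, 1), by simp, by simp [uvMonomial]⟩
    · exact ⟨(1, 1), by simp, by simp [uvMonomial]⟩
  · rintro ⟨⟨a, b⟩, ⟨ha, hb⟩, rfl⟩
    simp only at ha hb
    interval_cases a <;> interval_cases b <;> simp [uvMonomial]

lemma cminus_one : cminus (1 : kˣ) = 0 := by simp [cminus]

lemma cplus_one : cplus (1 : kˣ) = 2 := by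
  rw [cplus, Units.val_one, map_add, map_one]; norm_num

variable [NeZero (2 : k)]

lemma two_ne_zero_functionField : (2 : FunctionField k) ≠ 0 := by
  have := cplus_sq_sub (1 : kˣ)
  rw [cminus_one, cplus_one] at this
  intro h
  rw [h] at this
  norm_num at this

lemma phi_one_coordU : phi (1 : kˣ) 1 (coordU k) = coordU k * coordV k := by
  have := phi_numU (1 : kˣ) (1 : kˣ)
  rw [cminus_one, cplus_one] at this
  apply mul_left_cancel₀ (two_ne_zero_functionField (k := k))
  linear_combination this

lemma phi_one_coordV : phi (1 : kˣ) 1 (coordV k) = coordV k := by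
  have := phi_numV (1 : kˣ) (1 : kˣ)
  rw [cminus_one, cplus_one] at this
  apply mul_left_cancel₀ (two_ne_zero_functionField (k := k))
  linear_combination this

lemma phi_one_pow_coordV (n : ℕ) : (phi (1 : kˣ) 1 ^ n) (coordV k) = coordV k := by
  induction n with
  | zero => rfl
  | succ n ih => rw [pow_succ, AlgEquiv.mul_apply, phi_one_coordV, ih]

lemma phi_one_pow_coordU (n : ℕ) :
    (phi (1 : kˣ) 1 ^ n) (coordU k) = coordU k * coordV k ^ n := by
  induction n with
  | zero => rw [pow_zero, pow_zero, mul_one]; rfl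
  | succ n ih =>
    rw [pow_succ, AlgEquiv.mul_apply, phi_one_coordU, map_mul, ih, phi_one_pow_coordV]; ring

lemma uvMonomial_shiftExp (i j : ℕ) (x : ℕ × ℕ) :
    uvMonomial k (shiftExp i j x) =
      coordU k ^ i * coordV k ^ j * phi (1 : kˣ) 1 (uvMonomial k x) := by
  simp only [uvMonomial, shiftExp, map_mul, map_pow, phi_one_coordU, phi_one_coordV]
  ring

/-- The `k`-linear map `y ↦ u ^ i v ^ j φ(y)`. -/
def shiftMap (i j : ℕ) : FunctionField k →ₗ[k] FunctionField k :=
  LinearMap.mulLeft k (coordU k ^ i * coordV k ^ j) ∘ₗ (phi (1 : kˣ) 1).toLinearMap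

lemma map_shiftMap_monoSpan (i j : ℕ) (S : Set (ℕ × ℕ)) :
    (monoSpan k S).map (shiftMap i j) = monoSpan k (shiftExp i j '' S) := by
  rw [monoSpan_eq, monoSpan_eq, Submodule.map_span, ← Set.image_comp, ← Set.image_comp]
  congr 1
  exact Set.image_congr fun x _ => (uvMonomial_shiftExp i j x).symm

lemma shift_mem {i j : ℕ} {S : Set (ℕ × ℕ)} {y : FunctionField k} (hy : y ∈ monoSpan k S) :
    coordU k ^ i * coordV k ^ j * phi (1 : kˣ) 1 y ∈ monoSpan k (shiftExp i j '' S) := by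
  rw [← map_shiftMap_monoSpan]
  exact ⟨y, hy, rfl⟩

/-- At the parameters `(1, 1)` the space `W_n` is spanned by monomials. -/
lemma pieceW_one (n : ℕ) : pieceW (1 : kˣ) 1 n = monoSpan k (exponents n) := by
  induction n with
  | zero =>
    have : exponents 0 = {(0, 0)} := by
      ext ⟨a, b⟩
      rw [mem_exponents, Set.mem_singleton_iff, Prod.mk.injEq]
      constructor
      · rintro ⟨h1, h2, h3⟩
        have : a = 0 := by omega
        subst this
        omega
      · rintro ⟨rfl, rfl⟩; omega
    rw [pieceW, twistedPower_zero, Submodule.one_eq_span, this, monoSpan_eq, Set.image_singleton]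
    simp [uvMonomial]
  | succ n ih =>
    rw [pieceW] at ih
    rw [pieceW, twistedPower_succ, ih, spaceE_eq_monoSpan, monoSpan_eq, monoSpan_eq, monoSpan_eq,
      Submodule.map_span, Submodule.span_mul_span]
    congr 1
    ext y
    simp only [Set.mem_mul, Set.mem_image, Set.mem_ofPred_eq]
    constructor
    · rintro ⟨_, ⟨⟨i, j⟩, ⟨hi, hj⟩, rfl⟩, _, ⟨_, ⟨x, hx, rfl⟩, rfl⟩, rfl⟩
      exact ⟨shiftExp i j x, shiftExp_mem hi hj hx, uvMonomial_shiftExp i j x⟩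
    · rintro ⟨x, hx, rfl⟩
      obtain ⟨i, hi, j, hj, y, hy, rfl⟩ := exists_shiftExp hx
      exact ⟨_, ⟨(i, j), ⟨hi, hj⟩, rfl⟩, _, ⟨_, ⟨y, hy, rfl⟩, rfl⟩,
        (uvMonomial_shiftExp i j y).symm⟩

lemma finrank_pieceW_one (n : ℕ) :
    Module.finrank k (pieceW (1 : kˣ) 1 n) = (n + 3).choose 3 := by
  obtain ⟨s, hs, hc⟩ := exists_finset_exponents n
  rw [pieceW_one, ← hs, finrank_monoSpan, hc]

end MonomialSpaces

section RankBounds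

variable {k : Type u} [Field k]

/-- A bound on the rank: the kernel of `L` in `V` is embedded by `g` into `T`. -/
lemma finrank_le_finrank_map_add {X Y Z : Type*} [AddCommGroup X] [Module k X] [AddCommGroup Y]
    [Module k Y] [AddCommGroup Z] [Module k Z] (V : Submodule k X) [FiniteDimensional k V]
    (L : X →ₗ[k] Y) (g : X →ₗ[k] Z) (T : Submodule k Z) [FiniteDimensional k T]
    (hT : ∀ y ∈ V, L y = 0 → g y ∈ T) (hg : ∀ y ∈ V, L y = 0 → g y = 0 → y = 0) :
    Module.finrank k V ≤ Module.finrank k (V.map L) + Module.finrank k T := by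
  have h := (L.domRestrict V).finrank_range_add_finrank_ker
  rw [LinearMap.range_domRestrict] at h
  rw [← h]
  refine Nat.add_le_add_left ?_ _
  let f : (L.domRestrict V).ker →ₗ[k] T :=
    (g ∘ₗ V.subtype ∘ₗ (L.domRestrict V).ker.subtype).codRestrict T fun y =>
      hT _ y.1.2 (LinearMap.mem_ker.1 y.2)
  refine LinearMap.finrank_le_finrank_of_injective (f := f) ?_
  rw [← LinearMap.ker_eq_bot, LinearMap.ker_eq_bot']
  intro y hy
  have h1 : g y.1.1 = 0 := congrArg Subtype.val hy
  exact Subtype.ext (Subtype.ext (hg _ y.1.2 (LinearMap.mem_ker.1 y.2) h1))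

lemma coordE_mem (i : Fin 4) : coordE k i ∈ spaceE k := by
  rw [← span_coordE]; exact Submodule.subset_span ⟨i, rfl⟩

variable [NeZero (2 : k)]

/-- The action of `Q` in degree `n` has image `W_{n+1}`. -/
lemma map_twistMap_shapeQ (ρ θ : kˣ) (n : ℕ) :
    (tuples 4 (pieceW ρ θ n)).map (twistMap (phi ρ θ) (shapeQ (coordE k))) =
      tuples 1 (pieceW ρ θ (n + 1)) := by
  apply le_antisymm
  · rintro _ ⟨y, hy, rfl⟩
    refine mem_tuples.2 fun i => ?_
    rw [twistMap_apply]
    refine Submodule.sum_mem _ fun j _ => Submodule.mul_mem_mul ?_ ⟨_, mem_tuples.1 hy j, rfl⟩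
    exact shapeQ_forall (· ∈ spaceE k) coordE_mem i j
  · let S := ((tuples 4 (pieceW ρ θ n)).map (twistMap (phi ρ θ) (shapeQ (coordE k)))).map
      (LinearMap.proj (R := k) (φ := fun _ : Fin 1 => FunctionField k) 0)
    have hS : pieceW ρ θ (n + 1) ≤ S := by
      rw [pieceW, twistedPower_succ, Submodule.mul_le]
      rintro e he _ ⟨w, hw, rfl⟩
      rw [← span_coordE] at he
      induction he using Submodule.span_induction with
      | mem x hx =>
        obtain ⟨i, rfl⟩ := hx
        refine ⟨_, ⟨Pi.single i w, mem_tuples.2 fun j => ?_, rfl⟩, ?_⟩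
        · by_cases h : j = i
          · subst h; rwa [Pi.single_eq_same]
          · rw [Pi.single_eq_of_ne h]; exact zero_mem _
        · rw [LinearMap.proj_apply, twistMap_apply, Finset.sum_eq_single i]
          · rw [Pi.single_eq_same]
            fin_cases i <;> rfl
          · intro j _ h
            rw [Pi.single_eq_of_ne h, map_zero, mul_zero]
          · exact fun h => (h (Finset.mem_univ i)).elim
      | zero => rw [zero_mul]; exact zero_mem _
      | add x y _ _ hx hy => rw [add_mul]; exact add_mem hx hy
      | smul c x _ hx => rw [smul_mul_assoc]; exact Submodule.smul_mem _ _ hx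
    intro x hx
    obtain ⟨z, hz, h⟩ := hS (mem_tuples.1 hx 0)
    have : z = x := by
      ext i
      rw [Subsingleton.elim i 0]
      exact h
    exact this ▸ hz

lemma rankCol_shapeQ (ρ θ : kˣ) (n : ℕ) :
    rankCol ρ θ n (shapeQ (coordE k)) = Module.finrank k (pieceW ρ θ (n + 1)) := by
  rw [rankCol, map_twistMap_shapeQ, finrank_tuples, one_mul]

end RankBounds

section RanksAtOne

/-- The exponents of the monomials in `W_{n-1}`, where `W_{-1} = 0`. -/
def predExponents : ℕ → Set (ℕ × ℕ)
  | 0 => ∅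
  | n + 1 => exponents n

lemma exists_finset_predExponents (n : ℕ) :
    ∃ s : Finset (ℕ × ℕ), (s : Set (ℕ × ℕ)) = predExponents n ∧ s.card = (n + 2).choose 3 := by
  obtain _ | n := n
  · exact ⟨∅, Finset.coe_empty, rfl⟩
  · exact exists_finset_exponents n

lemma shiftExp_mem_predExponents {n i j : ℕ} (hi : i ≤ 1) (hj : j ≤ 1) {x : ℕ × ℕ}
    (hx : x ∈ predExponents n) : shiftExp i j x ∈ exponents n := by
  obtain _ | n := n
  · exact hx.elim
  · exact shiftExp_mem hi hj hx

lemma shift_inter_subset_pred (n : ℕ) :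
    shiftExp 0 0 '' exponents n ∩ shiftExp 1 0 '' exponents n ⊆
      shiftExp 0 0 '' (shiftExp 1 0 '' predExponents n) := by
  obtain _ | n := n
  · rw [shift_inter_subset_zero]; exact Set.empty_subset _
  · exact shift_inter_subset n

lemma shift_inter_subset_pred' (n : ℕ) :
    shiftExp 0 0 '' exponents n ∩ shiftExp 0 1 '' exponents n ⊆
      shiftExp 0 0 '' (shiftExp 0 1 '' predExponents n ∪ shiftExp 1 1 '' predExponents n) := by
  obtain _ | n := n
  · rw [shift_inter_subset_zero']; exact Set.empty_subset _
  · exact shift_inter_subset' n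

/-- The exponents of `t u t W_{n-1}`. -/
lemma exists_finset_shift (n : ℕ) :
    ∃ s : Finset (ℕ × ℕ), (s : Set (ℕ × ℕ)) = shiftExp 0 0 '' (shiftExp 1 0 '' predExponents n) ∧
      s.card = (n + 2).choose 3 := by
  classical
  obtain ⟨s, hs, hc⟩ := exists_finset_predExponents n
  refine ⟨(s.image (shiftExp 1 0)).image (shiftExp 0 0), ?_, ?_⟩
  · rw [Finset.coe_image, Finset.coe_image, hs]
  · rw [Finset.card_image_of_injective _ (shiftExp_injective 0 0),
      Finset.card_image_of_injective _ (shiftExp_injective 1 0), hc]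

/-- The exponents of `t (v t W_{n-1} + u v t W_{n-1})`; the two summands share the monomials of
`v t u t W_{n-2} = u v t v t W_{n-2}`. -/
lemma exists_finset_shift' (n : ℕ) :
    ∃ s : Finset (ℕ × ℕ), (s : Set (ℕ × ℕ)) =
        shiftExp 0 0 '' (shiftExp 0 1 '' predExponents n ∪ shiftExp 1 1 '' predExponents n) ∧
      s.card + (n + 1).choose 3 ≤ 2 * (n + 2).choose 3 := by
  classical
  obtain ⟨s, hs, hc⟩ := exists_finset_predExponents n
  refine ⟨(s.image (shiftExp 0 1) ∪ s.image (shiftExp 1 1)).image (shiftExp 0 0), ?_, ?_⟩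
  · rw [Finset.coe_image, Finset.coe_union, Finset.coe_image, Finset.coe_image, hs]
  rw [Finset.card_image_of_injective _ (shiftExp_injective 0 0)]
  have h := Finset.card_union_add_card_inter (s.image (shiftExp 0 1)) (s.image (shiftExp 1 1))
  rw [Finset.card_image_of_injective _ (shiftExp_injective 0 1),
    Finset.card_image_of_injective _ (shiftExp_injective 1 1), hc] at h
  have h2 : (n + 1).choose 3 ≤
      (s.image (shiftExp 0 1) ∩ s.image (shiftExp 1 1)).card := by
    obtain _ | n := n
    · exact Nat.zero_le _
    · obtain ⟨s', hs', hc'⟩ := exists_finset_predExponents n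
      rw [← hc', ← Finset.card_image_of_injective s'
        ((shiftExp_injective 0 1).comp (shiftExp_injective 1 0))]
      refine Finset.card_le_card fun x hx => ?_
      obtain ⟨y, hy, rfl⟩ := Finset.mem_image.1 hx
      have hy' : y ∈ predExponents n := by rw [← hs']; exact hy
      have hmem : ∀ {z}, z ∈ exponents n → z ∈ s := fun {z} hz => by
        rw [← Finset.mem_coe, hs]; exact hz
      refine Finset.mem_inter.2 ⟨Finset.mem_image.2 ⟨_, hmem
        (shiftExp_mem_predExponents le_rfl (Nat.zero_le _) hy'), rfl⟩,
        Finset.mem_image.2 ⟨_, hmem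
        (shiftExp_mem_predExponents (Nat.zero_le _) le_rfl hy'), ?_⟩⟩
      exact Prod.ext (by simp [shiftExp]) (by simp only [shiftExp, Function.comp_apply]; omega)
  omega

variable {k : Type u} [Field k]

lemma finrank_submodule_prod {X Y : Type*} [AddCommGroup X] [Module k X] [AddCommGroup Y]
    [Module k Y] (S : Submodule k X) (T : Submodule k Y) [FiniteDimensional k S]
    [FiniteDimensional k T] :
    FiniteDimensional k (S.prod T) ∧
      Module.finrank k (S.prod T) = Module.finrank k S + Module.finrank k T := by
  let e : (S.prod T) ≃ₗ[k] S × T :=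
    { toFun := fun y => (⟨y.1.1, y.2.1⟩, ⟨y.1.2, y.2.2⟩)
      invFun := fun y => ⟨(y.1, y.2), y.1.2, y.2.2⟩
      map_add' := fun _ _ => rfl
      map_smul' := fun _ _ => rfl
      left_inv := fun _ => rfl
      right_inv := fun _ => rfl }
  exact ⟨FiniteDimensional.of_injective e.toLinearMap e.injective, by
    rw [e.finrank_eq, Module.finrank_prod]⟩

/-- If `y` and `φ^n(u) y = u v ^ n y` are both in `W_n`, then `y` is in `W_{n-1}`. -/
lemma monoSpan_mem_pred {n : ℕ} {y : FunctionField k} (hy : y ∈ monoSpan k (exponents n))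
    (hy' : coordU k * coordV k ^ n * y ∈ monoSpan k (exponents n)) :
    y ∈ monoSpan k (predExponents n) := by
  let f : ℕ × ℕ → ℕ × ℕ := fun x => (x.1 + 1, x.2 + n)
  have hf : Function.Injective f := fun x z h => by
    simp only [f, Prod.mk.injEq, add_left_inj] at h
    exact Prod.ext h.1 h.2
  have hmul : ∀ S, (monoSpan k S).map (LinearMap.mulLeft k (coordU k * coordV k ^ n)) =
      monoSpan k (f '' S) := by
    intro S
    rw [monoSpan_eq, monoSpan_eq, Submodule.map_span, ← Set.image_comp, ← Set.image_comp]
    congr 1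
    refine Set.image_congr fun x _ => ?_
    simp only [Function.comp_apply, LinearMap.mulLeft_apply, uvMonomial, f]
    ring
  have h1 : coordU k * coordV k ^ n * y ∈ monoSpan k (f '' exponents n) := by
    rw [← hmul]; exact ⟨y, hy, rfl⟩
  have h2 := mem_monoSpan_inter h1 hy'
  have h3 : f '' exponents n ∩ exponents n ⊆ f '' predExponents n := by
    rintro _ ⟨⟨⟨a, b⟩, hx, rfl⟩, hx'⟩
    obtain _ | n := n
    · exact absurd hx'.1 (Nat.not_succ_le_zero a)
    · exact ⟨_, mem_exponents_of_succ hx hx', rfl⟩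
  have h4 := monoSpan_mono h3 h2
  rw [← hmul] at h4
  obtain ⟨z, hz, h⟩ := h4
  rw [LinearMap.mulLeft_apply] at h
  rwa [← mul_left_cancel₀ (mul_ne_zero coordU_ne_zero (pow_ne_zero _ coordV_ne_zero)) h]

variable [NeZero (2 : k)]

/-- At `(1, 1)` the third entry of `M` is `4 u t`, so `M` is injective. -/
lemma rankCol_one_shapeM (n : ℕ) :
    (n + 3).choose 3 ≤ rankCol 1 1 n (shapeM (coeffZ (1 : kˣ) 1)) := by
  have h2 := two_ne_zero_functionField (k := k)
  have h := finrank_le_finrank_map_add (k := k) (tuples 1 (pieceW (1 : kˣ) 1 n))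
    (twistMap (phi (1 : kˣ) 1) (shapeM (coeffZ (1 : kˣ) 1))) (0 : _ →ₗ[k] Fin 1 → k) ⊥
    (fun y _ _ => rfl) (by
      intro y _ hy _
      have h0 := congrFun hy 2
      simp [twistMap_apply, shapeM, coeffZ, cplus_one, cminus_one, coordU_ne_zero, h2] at h0
      ext i
      rw [Subsingleton.elim i 0]
      exact h0)
  rwa [finrank_tuples, finrank_pieceW_one, finrank_bot, one_mul, add_zero] at h

/-- At `(1, 1)` a column `y` in the kernel of `N` has `y₁ = y₂ = 0` and `φ(y₃) = -u φ(y₄)`.  It is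
determined by `φ(y₃)`, whose monomials are among those of `t W_n` and `u t W_n`. -/
lemma rankCol_one_shapeN (n : ℕ) :
    4 * (n + 3).choose 3 ≤
      rankCol 1 1 n (shapeN (coeffZ (1 : kˣ) 1)) + (n + 2).choose 3 := by
  have h2 := two_ne_zero_functionField (k := k)
  have hu := coordU_ne_zero (k := k)
  obtain ⟨s, hs, hc⟩ := exists_finset_shift n
  have key : ∀ y : Fin 4 → FunctionField k,
      twistMap (phi (1 : kˣ) 1) (shapeN (coeffZ (1 : kˣ) 1)) y = 0 →
      y 0 = 0 ∧ y 1 = 0 ∧ phi (1 : kˣ) 1 (y 2) = coordU k * phi (1 : kˣ) 1 (-y 3) := by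
    intro y hy
    have h0 := congrFun hy 0
    have h1 := congrFun hy 2
    have h5 := congrFun hy 5
    simp [twistMap_apply, shapeN, coeffZ, cplus_one, cminus_one, hu, h2,
      Fin.sum_univ_succ] at h0 h1 h5
    refine ⟨h0, h1, mul_left_cancel₀ h2 ?_⟩
    rw [map_neg]
    linear_combination h5
  have h := finrank_le_finrank_map_add (k := k) (tuples 4 (pieceW (1 : kˣ) 1 n))
    (twistMap (phi (1 : kˣ) 1) (shapeN (coeffZ (1 : kˣ) 1)))
    ((phi (1 : kˣ) 1).toLinearMap ∘ₗ LinearMap.proj 2) (monoSpan k s) (by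
      intro y hy h0
      have hm := mem_tuples.1 hy
      rw [pieceW_one] at hm
      obtain ⟨-, -, h⟩ := key y h0
      have e0 := shift_mem (i := 0) (j := 0) (hm 2)
      have e1 := shift_mem (i := 1) (j := 0) (Submodule.neg_mem _ (hm 3))
      simp only [pow_zero, pow_one, mul_one, one_mul] at e0 e1
      rw [← h] at e1
      rw [hs]
      exact monoSpan_mono (shift_inter_subset_pred n) (mem_monoSpan_inter e0 e1)) (by
      intro y hy h0 hg
      obtain ⟨h1, h2, h⟩ := key y h0
      have hg' : phi (1 : kˣ) 1 (y 2) = 0 := hg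
      rw [hg', eq_comm, mul_eq_zero, or_iff_right hu, map_eq_zero, neg_eq_zero] at h
      rw [map_eq_zero] at hg'
      ext i
      fin_cases i
      exacts [h1, h2, hg', h])
  rwa [finrank_tuples, finrank_pieceW_one, finrank_monoSpan, hc] at h

/-- At `(1, 1)` a column `y` in the kernel of `P` has `φ(y₁) = -u φ(y₂)`, `φ(y₃) = -u φ(y₄)` and
`φ(y₅) = -v φ(y₆)`.  It is determined by `φ(y₁)`, `φ(y₃)` and `φ(y₅)`, whose monomials lie in
intersections of two translates of the exponents of `W_n`. -/
lemma rankCol_one_shapeP (n : ℕ) :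
    6 * (n + 3).choose 3 + (n + 1).choose 3 ≤
      rankCol 1 1 n (shapeP (coeffZ (1 : kˣ) 1)) + 4 * (n + 2).choose 3 := by
  have h2 := two_ne_zero_functionField (k := k)
  have hu := coordU_ne_zero (k := k)
  have hv := coordV_ne_zero (k := k)
  obtain ⟨s, hs, hc⟩ := exists_finset_shift n
  obtain ⟨s', hs', hc'⟩ := exists_finset_shift' n
  have key : ∀ y : Fin 6 → FunctionField k,
      twistMap (phi (1 : kˣ) 1) (shapeP (coeffZ (1 : kˣ) 1)) y = 0 →
      phi (1 : kˣ) 1 (y 0) = coordU k * phi (1 : kˣ) 1 (-y 1) ∧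
      phi (1 : kˣ) 1 (y 2) = coordU k * phi (1 : kˣ) 1 (-y 3) ∧
      phi (1 : kˣ) 1 (y 4) = coordV k * phi (1 : kˣ) 1 (-y 5) := by
    intro y hy
    have h1 := congrFun hy 1
    have h3 := congrFun hy 2
    have h4 := congrFun hy 3
    simp [twistMap_apply, shapeP, coeffZ, cplus_one, cminus_one,
      Fin.sum_univ_succ] at h1 h3 h4
    have e2 : phi (1 : kˣ) 1 (y 2) = coordU k * phi (1 : kˣ) 1 (-y 3) := by
      refine mul_left_cancel₀ h2 (mul_left_cancel₀ hv ?_)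
      rw [map_neg]
      linear_combination -h1
    refine ⟨mul_left_cancel₀ h2 ?_, e2, mul_left_cancel₀ h2 ?_⟩
    · rw [map_neg]
      linear_combination h3
    · rw [map_neg] at e2 ⊢
      linear_combination h4 - 2 * e2
  obtain ⟨hf1, hr1⟩ := finrank_submodule_prod (monoSpan k (s : Set (ℕ × ℕ)))
    (monoSpan k (s' : Set (ℕ × ℕ)))
  obtain ⟨hf2, hr2⟩ := finrank_submodule_prod (monoSpan k (s : Set (ℕ × ℕ)))
    ((monoSpan k (s : Set (ℕ × ℕ))).prod (monoSpan k (s' : Set (ℕ × ℕ))))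
  let π : ∀ i : Fin 6, (Fin 6 → FunctionField k) →ₗ[k] FunctionField k :=
    fun i => (phi (1 : kˣ) 1).toLinearMap ∘ₗ LinearMap.proj i
  have h := finrank_le_finrank_map_add (k := k) (tuples 6 (pieceW (1 : kˣ) 1 n))
    (twistMap (phi (1 : kˣ) 1) (shapeP (coeffZ (1 : kˣ) 1)))
    ((π 0).prod ((π 2).prod (π 4))) ((monoSpan k s).prod ((monoSpan k s).prod (monoSpan k s'))) (by
      intro y hy h0
      have hm := mem_tuples.1 hy
      rw [pieceW_one] at hm
      obtain ⟨h1, h3, h5⟩ := key y h0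
      have e0 := fun i => shift_mem (i := 0) (j := 0) (hm i)
      have e1 := fun i => shift_mem (i := 1) (j := 0) (Submodule.neg_mem _ (hm i))
      have e2 := shift_mem (i := 0) (j := 1) (Submodule.neg_mem _ (hm 5))
      simp only [pow_zero, pow_one, mul_one, one_mul] at e0 e1 e2
      have m1 := e1 1
      have m3 := e1 3
      rw [← h1] at m1
      rw [← h3] at m3
      rw [← h5] at e2
      rw [hs, hs']
      exact ⟨monoSpan_mono (shift_inter_subset_pred n) (mem_monoSpan_inter (e0 0) m1),
        monoSpan_mono (shift_inter_subset_pred n) (mem_monoSpan_inter (e0 2) m3),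
        monoSpan_mono (shift_inter_subset_pred' n) (mem_monoSpan_inter (e0 4) e2)⟩) (by
      intro y hy h0 hg
      obtain ⟨h1, h3, h5⟩ := key y h0
      have g0 : phi (1 : kˣ) 1 (y 0) = 0 := congrArg Prod.fst hg
      have g2 : phi (1 : kˣ) 1 (y 2) = 0 := congrArg (fun z => z.2.1) hg
      have g4 : phi (1 : kˣ) 1 (y 4) = 0 := congrArg (fun z => z.2.2) hg
      rw [g0, eq_comm, mul_eq_zero, or_iff_right hu, map_eq_zero, neg_eq_zero] at h1
      rw [g2, eq_comm, mul_eq_zero, or_iff_right hu, map_eq_zero, neg_eq_zero] at h3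
      rw [g4, eq_comm, mul_eq_zero, or_iff_right hv, map_eq_zero, neg_eq_zero] at h5
      rw [map_eq_zero] at g0 g2 g4
      ext i
      fin_cases i
      exacts [g0, h1, g2, h3, g4, h5])
  rw [finrank_tuples, finrank_pieceW_one, hr2, hr1, finrank_monoSpan, finrank_monoSpan, hc] at h
  rw [rankCol]
  omega

/-- At `(1, 1)` a row `y` in degree `n` that is annihilated by `P` is determined by its first entry:
it is `y₁ (1, u v ^ (n-1), v, u v ^ n)`. -/
lemma rankRow_one_shapeP (n : ℕ) :
    4 * (n + 3).choose 3 ≤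
      rankRow 1 1 n (shapeP (coeffZ (1 : kˣ) 1)) + (n + 2).choose 3 := by
  have h2 := two_ne_zero_functionField (k := k)
  have hu := coordU_ne_zero (k := k)
  have hv := coordV_ne_zero (k := k)
  obtain ⟨s, hs, hc⟩ := exists_finset_predExponents n
  have key : ∀ y : Fin 4 → FunctionField k,
      rowMap (phi (1 : kˣ) 1) n (shapeP (coeffZ (1 : kˣ) 1)) y = 0 →
      y 2 = coordV k * y 0 ∧ y 3 = coordV k * y 1 ∧ y 3 = coordU k * coordV k ^ n * y 0 := by
    intro y hy
    have h0 := congrFun hy 0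
    have h3 := congrFun hy 2
    have h4 := congrFun hy 4
    have hm2 : (phi (1 : kˣ) 1 ^ n) 2 = 2 := map_ofNat _ 2
    simp [rowMap_apply, shapeP, coeffZ, hm2, cplus_one, cminus_one, Fin.sum_univ_succ,
      -AlgEquiv.coe_pow, phi_one_pow_coordU, phi_one_pow_coordV] at h0 h3 h4
    refine ⟨mul_left_cancel₀ h2 ?_, mul_left_cancel₀ h2 ?_, mul_left_cancel₀ h2 ?_⟩
    · linear_combination h0
    · linear_combination h3
    · linear_combination h4
  have h := finrank_le_finrank_map_add (k := k) (tuples 4 (pieceW (1 : kˣ) 1 n))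
    (rowMap (phi (1 : kˣ) 1) n (shapeP (coeffZ (1 : kˣ) 1)))
    (LinearMap.proj 0) (monoSpan k s) (by
      intro y hy h0
      have hm := mem_tuples.1 hy
      rw [pieceW_one] at hm
      obtain ⟨-, -, h⟩ := key y h0
      rw [hs]
      refine monoSpan_mem_pred (hm 0) ?_
      rw [LinearMap.proj_apply, ← h]
      exact hm 3) (by
      intro y hy h0 hg
      obtain ⟨h1, h3, h5⟩ := key y h0
      have g0 : y 0 = 0 := hg
      rw [g0, mul_zero] at h1 h5
      rw [h5, eq_comm, mul_eq_zero, or_iff_right hv] at h3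
      ext i
      fin_cases i
      exacts [g0, h3, h1, h5])
  rwa [finrank_tuples, finrank_pieceW_one, finrank_monoSpan, hc] at h

end RanksAtOne

/-! ### Exactness at general parameters -/

section DimensionCounts

variable {k : Type u} [Field k] {X Y Z : Type*} [AddCommGroup X] [Module k X] [AddCommGroup Y]
    [Module k Y]

lemma finrank_map_add_finrank_inf_ker (V : Submodule k X) [FiniteDimensional k V]
    (L : X →ₗ[k] Y) :
    Module.finrank k (V.map L) + Module.finrank k (V ⊓ L.ker : Submodule k X) =
      Module.finrank k V := by
  have h := (L.domRestrict V).finrank_range_add_finrank_ker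
  rw [LinearMap.range_domRestrict, LinearMap.ker_domRestrict] at h
  have h2 := (Submodule.equivMapOfInjective V.subtype V.injective_subtype
    (L.ker.comap V.subtype)).finrank_eq
  rw [Submodule.map_comap_subtype] at h2
  rw [← h, h2]

lemma finrank_map_add_le (V : Submodule k X) [FiniteDimensional k V] (L : X →ₗ[k] Y)
    {U : Submodule k X} (hUV : U ≤ V) (hU : ∀ y ∈ U, L y = 0) :
    Module.finrank k (V.map L) + Module.finrank k U ≤ Module.finrank k V := by
  rw [← finrank_map_add_finrank_inf_ker V L]
  have : FiniteDimensional k (V ⊓ L.ker : Submodule k X) :=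
    Submodule.finiteDimensional_inf_left V _
  exact Nat.add_le_add_left (Submodule.finrank_mono (le_inf hUV hU)) _

/-- A complex is exact as soon as its ranks are large enough. -/
lemma mem_of_finrank_le (V : Submodule k X) [FiniteDimensional k V] (L : X →ₗ[k] Y)
    {U : Submodule k X} (hUV : U ≤ V) (hU : ∀ y ∈ U, L y = 0)
    (h : Module.finrank k V ≤ Module.finrank k (V.map L) + Module.finrank k U) {y : X}
    (hy : y ∈ V) (h0 : L y = 0) : y ∈ U := by
  rw [← finrank_map_add_finrank_inf_ker V L] at h
  have : FiniteDimensional k (V ⊓ L.ker : Submodule k X) :=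
    Submodule.finiteDimensional_inf_left V _
  have := Submodule.eq_of_le_of_finrank_le (le_inf hUV hU) (Nat.le_of_add_le_add_left h)
  rw [this]
  exact ⟨hy, h0⟩

end DimensionCounts

section Exactness

variable {k : Type u} [Field k] [NeZero (2 : k)] {ρ θ : kˣ}

lemma twistMap_mem {a b : ℕ} {c : Matrix (Fin b) (Fin a) (FunctionField k)}
    (hc : ∀ i j, c i j ∈ spaceE k) (n : ℕ) :
    (tuples a (pieceW ρ θ n)).map (twistMap (phi ρ θ) c) ≤ tuples b (pieceW ρ θ (n + 1)) := by
  rintro _ ⟨y, hy, rfl⟩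
  refine mem_tuples.2 fun i => ?_
  rw [twistMap_apply]
  exact Submodule.sum_mem _ fun j _ => Submodule.mul_mem_mul (hc i j) ⟨_, mem_tuples.1 hy j, rfl⟩

lemma rowMap_mem {a b : ℕ} {c : Matrix (Fin a) (Fin b) (FunctionField k)}
    (hc : ∀ i j, c i j ∈ spaceE k) (n : ℕ) :
    (tuples a (pieceW ρ θ n)).map (rowMap (phi ρ θ) n c) ≤ tuples b (pieceW ρ θ (n + 1)) := by
  rintro _ ⟨y, hy, rfl⟩
  refine mem_tuples.2 fun i => ?_
  rw [rowMap_apply, pieceW, twistedPower_succ']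
  exact Submodule.sum_mem _ fun j _ => Submodule.mul_mem_mul (mem_tuples.1 hy j) ⟨_, hc j i, rfl⟩

lemma twistMap_twistMap {a b c : ℕ} {A : Matrix (Fin b) (Fin a) (FunctionField k)}
    {B : Matrix (Fin c) (Fin b) (FunctionField k)} (h : B * A.map (phi ρ θ) = 0)
    (y : Fin a → FunctionField k) : twistMap (phi ρ θ) B (twistMap (phi ρ θ) A y) = 0 := by
  have e : ∀ {m n : ℕ} (C : Matrix (Fin m) (Fin n) (FunctionField k)) (z : Fin n → FunctionField k),
      twistMap (phi ρ θ) C z = C.mulVec (fun j => phi ρ θ (z j)) := fun C z => rfl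
  have e2 : (fun j => phi ρ θ (A.mulVec (fun j => phi ρ θ (y j)) j)) =
      (A.map (phi ρ θ)).mulVec (fun j => phi ρ θ (phi ρ θ (y j))) := by
    ext j
    simp [Matrix.mulVec, dotProduct]
  rw [e, e, e2, Matrix.mulVec_mulVec, h, Matrix.zero_mulVec]

lemma rowMap_rowMap {a b c : ℕ} {A : Matrix (Fin b) (Fin a) (FunctionField k)}
    {B : Matrix (Fin c) (Fin b) (FunctionField k)} (h : B * A.map (phi ρ θ) = 0) (n : ℕ)
    (y : Fin c → FunctionField k) :
    rowMap (phi ρ θ) (n + 1) A (rowMap (phi ρ θ) n B y) = 0 := by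
  ext j
  have h1 : ∀ i, ∑ l, (phi ρ θ ^ n) (B i l) * (phi ρ θ ^ (n + 1)) (A l j) = 0 := by
    intro i
    have := congrArg (phi ρ θ ^ n) (congrFun (congrFun h i) j)
    rw [Matrix.mul_apply, map_sum, Matrix.zero_apply, map_zero] at this
    rw [← this]
    refine Finset.sum_congr rfl fun l _ => ?_
    rw [map_mul, pow_succ]
    rfl
  simp only [rowMap_apply, Finset.sum_mul, mul_assoc]
  rw [Finset.sum_comm]
  simp only [← Finset.mul_sum, h1, mul_zero, Finset.sum_const_zero, Pi.zero_apply]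

lemma coeffZ_mem (i : Fin 10) : coeffZ ρ θ i ∈ spaceE k := by
  rw [← shapeZ_coordE]
  exact shapeZ_mem ρ θ _ coordE_mem i

omit [NeZero (2 : k)] in
lemma shapeQ_mem (i j) : shapeQ (coordE k) i j ∈ spaceE k :=
  shapeQ_forall (· ∈ spaceE k) coordE_mem i j

lemma shapeP_mem (i j) : shapeP (coeffZ ρ θ) i j ∈ spaceE k :=
  shapeP_forall (· ∈ spaceE k) (zero_mem _) coeffZ_mem i j

lemma shapeN_mem (i j) : shapeN (coeffZ ρ θ) i j ∈ spaceE k :=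
  shapeN_forall (· ∈ spaceE k) (zero_mem _) coeffZ_mem i j

lemma shapeM_mem (i j) : shapeM (coeffZ ρ θ) i j ∈ spaceE k :=
  shapeM_forall (· ∈ spaceE k) (zero_mem _) coeffZ_mem i j

/-- The coefficient of `s ^ (n+2)` in `(1 - s) ^ 4 (1 - s)⁻⁴ = 1`. -/
lemma choose_three (n : ℕ) : (n + 5).choose 3 + 6 * (n + 3).choose 3 + (n + 1).choose 3 =
    4 * (n + 4).choose 3 + 4 * (n + 2).choose 3 := by
  have h3 : ∀ m : ℕ, (m + 1).choose 3 = m.choose 2 + m.choose 3 := fun m =>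
    Nat.choose_succ_succ' m 2
  have h2 : ∀ m : ℕ, (m + 1).choose 2 = m + m.choose 2 := fun m => by
    rw [Nat.choose_succ_succ' m 1, Nat.choose_one_right]
  have := h3 (n + 1); have := h3 (n + 2); have := h3 (n + 3); have := h3 (n + 4)
  have := h2 (n + 1); have := h2 (n + 2); have := h2 (n + 3)
  simp only [add_assoc, Nat.reduceAdd] at *
  omega

/-- The image of `P` fills the kernel of `Q`, which bounds `dim W_{n+1}` from above; the
comparison with the parameters `(1, 1)` bounds it from below. -/
lemma finrank_pieceW (hr : ∀ n, RanksAtLeast n ρ θ) (n : ℕ) :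
    Module.finrank k (pieceW ρ θ n) = (n + 3).choose 3 := by
  have hlow : ∀ n, (n + 4).choose 3 ≤ Module.finrank k (pieceW ρ θ (n + 1)) := by
    intro n
    have := (hr n).1
    rw [rankCol_shapeQ, rankCol_shapeQ, finrank_pieceW_one] at this
    exact this
  induction n with
  | zero =>
    rw [pieceW, twistedPower_zero, Submodule.one_eq_span, finrank_span_singleton one_ne_zero]
    rfl
  | succ n ih =>
    refine le_antisymm ?_ (hlow n)
    obtain _ | n := n
    · have h := finrank_map_add_le (tuples 4 (pieceW ρ θ 0))
        (twistMap (phi ρ θ) (shapeQ (coordE k))) bot_le (fun y hy => by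
          rw [(Submodule.mem_bot k).1 hy, map_zero])
      rw [← rankCol, rankCol_shapeQ, finrank_tuples, ih, finrank_bot] at h
      exact h
    · have h := finrank_map_add_le (tuples 4 (pieceW ρ θ (n + 1)))
        (twistMap (phi ρ θ) (shapeQ (coordE k)))
        (twistMap_mem (ρ := ρ) (θ := θ) (shapeP_mem (ρ := ρ) (θ := θ)) n) (by
          rintro _ ⟨y, _, rfl⟩
          exact twistMap_twistMap coeffQ_mul_coeffP y)
      rw [← rankCol, ← rankCol, rankCol_shapeQ, finrank_tuples, ih] at h
      have h1 := (hr n).2.1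
      have h2 := rankCol_one_shapeP (k := k) n
      have h3 := choose_three n
      simp only [add_assoc, Nat.reduceAdd] at *
      omega

lemma exact_PQ (hr : ∀ n, RanksAtLeast n ρ θ) :
    Function.Exact (matrixMap (matrixP ρ θ)) (matrixMap (matrixQ ρ θ)) := by
  refine exact_of_graded matrixP_mem matrixQ_mem matrixQ_mul_matrixP ?_ ?_
  · intro y hy h0
    rw [coeffMatrix_matrixQ] at h0
    refine (Submodule.mem_bot k).1 (mem_of_finrank_le (tuples 4 (pieceW ρ θ 0)) _ bot_le
      (fun y hy => by rw [(Submodule.mem_bot k).1 hy, map_zero]) ?_ (mem_tuples.2 hy) h0)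
    rw [← rankCol, rankCol_shapeQ, finrank_tuples, finrank_pieceW hr, finrank_pieceW hr]
    exact Nat.le_add_right _ _
  · intro n y hy h0
    rw [coeffMatrix_matrixQ] at h0
    rw [coeffMatrix_matrixP]
    obtain ⟨z, hz, h⟩ := mem_of_finrank_le (tuples 4 (pieceW ρ θ (n + 1))) _
      (twistMap_mem (ρ := ρ) (θ := θ) (shapeP_mem (ρ := ρ) (θ := θ)) n) (by
          rintro _ ⟨y, _, rfl⟩
          exact twistMap_twistMap coeffQ_mul_coeffP y) (by
        rw [← rankCol, ← rankCol, rankCol_shapeQ, finrank_tuples, finrank_pieceW hr,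
          finrank_pieceW hr]
        have h1 := (hr n).2.1
        have h2 := rankCol_one_shapeP (k := k) n
        have h3 := choose_three n
        simp only [add_assoc, Nat.reduceAdd] at *
        omega) (mem_tuples.2 hy) h0
    exact ⟨z, mem_tuples.1 hz, h⟩

lemma exact_NP (hr : ∀ n, RanksAtLeast n ρ θ) :
    Function.Exact (matrixMap (matrixN ρ θ)) (matrixMap (matrixP ρ θ)) := by
  refine exact_of_graded matrixN_mem matrixP_mem matrixP_mul_matrixN ?_ ?_
  · intro y hy h0
    rw [coeffMatrix_matrixP] at h0
    refine (Submodule.mem_bot k).1 (mem_of_finrank_le (tuples 6 (pieceW ρ θ 0)) _ bot_le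
      (fun y hy => by rw [(Submodule.mem_bot k).1 hy, map_zero]) ?_ (mem_tuples.2 hy) h0)
    rw [← rankCol, finrank_tuples, finrank_pieceW hr]
    have h1 := (hr 0).2.1
    have h2 := rankCol_one_shapeP (k := k) 0
    simp only [zero_add, Nat.choose_self,
      Nat.choose_eq_zero_of_lt (by norm_num : 2 < 3)] at *
    omega
  · intro n y hy h0
    rw [coeffMatrix_matrixP] at h0
    rw [coeffMatrix_matrixN]
    obtain ⟨z, hz, h⟩ := mem_of_finrank_le (tuples 6 (pieceW ρ θ (n + 1))) _
      (twistMap_mem (ρ := ρ) (θ := θ) (shapeN_mem (ρ := ρ) (θ := θ)) n) (by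
          rintro _ ⟨y, _, rfl⟩
          exact twistMap_twistMap coeffP_mul_coeffN y) (by
        rw [← rankCol, ← rankCol, finrank_tuples, finrank_pieceW hr]
        have h1 := (hr (n + 1)).2.1
        have h2 := rankCol_one_shapeP (k := k) (n + 1)
        have h3 := (hr n).2.2.1
        have h4 := rankCol_one_shapeN (k := k) n
        simp only [add_assoc, Nat.reduceAdd] at *
        omega) (mem_tuples.2 hy) h0
    exact ⟨z, mem_tuples.1 hz, h⟩

lemma exact_MN (hr : ∀ n, RanksAtLeast n ρ θ) :
    Function.Exact (matrixMap (matrixM ρ θ)) (matrixMap (matrixN ρ θ)) := by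
  refine exact_of_graded matrixM_mem matrixN_mem matrixN_mul_matrixM ?_ ?_
  · intro y hy h0
    rw [coeffMatrix_matrixN] at h0
    refine (Submodule.mem_bot k).1 (mem_of_finrank_le (tuples 4 (pieceW ρ θ 0)) _ bot_le
      (fun y hy => by rw [(Submodule.mem_bot k).1 hy, map_zero]) ?_ (mem_tuples.2 hy) h0)
    rw [← rankCol, finrank_tuples, finrank_pieceW hr]
    have h1 := (hr 0).2.2.1
    have h2 := rankCol_one_shapeN (k := k) 0
    simp only [zero_add, Nat.choose_self,
      Nat.choose_eq_zero_of_lt (by norm_num : 2 < 3)] at *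
    omega
  · intro n y hy h0
    rw [coeffMatrix_matrixN] at h0
    rw [coeffMatrix_matrixM]
    obtain ⟨z, hz, h⟩ := mem_of_finrank_le (tuples 4 (pieceW ρ θ (n + 1))) _
      (twistMap_mem (ρ := ρ) (θ := θ) (shapeM_mem (ρ := ρ) (θ := θ)) n) (by
          rintro _ ⟨y, _, rfl⟩
          exact twistMap_twistMap coeffN_mul_coeffM y) (by
        rw [← rankCol, ← rankCol, finrank_tuples, finrank_pieceW hr]
        have h1 := (hr (n + 1)).2.2.1
        have h2 := rankCol_one_shapeN (k := k) (n + 1)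
        have h3 := (hr n).2.2.2.1
        have h4 := rankCol_one_shapeM (k := k) n
        simp only [add_assoc, Nat.reduceAdd] at *
        omega) (mem_tuples.2 hy) h0
    exact ⟨z, mem_tuples.1 hz, h⟩

lemma injective_M (hr : ∀ n, RanksAtLeast n ρ θ) :
    Function.Injective (matrixMap (matrixM ρ θ)) := by
  have h : ∀ n, ∀ y : Fin 1 → FunctionField k, (∀ j, y j ∈ pieceW ρ θ n) →
      twistMap (phi ρ θ) (coeffMatrix (matrixM ρ θ)) y = 0 → y = 0 := by
    intro n y hy h0
    rw [coeffMatrix_matrixM] at h0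
    refine (Submodule.mem_bot k).1 (mem_of_finrank_le (tuples 1 (pieceW ρ θ n)) _ bot_le
      (fun y hy => by rw [(Submodule.mem_bot k).1 hy, map_zero]) ?_ (mem_tuples.2 hy) h0)
    rw [← rankCol, finrank_tuples, finrank_pieceW hr]
    have h3 := (hr n).2.2.2.1
    have h4 := rankCol_one_shapeM (k := k) n
    omega
  have := exact_of_graded (A := (0 : Matrix (Fin 1) (Fin 1) (algebraR ρ θ)))
    (fun _ _ => zero_mem _) matrixM_mem (Matrix.mul_zero _) (h 0)
    (fun n y hy h0 => ⟨0, fun _ => zero_mem _, by rw [map_zero, h _ y hy h0]⟩)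
  rw [← LinearMap.ker_eq_bot, LinearMap.ker_eq_bot']
  intro x hx
  obtain ⟨z, hz⟩ := (this x).1 hx
  rw [← hz]
  exact Matrix.zero_mulVec z

lemma exists_matrixQ_eq {n : ℕ} {x : Fin 1 → algebraR ρ θ}
    (hx : ∀ i, x i ∈ gradingR ρ θ (n + 1)) : ∃ z, matrixMap (matrixQ ρ θ) z = x := by
  have h : (fun i => coeffR ρ θ (n + 1 : ℕ) (x i)) ∈ tuples 1 (pieceW ρ θ (n + 1)) :=
    mem_tuples.2 fun _ => coeffR_mem _ _
  rw [← map_twistMap_shapeQ, ← coeffMatrix_matrixQ (ρ := ρ) (θ := θ)] at h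
  obtain ⟨z, hz, h⟩ := h
  obtain ⟨w, hw⟩ : ∃ w : Fin 4 → algebraR ρ θ, ∀ j, w j = ofPiece ρ θ n ⟨z j, mem_tuples.1 hz j⟩ :=
    ⟨_, fun _ => rfl⟩
  refine ⟨w, funext fun i => ext_coeffR fun m => ?_⟩
  rw [coeffR_matrixMap matrixQ_mem]
  by_cases hm : (n : ℤ) = m - 1
  · obtain rfl : m = ((n + 1 : ℕ) : ℤ) := by push_cast; omega
    have h1 : (fun j => coeffR ρ θ (((n + 1 : ℕ) : ℤ) - 1) (w j)) = z := by
      ext j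
      rw [← hm, hw, coeffR_ofPiece_same]
    rw [h1, h]
  · have h1 : (fun j => coeffR ρ θ (m - 1) (w j)) = 0 := by
      ext j
      rw [hw, coeffR_ofPiece_of_ne hm]
      rfl
    rw [h1, map_zero, coeffR_of_mem_of_ne (hx i) (by push_cast; omega)]
    rfl

/-- The image of `Q` is the augmentation ideal. -/
lemma mem_range_matrixQ (x : Fin 1 → algebraR ρ θ) :
    x ∈ (matrixMap (matrixQ ρ θ)).range ↔ x 0 ∈ augmentationIdeal (gradingR ρ θ) := by
  constructor
  · rintro ⟨z, rfl⟩
    rw [mem_augmentationIdeal_iff, coeffR_matrixMap matrixQ_mem]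
    have : (fun j => coeffR ρ θ (0 - 1) (z j)) = 0 := funext fun j => coeffR_of_neg (by norm_num) _
    rw [this, map_zero, Pi.zero_apply]
  · intro hx
    let S : Submodule (algebraR ρ θ)ᵐᵒᵖ (algebraR ρ θ) :=
      (matrixMap (matrixQ ρ θ)).range.comap (LinearMap.pi fun _ => LinearMap.id)
    have hS : augmentationIdeal (gradingR ρ θ) ≤ S := by
      refine Submodule.span_le.2 ?_
      rintro a ⟨n, hn, ha⟩
      obtain ⟨n, rfl⟩ := Nat.exists_eq_add_of_le' hn
      exact exists_matrixQ_eq (n := n) fun _ => ha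
    obtain ⟨z, hz⟩ := hS hx
    refine ⟨z, hz.trans (funext fun i => ?_)⟩
    rw [Subsingleton.elim i 0]
    rfl

theorem koszulComplexExact (hr : ∀ n, RanksAtLeast n ρ θ) : KoszulComplexExact ρ θ := by
  refine ⟨injective_M hr, exact_MN hr, exact_NP hr, exact_PQ hr, fun x => ?_, fun y => ?_⟩
  · refine Iff.trans ?_ (mem_range_matrixQ x).symm
    rw [augmentation, LinearMap.comp_apply,
      Submodule.mkQ_apply, Submodule.Quotient.mk_eq_zero, LinearMap.proj_apply]
  · obtain ⟨r, rfl⟩ := Submodule.mkQ_surjective _ y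
    exact ⟨fun _ => r, rfl⟩

/-- The ranks of the modules in the Koszul resolution. -/
def koszulRank : ℕ → ℕ
  | 0 => 1
  | 1 => 4
  | 2 => 6
  | 3 => 4
  | 4 => 1
  | _ + 5 => 0

variable (ρ θ) in
/-- The differentials of the Koszul resolution, extended by zero. -/
def koszulDifferential : ∀ n, Matrix (Fin (koszulRank n)) (Fin (koszulRank (n + 1))) (algebraR ρ θ)
  | 0 => matrixQ ρ θ
  | 1 => matrixP ρ θ
  | 2 => matrixN ρ θ
  | 3 => matrixM ρ θ
  | _ + 4 => 0

theorem isKoszul (hr : ∀ n, RanksAtLeast n ρ θ) : IsKoszul (gradingR ρ θ) := by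
  refine ⟨isConnectedGraded_gradingR ρ θ, koszulRank, koszulDifferential ρ θ, rfl, ?_, ?_, ?_⟩
  · rintro (_ | _ | _ | _ | n)
    · exact matrixQ_mem
    · exact matrixP_mem
    · exact matrixN_mem
    · exact matrixM_mem
    · exact fun _ _ => zero_mem _
  · intro x
    refine (mem_range_matrixQ x).trans ⟨fun h i => ?_, fun h => h (0 : Fin 1)⟩
    have : i = (0 : Fin 1) := Subsingleton.elim (α := Fin 1) i 0
    rw [this]
    exact h
  · rintro (_ | _ | _ | _ | n)
    · exact exact_PQ hr
    · exact exact_NP hr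
    · exact exact_MN hr
    · intro x
      constructor
      · intro hx
        have hx0 : x = 0 := injective_M hr (hx.trans (map_zero _).symm)
        exact ⟨0, by rw [map_zero, hx0]⟩
      · rintro ⟨z, rfl⟩
        have : matrixMap (koszulDifferential ρ θ (3 + 1)) z = 0 := Matrix.zero_mulVec z
        rw [this, map_zero]
    · intro x
      have hx : x = 0 := funext fun i : Fin 0 => i.elim0
      rw [hx, map_zero]
      exact ⟨fun _ => ⟨0, map_zero _⟩, fun _ => rfl⟩

theorem hilbertSeries_gradingR (hr : ∀ n, RanksAtLeast n ρ θ) :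
    hilbertSeries (gradingR ρ θ) = ((1 - PowerSeries.X) ^ 4)⁻¹ := by
  have h := PowerSeries.mk_one_pow_eq_mk_choose_add ℚ 3
  rw [PowerSeries.eq_inv_iff_mul_eq_one (by simp)]
  have e : hilbertSeries (gradingR ρ θ) = PowerSeries.mk fun n => ((3 + n).choose 3 : ℚ) := by
    ext n
    rw [hilbertSeries, PowerSeries.coeff_mk, PowerSeries.coeff_mk, finrank_gradingR,
      finrank_pieceW hr, add_comm]
  rw [e, ← h, ← mul_pow, PowerSeries.mk_one_mul_one_sub_eq_one, one_pow]

/-- Exactness of the dual complex at the rows of length four: a row which is annihilated by `P` on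
the right is a multiple of the row of generators. -/
lemma exists_eq_mul_generatorR (hr : ∀ n, RanksAtLeast n ρ θ) {x : Fin 4 → algebraR ρ θ}
    (hx : Matrix.vecMul x (matrixP ρ θ) = 0) : ∃ r, ∀ j, x j = r * generatorR ρ θ j := by
  have hx' : ∀ n : ℕ, rowMap (phi ρ θ) n (shapeP (coeffZ ρ θ))
      (fun j => coeffR ρ θ n (x j)) = 0 := by
    intro n
    ext i
    rw [← coeffMatrix_matrixP, ← coeffR_vecMul matrixP_mem, hx]
    simp
  have h1 : ∀ n : ℕ, ∃ z : Fin 1 → FunctionField k, (∀ j, z j ∈ pieceW ρ θ n) ∧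
      rowMap (phi ρ θ) n (shapeQ (coordE k)) z = fun j => coeffR ρ θ (n + 1 : ℕ) (x j) := by
    intro n
    obtain ⟨z, hz, h⟩ := mem_of_finrank_le (tuples 4 (pieceW ρ θ (n + 1))) _
      (rowMap_mem (ρ := ρ) (θ := θ) shapeQ_mem n) (by
          rintro _ ⟨y, _, rfl⟩
          exact rowMap_rowMap coeffQ_mul_coeffP n y) (by
        have hq : rankRow ρ θ n (shapeQ (coordE k)) = (n + 3).choose 3 := by
          rw [← finrank_pieceW hr n, ← one_mul (Module.finrank k _), ← finrank_tuples, rankRow]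
          refine LinearEquiv.finrank_eq (Submodule.equivMapOfInjective _ ?_ _).symm
          rw [← LinearMap.ker_eq_bot, LinearMap.ker_eq_bot']
          intro y hy
          have := congrFun hy 0
          rw [rowMap_apply, Fin.sum_univ_one, Pi.zero_apply,
            show shapeQ (coordE k) 0 0 = 1 from rfl, map_one, mul_one] at this
          ext i
          rw [Subsingleton.elim i 0]
          exact this
        rw [← rankRow, ← rankRow, hq, finrank_tuples, finrank_pieceW hr]
        have h3 := (hr (n + 1)).2.2.2.2
        have h4 := rankRow_one_shapeP (k := k) (n + 1)
        simp only [add_assoc, Nat.reduceAdd] at *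
        omega) (mem_tuples.2 fun j => coeffR_mem (x j) (n + 1)) (hx' (n + 1))
    exact ⟨z, mem_tuples.1 hz, h⟩
  have h0 : (fun j => coeffR ρ θ 0 (x j)) = 0 := by
    refine (Submodule.mem_bot k).1 (mem_of_finrank_le (tuples 4 (pieceW ρ θ 0)) _ bot_le
      (fun y hy => by rw [(Submodule.mem_bot k).1 hy, map_zero]) ?_
      (mem_tuples.2 fun j => coeffR_mem (x j) 0) (hx' 0))
    rw [← rankRow, finrank_tuples, finrank_pieceW hr]
    have h1 := (hr 0).2.2.2.2
    have h2 := rankRow_one_shapeP (k := k) 0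
    simp only [zero_add, Nat.choose_self,
      Nat.choose_eq_zero_of_lt (by norm_num : 2 < 3)] at *
    omega
  choose z hz hz' using h1
  obtain ⟨T, hT⟩ := exists_coeffR_bound x
  obtain ⟨w, hw, hw'⟩ := exists_coeffR_eq T z hz
  refine ⟨w 0, fun j => ext_coeffR_nat fun n => ?_⟩
  rw [coeffR_mul_right (generatorR_mem j), coeffR_generatorR]
  obtain _ | n := n
  · have : coeffR ρ θ (((0 : ℕ) : ℤ) - 1) (w 0) = 0 := coeffR_of_neg (by norm_num) _
    rw [this, zero_mul]
    exact congrFun h0 j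
  · have h := congrFun (hz' n) j
    rw [← h]
    push_cast
    rw [add_sub_cancel_right, zpow_natCast]
    by_cases hn : n < T
    · rw [hw n hn, rowMap_apply, Fin.sum_univ_one]
      congr 2
    · rw [hw' n (by omega), zero_mul, h]
      exact hT (n + 1) (by omega) j

end Exactness

/-! ### The presentation of `R(τ)` -/

section Presentation

variable {k : Type u} [Field k]

/-- The relations are the entries of the product of the matrices `Q` and `P` over the free
algebra. -/
lemma relations_eq (ρ θ : kˣ) (l : Fin 6) :
    relations ρ θ l = ∑ j, FreeAlgebra.ι k j * shapeP (shapeZ ρ θ (FreeAlgebra.ι k)) j l := by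
  rw [Fin.sum_univ_four]
  fin_cases l <;> simp [relations, shapeP, shapeZ]

variable (ρ θ : kˣ)

lemma sum_generatorS_mul (l : Fin 6) :
    ∑ j, generatorS ρ θ j * shapeP (shapeZ ρ θ (generatorS ρ θ)) j l = 0 := by
  have h1 : RingQuot.mkAlgHom k (fun a b : FreeAlgebra k (Fin 4) =>
      b = 0 ∧ ∃ i, a = relations ρ θ i) (relations ρ θ l) = 0 := by
    rw [← map_zero (RingQuot.mkAlgHom k (fun a b : FreeAlgebra k (Fin 4) =>
      b = 0 ∧ ∃ i, a = relations ρ θ i))]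
    exact RingQuot.mkAlgHom_rel k ⟨rfl, l, rfl⟩
  rw [relations_eq, map_sum] at h1
  rw [← h1]
  refine Finset.sum_congr rfl fun j _ => ?_
  rw [map_mul]
  congr 1
  have h2 := congrFun (congrFun (shapeP_map (RingQuot.mkAlgHom k
    (fun a b : FreeAlgebra k (Fin 4) => b = 0 ∧ ∃ i, a = relations ρ θ i)) (map_zero _)
    (shapeZ ρ θ (FreeAlgebra.ι k))) j) l
  rw [Matrix.map_apply] at h2
  rw [h2]
  congr 1
  ext i
  exact (map_shapeZ ρ θ (RingQuot.mkAlgHom k (fun a b : FreeAlgebra k (Fin 4) =>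
    b = 0 ∧ ∃ i, a = relations ρ θ i)).toLinearMap (FreeAlgebra.ι k) i).symm

/-- The span of the generators of `S(τ)`. -/
def generatorSpan : Submodule k (algebraS ρ θ) := Submodule.span k (Set.range (generatorS ρ θ))

lemma generatorS_mem (j : Fin 4) : generatorS ρ θ j ∈ generatorSpan ρ θ :=
  Submodule.subset_span ⟨j, rfl⟩

/-- Elements of `S(τ)` are sums of homogeneous ones. -/
lemma exists_eq_sum_generatorSpan (s : algebraS ρ θ) :
    ∃ f : ℕ →₀ algebraS ρ θ, (∀ n, f n ∈ generatorSpan ρ θ ^ n) ∧ s = f.sum fun _ a => a := by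
  have h : s ∈ ⨆ n, generatorSpan ρ θ ^ n := by
    obtain ⟨a, rfl⟩ := RingQuot.mkAlgHom_surjective k _ s
    induction a using FreeAlgebra.induction with
    | grade0 r =>
      rw [AlgHom.commutes]
      refine Submodule.mem_iSup_of_mem 0 ?_
      rw [pow_zero]
      exact Submodule.algebraMap_mem r
    | grade1 x =>
      refine Submodule.mem_iSup_of_mem 1 ?_
      rw [pow_one]
      exact generatorS_mem ρ θ x
    | add a b ha hb => rw [map_add]; exact add_mem ha hb
    | mul a b ha hb =>
      rw [map_mul]
      have := Submodule.mul_mem_mul ha hb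
      rw [Submodule.iSup_mul] at this
      refine (iSup_le fun m => ?_ : (⨆ m, generatorSpan ρ θ ^ m *
        ⨆ n, generatorSpan ρ θ ^ n) ≤ ⨆ n, generatorSpan ρ θ ^ n) this
      rw [Submodule.mul_iSup]
      refine iSup_le fun n => ?_
      rw [← pow_add]
      exact le_iSup (fun n => generatorSpan ρ θ ^ n) (m + n)
  obtain ⟨f, hf, hs⟩ := (Submodule.mem_iSup_iff_exists_finsupp _ _).1 h
  exact ⟨f, hf, hs.symm⟩

/-- Homogeneous elements of positive degree are combinations of the generators. -/
lemma exists_eq_sum_generatorS {n : ℕ} {s : algebraS ρ θ} (hs : s ∈ generatorSpan ρ θ ^ (n + 1)) :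
    ∃ f : Fin 4 → algebraS ρ θ, (∀ j, f j ∈ generatorSpan ρ θ ^ n) ∧
      s = ∑ j, generatorS ρ θ j * f j := by
  rw [pow_succ'] at hs
  induction hs using Submodule.mul_induction_on' with
  | mem_mul_mem a ha b hb =>
    obtain ⟨c, rfl⟩ := (Submodule.mem_span_range_iff_exists_fun k).1 ha
    refine ⟨fun j => c j • b, fun j => Submodule.smul_mem _ _ hb, ?_⟩
    rw [Finset.sum_mul]
    exact Finset.sum_congr rfl fun j _ => by rw [smul_mul_assoc, mul_smul_comm]
  | add x _ y _ hx hy =>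
    obtain ⟨f, hf, rfl⟩ := hx
    obtain ⟨g, hg, rfl⟩ := hy
    refine ⟨f + g, fun j => add_mem (hf j) (hg j), ?_⟩
    simp only [Pi.add_apply, mul_add, Finset.sum_add_distrib]

variable [NeZero (2 : k)]

variable {ρ θ} in
/-- The homogeneous part of a solution of a linear equation over `R(τ)` is a solution. -/
lemma matrixMap_projR {m n d : ℕ} {A : Matrix (Fin m) (Fin n) (algebraR ρ θ)}
    (hA : ∀ i j, A i j ∈ gradingR ρ θ 1) {y : Fin m → algebraR ρ θ}
    (hy : ∀ i, y i ∈ gradingR ρ θ (d + 1)) {w : Fin n → algebraR ρ θ} (hw : matrixMap A w = y) :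
    matrixMap A (fun j => projR ρ θ d (w j)) = y := by
  ext1 i
  refine ext_coeffR fun e => ?_
  rw [coeffR_matrixMap hA]
  by_cases he : (d : ℤ) = e - 1
  · have h1 : (fun j => coeffR ρ θ (e - 1) (projR ρ θ d (w j))) =
        fun j => coeffR ρ θ (e - 1) (w j) := by
      ext j
      rw [← he, coeffR_projR_same]
    rw [h1, ← coeffR_matrixMap hA, hw]
  · have h1 : (fun j => coeffR ρ θ (e - 1) (projR ρ θ d (w j))) = 0 := by
      ext j
      rw [coeffR_projR_of_ne he]
      rfl
    rw [h1, map_zero, coeffR_of_mem_of_ne (hy i) (by push_cast; omega)]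
    rfl

variable {ρ θ} in
lemma matrixMap_matrixQ (w : Fin 4 → algebraR ρ θ) (i : Fin 1) :
    matrixMap (matrixQ ρ θ) w i = ∑ j, generatorR ρ θ j * w j := by
  rw [matrixMap_apply]
  refine Finset.sum_congr rfl fun j _ => ?_
  congr 1
  fin_cases i
  fin_cases j <;> rfl

/-- The homomorphism from `S(τ)` given by elements that satisfy its relations. -/
def liftS {A : Type u} [Ring A] [Algebra k A] (t : Fin 4 → A)
    (h : ∀ l, ∑ j, t j * shapeP (shapeZ ρ θ t) j l = 0) : algebraS ρ θ →ₐ[k] A :=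
  RingQuot.liftAlgHom k ⟨FreeAlgebra.lift k t, by
    rintro _ _ ⟨rfl, l, rfl⟩
    rw [map_zero, relations_eq, map_sum]
    refine Eq.trans ?_ (h l)
    refine Finset.sum_congr rfl fun j _ => ?_
    rw [map_mul, FreeAlgebra.lift_ι_apply]
    have h2 := congrFun (congrFun (shapeP_map (FreeAlgebra.lift k t) (map_zero _)
      (shapeZ ρ θ (FreeAlgebra.ι k))) j) l
    rw [Matrix.map_apply] at h2
    have h3 : (fun i => FreeAlgebra.lift k t (shapeZ ρ θ (FreeAlgebra.ι k) i)) =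
        shapeZ ρ θ t := by
      ext1 i
      refine (map_shapeZ ρ θ (FreeAlgebra.lift k t).toLinearMap (FreeAlgebra.ι k) i).trans ?_
      congr 1
      ext1 j
      exact FreeAlgebra.lift_ι_apply _ _
    rw [h2, h3]⟩

omit [NeZero (2 : k)] in
lemma liftS_generatorS {A : Type u} [Ring A] [Algebra k A] (t : Fin 4 → A)
    (h : ∀ l, ∑ j, t j * shapeP (shapeZ ρ θ t) j l = 0) (i : Fin 4) :
    liftS ρ θ t h (generatorS ρ θ i) = t i := by
  rw [liftS, generatorS, RingQuot.liftAlgHom_mkAlgHom_apply, FreeAlgebra.lift_ι_apply]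

/-- The homomorphism `S(τ) → R(τ)`, `x_i ↦ r_i`. -/
def homSR : algebraS ρ θ →ₐ[k] algebraR ρ θ :=
  liftS ρ θ (generatorR ρ θ) fun l => by
    have h := congrFun (congrFun (matrixQ_mul_matrixP (ρ := ρ) (θ := θ)) 0) l
    refine Eq.trans ?_ h
    rw [Matrix.mul_apply]
    refine Finset.sum_congr rfl fun j _ => ?_
    rw [matrixP_eq, elementZ_eq]
    congr 1
    fin_cases j <;> rfl

lemma homSR_generatorS (i : Fin 4) : homSR ρ θ (generatorS ρ θ i) = generatorR ρ θ i :=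
  liftS_generatorS ρ θ _ _ i

lemma homSR_shapeP (j : Fin 4) (l : Fin 6) :
    homSR ρ θ (shapeP (shapeZ ρ θ (generatorS ρ θ)) j l) = matrixP ρ θ j l := by
  have h2 := congrFun (congrFun (shapeP_map (homSR ρ θ) (map_zero _)
    (shapeZ ρ θ (generatorS ρ θ))) j) l
  rw [Matrix.map_apply] at h2
  have h3 : (fun i => homSR ρ θ (shapeZ ρ θ (generatorS ρ θ) i)) = elementZ ρ θ := by
    ext1 i
    have := map_shapeZ ρ θ (homSR ρ θ).toLinearMap (generatorS ρ θ) i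
    rw [elementZ_eq]
    refine this.trans ?_
    congr 1
    ext1 j
    exact homSR_generatorS ρ θ j
  rw [h2, h3, matrixP_eq]

lemma homSR_mem {n : ℕ} {s : algebraS ρ θ} (hs : s ∈ generatorSpan ρ θ ^ n) :
    homSR ρ θ s ∈ gradingR ρ θ n := by
  induction n generalizing s with
  | zero =>
    rw [pow_zero] at hs
    obtain ⟨c, rfl⟩ := Submodule.mem_one.1 hs
    rw [AlgHom.commutes, Algebra.algebraMap_eq_smul_one]
    exact Submodule.smul_mem _ _ (isConnectedGraded_gradingR ρ θ).one_mem
  | succ n ih =>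
    obtain ⟨f, hf, rfl⟩ := exists_eq_sum_generatorS ρ θ hs
    rw [map_sum]
    refine Submodule.sum_mem _ fun j _ => ?_
    rw [map_mul, homSR_generatorS, add_comm]
    exact mul_mem_gradingR (generatorR_mem j) (ih (hf j))

lemma exists_homSR_eq {n : ℕ} {x : algebraR ρ θ} (hx : x ∈ gradingR ρ θ n) :
    ∃ s ∈ generatorSpan ρ θ ^ n, homSR ρ θ s = x := by
  induction n generalizing x with
  | zero =>
    obtain ⟨c, rfl⟩ := (isConnectedGraded_gradingR ρ θ).degree_zero x hx
    refine ⟨algebraMap k _ c, ?_, AlgHom.commutes _ c⟩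
    rw [pow_zero]
    exact Submodule.algebraMap_mem c
  | succ n ih =>
    obtain ⟨z, hz⟩ := exists_matrixQ_eq (x := fun _ => x) fun _ => hx
    have hz' := matrixMap_projR matrixQ_mem (fun _ => hx) hz
    choose f hf hf' using fun j => ih (projR_mem n (z j))
    refine ⟨∑ j, generatorS ρ θ j * f j, Submodule.sum_mem _ fun j _ => ?_, ?_⟩
    · rw [pow_succ']
      exact Submodule.mul_mem_mul (generatorS_mem ρ θ j) (hf j)
    · have h := congrFun hz' 0
      rw [matrixMap_matrixQ] at h
      rw [map_sum, ← h]
      exact Finset.sum_congr rfl fun j _ => by rw [map_mul, homSR_generatorS, hf']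

lemma homSR_surjective : Function.Surjective (homSR ρ θ) := by
  intro x
  obtain ⟨N, hN⟩ := exists_eq_sum_projR x
  choose f hf hf' using fun n => exists_homSR_eq ρ θ (projR_mem n x)
  refine ⟨∑ i ∈ Finset.range N, f i, ?_⟩
  rw [map_sum]
  exact (Finset.sum_congr rfl fun i _ => hf' i).trans (hN N le_rfl).symm

variable {ρ θ}

/-- On homogeneous elements, `S(τ) → R(τ)` is injective: if `∑ x_j s_j` vanishes in `R`, then the
images of the `s_j` form a column in the kernel of `Q`, which is the image of `P`. By induction
on the degree, the `s_j` are the same combinations of the columns of `P` over `S`. -/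
lemma eq_zero_of_homSR_eq_zero (hr : ∀ n, RanksAtLeast n ρ θ) (n : ℕ) {s : algebraS ρ θ}
    (hs : s ∈ generatorSpan ρ θ ^ n) (h0 : homSR ρ θ s = 0) : s = 0 := by
  induction n generalizing s with
  | zero =>
    rw [pow_zero] at hs
    obtain ⟨c, rfl⟩ := Submodule.mem_one.1 hs
    have := (isConnectedGraded_gradingR ρ θ).nontrivial
    rw [AlgHom.commutes, map_eq_zero_iff _ (algebraMap k (algebraR ρ θ)).injective] at h0
    rw [h0, map_zero]
  | succ n ih =>
    obtain ⟨f, hf, rfl⟩ := exists_eq_sum_generatorS ρ θ hs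
    have hQ : matrixMap (matrixQ ρ θ) (fun j => homSR ρ θ (f j)) = 0 := by
      ext1 i
      rw [matrixMap_matrixQ, Pi.zero_apply, ← h0, map_sum]
      exact Finset.sum_congr rfl fun j _ => by rw [map_mul, homSR_generatorS]
    obtain ⟨w, hw⟩ := (exact_PQ hr _).1 hQ
    have hlift : ∃ g : Fin 6 → algebraS ρ θ, ∀ j,
        f j = ∑ l, shapeP (shapeZ ρ θ (generatorS ρ θ)) j l * g l := by
      obtain _ | n := n
      · refine ⟨0, fun j => ?_⟩
        have h1 : homSR ρ θ (f j) = 0 := by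
          have h2 := congrFun hw j
          refine ext_coeffR fun e => ?_
          by_cases he : (0 : ℤ) = e
          · subst he
            rw [← h2, coeffR_matrixMap matrixP_mem, map_zero]
            have : (fun l => coeffR ρ θ (0 - 1) (w l)) = 0 :=
              funext fun l => coeffR_of_neg (by norm_num) _
            rw [this, map_zero, Pi.zero_apply]
          · rw [map_zero]
            exact coeffR_of_mem_of_ne (homSR_mem ρ θ (hf j)) he
        rw [ih (hf j) h1]
        simp
      · have hw' := matrixMap_projR matrixP_mem (fun j => homSR_mem ρ θ (hf j)) hw
        choose g hg hg' using fun l => exists_homSR_eq ρ θ (projR_mem n (w l))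
        refine ⟨g, fun j => sub_eq_zero.1 (ih (sub_mem (hf j) ?_) ?_)⟩
        · refine Submodule.sum_mem _ fun l _ => ?_
          rw [pow_succ']
          refine Submodule.mul_mem_mul ?_ (hg l)
          exact shapeP_forall (· ∈ generatorSpan ρ θ) (zero_mem _)
            (shapeZ_mem ρ θ _ (generatorS_mem ρ θ)) j l
        · rw [map_sub, sub_eq_zero, map_sum]
          refine (congrFun hw' j).symm.trans ?_
          rw [matrixMap_apply]
          exact Finset.sum_congr rfl fun l _ => by rw [map_mul, homSR_shapeP, hg']
    obtain ⟨g, hg⟩ := hlift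
    simp only [hg, Finset.mul_sum, ← mul_assoc]
    rw [Finset.sum_comm]
    refine Finset.sum_eq_zero fun l _ => ?_
    rw [← Finset.sum_mul, sum_generatorS_mul, zero_mul]

lemma homSR_injective (hr : ∀ n, RanksAtLeast n ρ θ) : Function.Injective (homSR ρ θ) := by
  refine (injective_iff_map_eq_zero (homSR ρ θ)).2 ?_
  intro s hs
  obtain ⟨f, hf, rfl⟩ := exists_eq_sum_generatorSpan ρ θ s
  have h : ∀ n, f n = 0 := by
    intro n
    refine eq_zero_of_homSR_eq_zero hr n (hf n) (ext_coeffR fun e => ?_)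
    by_cases he : (n : ℤ) = e
    · subst he
      have key : coeffR ρ θ n (homSR ρ θ (f.sum fun _ a => a)) =
          coeffR ρ θ n (homSR ρ θ (f n)) := by
        rw [Finsupp.sum, map_sum, map_sum]
        refine Finset.sum_eq_single n (fun m _ hm => ?_) (fun hn => ?_)
        · exact coeffR_of_mem_of_ne (homSR_mem ρ θ (hf m)) (by exact_mod_cast hm)
        · rw [Finsupp.notMem_support_iff.1 hn, map_zero, map_zero]
      rw [← key, hs]
    · rw [map_zero]
      exact coeffR_of_mem_of_ne (homSR_mem ρ θ (hf n)) he
  exact Finset.sum_eq_zero (s := f.support) (f := fun n => f n) fun n _ => h n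

/-- The algebra `R(τ)` is presented by the quadratic relations of `S(τ)`. -/
theorem exists_algEquiv (hr : ∀ n, RanksAtLeast n ρ θ) :
    ∃ e : algebraS ρ θ ≃ₐ[k] algebraR ρ θ, ∀ i, e (generatorS ρ θ i) = generatorR ρ θ i :=
  ⟨AlgEquiv.ofBijective (homSR ρ θ) ⟨homSR_injective hr, homSR_surjective ρ θ⟩,
    homSR_generatorS ρ θ⟩

end Presentation

/-! ### Cocycles of the dual complex that are not coboundaries -/

section Nakayama

variable {k : Type u} [Field k]

/-- Nakayama's lemma for the module spanned by `F` over the polynomial ring `k[a, b]` and its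
ideal `(a, b)`: a nonzero finite-dimensional space is not contained in `a F + b F`. -/
theorem exists_forall_ne_mul_add_mul {K : Type u} [Field K] [Algebra k K] {a b : K}
    (hab : AlgebraicIndependent k ![a, b]) (F : Submodule k K) [FiniteDimensional k F]
    (hF : F ≠ ⊥) : ∃ f ∈ F, ∀ x ∈ F, ∀ y ∈ F, f ≠ a * x + b * y := by
  by_contra! hcon
  let ψ : MvPolynomial (Fin 2) k →ₐ[k] K := MvPolynomial.aeval ![a, b]
  let _ : Module (MvPolynomial (Fin 2) k) K := Module.compHom K ψ.toRingHom
  have hsmul : ∀ (p : MvPolynomial (Fin 2) k) (x : K), p • x = ψ p * x := fun _ _ => rfl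
  let N : Submodule (MvPolynomial (Fin 2) k) K := Submodule.span _ (F : Set K)
  let I : Ideal (MvPolynomial (Fin 2) k) := Ideal.span {MvPolynomial.X 0, MvPolynomial.X 1}
  have hN : N ≤ I • N := by
    refine Submodule.span_le.2 fun f hf => ?_
    obtain ⟨x, hx, y, hy, rfl⟩ := hcon f hf
    have e0 : a * x = (MvPolynomial.X 0 : MvPolynomial (Fin 2) k) • x := by
      rw [hsmul, MvPolynomial.aeval_X]; rfl
    have e1 : b * y = (MvPolynomial.X 1 : MvPolynomial (Fin 2) k) • y := by
      rw [hsmul, MvPolynomial.aeval_X]; rfl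
    rw [e0, e1]
    exact add_mem
      (Submodule.smul_mem_smul (Ideal.subset_span (Or.inl rfl)) (Submodule.subset_span hx))
      (Submodule.smul_mem_smul (Ideal.subset_span (Or.inr rfl)) (Submodule.subset_span hy))
  have hfg : N.FG := by
    obtain ⟨s, hs⟩ := (Submodule.fg_iff_finiteDimensional F).2 inferInstance
    refine ⟨s, le_antisymm (Submodule.span_mono ?_) (Submodule.span_le.2 fun f hf => ?_)⟩
    · rw [← hs]; exact Submodule.subset_span
    · rw [← hs] at hf
      induction hf using Submodule.span_induction with
      | mem x hx => exact Submodule.subset_span hx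
      | zero => exact zero_mem _
      | add x y _ _ hx hy => exact add_mem hx hy
      | smul c x _ hx =>
        have : c • x = (MvPolynomial.C c : MvPolynomial (Fin 2) k) • x := by
          rw [hsmul, Algebra.smul_def, ← MvPolynomial.algebraMap_eq, AlgHom.commutes]
        rw [this]
        exact Submodule.smul_mem _ _ hx
  obtain ⟨r, hr, hr'⟩ := Submodule.exists_sub_one_mem_and_smul_eq_zero_of_fg_of_le_smul I N hfg hN
  obtain ⟨f, hf, hf0⟩ := (Submodule.ne_bot_iff F).1 hF
  have h1 := hr' f (Submodule.subset_span hf)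
  rw [hsmul, mul_eq_zero, or_iff_left hf0] at h1
  rw [hab (h1.trans (map_zero ψ).symm)] at hr
  have hI : I ≤ RingHom.ker (MvPolynomial.eval (fun _ : Fin 2 => (0 : k))) := by
    refine Ideal.span_le.2 ?_
    rintro _ (rfl | rfl) <;> simp
  have h2 := hI hr
  simp at h2

end Nakayama

section Cocycles

variable {k : Type u} [Field k] [NeZero (2 : k)] (ρ θ : kˣ)

/-- The element `U = (γ u - δ) / (γ - δ u)`, for which `φ(U) = u v`. -/
def ratioU : FunctionField k :=
  (cplus ρ * coordU k - cminus ρ) / (cplus ρ - cminus ρ * coordU k)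

/-- The element `V = (ε v - ζ) / (ε - ζ v)`, for which `φ(V) = v`. -/
def ratioV : FunctionField k :=
  (cplus θ * coordV k - cminus θ) / (cplus θ - cminus θ * coordV k)

omit [NeZero (2 : k)] in
lemma moebius_inv (c : kˣ) (x : FunctionField k) :
    moebius ((c⁻¹ : kˣ) : k) x = (cplus c * x - cminus c) / (cplus c - cminus c * x) := by
  have hc : algebraMap k (FunctionField k) (c : k) ≠ 0 := by
    rw [Ne, map_eq_zero]; exact c.ne_zero
  have hi : algebraMap k (FunctionField k) ((c⁻¹ : kˣ) : k) =
      (algebraMap k (FunctionField k) (c : k))⁻¹ := by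
    rw [Units.val_inv_eq_inv_val, map_inv₀]
  rw [moebius, cplus, cminus, map_add, map_sub, map_add, map_sub, hi, map_one,
    ← mul_div_mul_left _ _ hc]
  congr 1
  · field_simp
    ring
  · field_simp
    ring

lemma phi_ratioU : phi ρ θ (ratioU ρ) = coordU k * coordV k := by
  have h := phi_numU ρ θ
  have hne : cplus ρ - cminus ρ * phi ρ θ (coordU k) ≠ 0 := by
    have := (map_ne_zero (phi ρ θ)).2 (plus_sub_u_ne_zero ρ)
    rwa [map_sub, map_mul, phi_cplus, phi_cminus] at this
  rw [ratioU, map_div₀, map_sub, map_sub, map_mul, map_mul, phi_cplus, phi_cminus, h,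
    mul_div_cancel_right₀ _ hne]

lemma phi_ratioV : phi ρ θ (ratioV θ) = coordV k := by
  have h := phi_numV ρ θ
  have hne : cplus θ - cminus θ * phi ρ θ (coordV k) ≠ 0 := by
    have := (map_ne_zero (phi ρ θ)).2 (plus_sub_v_ne_zero θ)
    rwa [map_sub, map_mul, phi_cplus, phi_cminus] at this
  rw [ratioV, map_div₀, map_sub, map_sub, map_mul, map_mul, phi_cplus, phi_cminus, h,
    mul_div_cancel_right₀ _ hne]

lemma ratioU_ne_zero : ratioU ρ ≠ 0 := fun h => by
  have := phi_ratioU ρ 1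
  rw [h, map_zero] at this
  exact mul_ne_zero coordU_ne_zero coordV_ne_zero this.symm

lemma ratioV_ne_zero : ratioV θ ≠ 0 := fun h => by
  have := phi_ratioV 1 θ
  rw [h, map_zero] at this
  exact coordV_ne_zero this.symm

lemma algebraicIndependent_ratio (a b : FunctionField k)
    (ha : ∀ L : IntermediateField k (FunctionField k), a ∈ L → ratioU ρ ∈ L)
    (hb : ∀ L : IntermediateField k (FunctionField k), b ∈ L → ratioV θ ∈ L) (n : ℕ) :
    AlgebraicIndependent k ![(phi ρ θ ^ n) a, (phi ρ θ ^ n) b] := by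
  have h : AlgebraicIndependent k ![a, b] := by
    refine algebraicIndependent_of_adjoin a b ?_ ?_
    · refine coord_mem_adjoin_moebius ρ⁻¹ 0 _ ?_
      rw [moebius_inv]
      exact ha _ (IntermediateField.subset_adjoin k _ (Or.inl rfl))
    · refine coord_mem_adjoin_moebius θ⁻¹ 1 _ ?_
      rw [moebius_inv]
      exact hb _ (IntermediateField.subset_adjoin k _ (Or.inr rfl))
  have h2 := h.map' (f := ((phi ρ θ ^ n : FunctionField k ≃ₐ[k] FunctionField k) :
    FunctionField k →ₐ[k] FunctionField k)) (phi ρ θ ^ n).injective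
  convert h2 using 1
  ext i
  fin_cases i <;> rfl

variable {ρ θ}

omit [NeZero (2 : k)] in
lemma one_mem_spaceE : (1 : FunctionField k) ∈ spaceE k := coordE_mem 0

lemma pieceW_ne_bot (n : ℕ) : pieceW ρ θ n ≠ ⊥ := by
  have h : (1 : FunctionField k) ∈ pieceW ρ θ n := by
    induction n with
    | zero => exact one_mem_twistedPower_zero _ _
    | succ n ih =>
      rw [pieceW, twistedPower_succ, ← one_mul (1 : FunctionField k)]
      exact Submodule.mul_mem_mul one_mem_spaceE ⟨1, ih, map_one (phi ρ θ)⟩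
  exact fun h0 => one_ne_zero ((Submodule.mem_bot k).1 (h0 ▸ h))

variable (ρ θ)

lemma exists_not_mem_ratio (n : ℕ) : ∃ f ∈ pieceW ρ θ n, ∀ x ∈ pieceW ρ θ n,
    ∀ y ∈ pieceW ρ θ n, f ≠ (phi ρ θ ^ n) (ratioU ρ) * x + (phi ρ θ ^ n) (ratioV θ) * y :=
  exists_forall_ne_mul_add_mul (algebraicIndependent_ratio ρ θ _ _ (fun _ h => h) (fun _ h => h) n)
    _ (pieceW_ne_bot n)

lemma exists_not_mem_inv_ratio (n : ℕ) : ∃ f ∈ pieceW ρ θ n, ∀ x ∈ pieceW ρ θ n,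
    ∀ y ∈ pieceW ρ θ n,
      f ≠ (phi ρ θ ^ n) (ratioU ρ)⁻¹ * x + (phi ρ θ ^ n) (ratioV θ)⁻¹ * y :=
  exists_forall_ne_mul_add_mul (algebraicIndependent_ratio ρ θ _ _
    (fun L h => by simpa using L.inv_mem h) (fun L h => by simpa using L.inv_mem h) n)
    _ (pieceW_ne_bot n)

/-- The element `c = (γ - δ u) (ε - ζ v)`, for which `z₉ = c U t` and `z₁₀ = -c V t`. -/
def commonFactor : FunctionField k :=
  (cplus ρ - cminus ρ * coordU k) * (cplus θ - cminus θ * coordV k)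

lemma commonFactor_ne_zero : commonFactor ρ θ ≠ 0 :=
  mul_ne_zero (plus_sub_u_ne_zero ρ) (plus_sub_v_ne_zero θ)

lemma coeffZ_eight : coeffZ ρ θ 8 = commonFactor ρ θ * ratioU ρ := by
  have h := plus_sub_u_ne_zero ρ
  have h2 : (cplus ρ - cminus ρ * coordU k) * ratioU ρ = cplus ρ * coordU k - cminus ρ :=
    mul_div_cancel₀ _ h
  change (cplus ρ * coordU k - cminus ρ) * (cplus θ - cminus θ * coordV k) = _
  rw [commonFactor, ← h2]
  ring

lemma coeffZ_nine : coeffZ ρ θ 9 = -(commonFactor ρ θ * ratioV θ) := by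
  have h := plus_sub_v_ne_zero θ
  have h2 : (cplus θ - cminus θ * coordV k) * ratioV θ = cplus θ * coordV k - cminus θ :=
    mul_div_cancel₀ _ h
  change (cminus ρ * coordU k - cplus ρ) * (cplus θ * coordV k - cminus θ) = _
  rw [commonFactor, ← h2]
  ring

lemma mul_map_mem_pieceW {n : ℕ} {a e : FunctionField k} (ha : a ∈ pieceW ρ θ n)
    (he : e ∈ spaceE k) : a * (phi ρ θ ^ n) e ∈ pieceW ρ θ (n + 1) := by
  rw [pieceW, twistedPower_succ']
  exact Submodule.mul_mem_mul ha ⟨e, he, rfl⟩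

omit [NeZero (2 : k)] in
lemma algebraMap_mul_mem (c : k) {e : FunctionField k} (he : e ∈ spaceE k) :
    algebraMap k _ c * e ∈ spaceE k := by
  rw [← Algebra.smul_def]
  exact Submodule.smul_mem _ _ he

lemma commonFactor_mem : commonFactor ρ θ ∈ spaceE k := by
  have e : commonFactor ρ θ = cplus ρ * (cplus θ * 1) - cplus ρ * (cminus θ * coordV k) -
      cminus ρ * (cplus θ * coordU k) + cminus ρ * (cminus θ * (coordU k * coordV k)) := by
    rw [commonFactor]; ring
  rw [e]
  exact add_mem (sub_mem (sub_mem
    (algebraMap_mul_mem _ (algebraMap_mul_mem _ (coordE_mem 0)))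
    (algebraMap_mul_mem _ (algebraMap_mul_mem _ (coordE_mem 2))))
    (algebraMap_mul_mem _ (algebraMap_mul_mem _ (coordE_mem 1))))
    (algebraMap_mul_mem _ (algebraMap_mul_mem _ (coordE_mem 3)))

/-- Some homogeneous element of each positive degree is not in the left ideal generated by `z₉`
and `z₁₀`. -/
lemma exists_ne_mul_elementZ (n : ℕ) : ∃ f ∈ gradingR ρ θ (n + 1), ∀ x y : algebraR ρ θ,
    f ≠ x * elementZ ρ θ 8 + y * elementZ ρ θ 9 := by
  obtain ⟨f, hf, hne⟩ := exists_not_mem_ratio ρ θ n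
  refine ⟨ofPiece ρ θ (n + 1) ⟨_, mul_map_mem_pieceW ρ θ hf (commonFactor_mem ρ θ)⟩,
    ofPiece_mem _ _, fun x y h => ?_⟩
  have h1 := congrArg (coeffR ρ θ (n + 1 : ℕ)) h
  rw [coeffR_ofPiece_same, map_add, coeffR_mul_right (elementZ_mem 8),
    coeffR_mul_right (elementZ_mem 9), coeffR_elementZ, coeffR_elementZ] at h1
  push_cast at h1
  rw [add_sub_cancel_right, zpow_natCast, coeffZ_eight, coeffZ_nine, map_neg, map_mul, map_mul]
    at h1
  refine hne _ (coeffR_mem x n) _ (neg_mem (coeffR_mem y n)) ?_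
  refine mul_right_cancel₀ ((map_ne_zero (phi ρ θ ^ n)).2 (commonFactor_ne_zero ρ θ)) ?_
  rw [h1]
  ring

lemma vecMul_shapeN {X : Type u} [Ring X] (a b : X) (z : Fin 10 → X) :
    Matrix.vecMul ![a, b, 0, 0, 0, 0] (shapeN z) = ![a * z 8 + b * z 9, 0, 0, 0] := by
  ext j
  fin_cases j <;> simp [Matrix.vecMul, dotProduct, Fin.sum_univ_succ, shapeN]

lemma vecMul_shapeP {X : Type u} [Ring X] (x : Fin 4 → X) (z : Fin 10 → X) :
    Matrix.vecMul x (shapeP z) 0 = x 0 * z 0 + x 2 * z 1 ∧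
      Matrix.vecMul x (shapeP z) 4 = x 0 * z 4 + x 3 * z 5 := by
  constructor <;> simp [Matrix.vecMul, dotProduct, Fin.sum_univ_four, shapeP]

/-- In each positive degree there is a row of length six which is annihilated by `N` but is not
a combination of the rows of `P`. -/
lemma exists_ne_vecMul_matrixP (n : ℕ) : ∃ y : Fin 6 → algebraR ρ θ,
    (∀ j, y j ∈ gradingR ρ θ (n + 1)) ∧ Matrix.vecMul y (matrixN ρ θ) = 0 ∧
      ∀ x, Matrix.vecMul x (matrixP ρ θ) ≠ y := by
  obtain ⟨b, hb, hne⟩ := exists_not_mem_inv_ratio ρ θ n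
  have hU := (map_ne_zero (phi ρ θ ^ n)).2 (ratioU_ne_zero ρ)
  have hV := (map_ne_zero (phi ρ θ ^ n)).2 (ratioV_ne_zero θ)
  have hU' := (map_ne_zero (phi ρ θ ^ n)).2 (plus_sub_u_ne_zero ρ)
  have hV' := (map_ne_zero (phi ρ θ ^ n)).2 (plus_sub_v_ne_zero θ)
  have hv : cplus θ * coordV k - cminus θ = ratioV θ * (cplus θ - cminus θ * coordV k) :=
    (div_mul_cancel₀ _ (plus_sub_v_ne_zero θ)).symm
  have hu : cplus ρ * coordU k - cminus ρ = ratioU ρ * (cplus ρ - cminus ρ * coordU k) :=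
    (div_mul_cancel₀ _ (plus_sub_u_ne_zero ρ)).symm
  have m0 : cplus θ * coordV k - cminus θ ∈ spaceE k := by
    have := sub_mem (algebraMap_mul_mem ((θ : k) + 1) (coordE_mem (k := k) 2))
      (algebraMap_mul_mem ((θ : k) - 1) (coordE_mem (k := k) 0))
    have e : cplus θ * coordV k - cminus θ = cplus θ * coordV k - cminus θ * 1 := by ring
    rw [e]
    exact this
  have m1 : (cplus θ * coordV k - cminus θ) * coordU k ∈ spaceE k := by
    have := sub_mem (algebraMap_mul_mem ((θ : k) + 1) (coordE_mem (k := k) 3))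
      (algebraMap_mul_mem ((θ : k) - 1) (coordE_mem (k := k) 1))
    have e : (cplus θ * coordV k - cminus θ) * coordU k =
      cplus θ * (coordU k * coordV k) - cminus θ * coordU k := by ring
    rw [e]
    exact this
  -- With `b ∈ W_n` as in Nakayama's lemma, the cocycle is `b φ^n(ε v - ζ) (1, φ^n(u), 0, 0, 0, 0)`.
  let y₀ := ofPiece ρ θ (n + 1) ⟨_, mul_map_mem_pieceW ρ θ hb m0⟩
  let y₁ := ofPiece ρ θ (n + 1) ⟨_, mul_map_mem_pieceW ρ θ hb m1⟩
  have hy₀ : y₀ ∈ gradingR ρ θ (n + 1) := ofPiece_mem _ _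
  have hy₁ : y₁ ∈ gradingR ρ θ (n + 1) := ofPiece_mem _ _
  have c₀ : coeffR ρ θ (n + 1 : ℕ) y₀ = b * (phi ρ θ ^ n) (cplus θ * coordV k - cminus θ) :=
    coeffR_ofPiece_same _ _
  have c₁ : coeffR ρ θ (n + 1 : ℕ) y₁ =
      b * (phi ρ θ ^ n) ((cplus θ * coordV k - cminus θ) * coordU k) :=
    coeffR_ofPiece_same _ _
  clear_value y₀ y₁
  refine ⟨![y₀, y₁, 0, 0, 0, 0], ?_, ?_, fun x hx => ?_⟩
  · intro j
    fin_cases j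
    exacts [hy₀, hy₁, zero_mem _, zero_mem _, zero_mem _, zero_mem _]
  · have h : y₀ * elementZ ρ θ 8 + y₁ * elementZ ρ θ 9 = 0 := by
      refine ext_coeffR fun e => ?_
      rw [map_add, coeffR_mul_right (elementZ_mem 8), coeffR_mul_right (elementZ_mem 9),
        coeffR_elementZ, coeffR_elementZ, map_zero]
      by_cases he : ((n + 1 : ℕ) : ℤ) = e - 1
      · rw [← he, c₀, c₁, zpow_natCast, coeffZ_eight, coeffZ_nine, pow_succ]
        simp only [AlgEquiv.mul_apply, map_neg, map_mul, phi_ratioU, phi_ratioV]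
        ring
      · rw [coeffR_of_mem_of_ne hy₀ he, coeffR_of_mem_of_ne hy₁ he, zero_mul, zero_mul, add_zero]
    rw [matrixN_eq, vecMul_shapeN, h]
    ext j
    fin_cases j <;> rfl
  · rw [matrixP_eq] at hx
    have key : ∀ (w w' : algebraR ρ θ) (i j : Fin 10),
        coeffR ρ θ (n + 1 : ℕ) (w * elementZ ρ θ i + w' * elementZ ρ θ j) =
          coeffR ρ θ n w * (phi ρ θ ^ n) (coeffZ ρ θ i) +
            coeffR ρ θ n w' * (phi ρ θ ^ n) (coeffZ ρ θ j) := by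
      intro w w' i j
      rw [map_add, coeffR_mul_right (elementZ_mem i), coeffR_mul_right (elementZ_mem j),
        coeffR_elementZ, coeffR_elementZ]
      push_cast
      rw [add_sub_cancel_right, zpow_natCast]
    -- If it were a combination `x P`, its first and fifth entries would give
    -- `b = φ^n(U)⁻¹ (-x₄) + φ^n(V)⁻¹ x₃` on coefficients.
    have e0 := (vecMul_shapeP x (elementZ ρ θ)).1
    have e4 := (vecMul_shapeP x (elementZ ρ θ)).2
    rw [hx] at e0 e4
    have k0 := key (x 0) (x 2) 0 1
    have k4 := key (x 0) (x 3) 4 5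
    rw [← e0] at k0
    rw [← e4] at k4
    have k0' : b * (phi ρ θ ^ n) (cplus θ * coordV k - cminus θ) =
        coeffR ρ θ n (x 0) * (phi ρ θ ^ n) (cminus θ - cplus θ * coordV k) +
          coeffR ρ θ n (x 2) * (phi ρ θ ^ n) (cplus θ - cminus θ * coordV k) := c₀.symm.trans k0
    have k4' : 0 = coeffR ρ θ n (x 0) * (phi ρ θ ^ n) (cminus ρ - cplus ρ * coordU k) +
          coeffR ρ θ n (x 3) * (phi ρ θ ^ n) (cplus ρ - cminus ρ * coordU k) :=
      (map_zero (coeffR ρ θ (n + 1 : ℕ))).symm.trans k4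
    rw [← neg_sub (cplus θ * coordV k), map_neg, hv, map_mul] at k0'
    rw [← neg_sub (cplus ρ * coordU k), map_neg, hu, map_mul] at k4'
    have l0 : b * (phi ρ θ ^ n) (ratioV θ) =
        coeffR ρ θ n (x 2) - coeffR ρ θ n (x 0) * (phi ρ θ ^ n) (ratioV θ) := by
      refine mul_right_cancel₀ hV' ?_
      linear_combination k0'
    have l4 : coeffR ρ θ n (x 3) = coeffR ρ θ n (x 0) * (phi ρ θ ^ n) (ratioU ρ) := by
      refine mul_right_cancel₀ hU' ?_
      linear_combination -k4'
    refine hne _ (neg_mem (coeffR_mem (x 3) n)) _ (coeffR_mem (x 2) n) ?_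
    rw [map_inv₀, map_inv₀, l4]
    field_simp
    linear_combination l0

end Cocycles

/-! ### Dimension shifting -/

section Shifting

variable {k : Type u} [Field k] {A : Type u} [Ring A] [Algebra k A]
  {X F G H K : Type u} [AddCommGroup X] [Module A X] [AddCommGroup F] [Module A F]
  [AddCommGroup G] [Module A G] [AddCommGroup H] [Module A H] [AddCommGroup K] [Module A K]

lemma shortExact_mk {j : K →ₗ[A] F} {p : F →ₗ[A] X} (hj : Function.Injective j)
    (h : Function.Exact j p) (hp : Function.Surjective p) :
    (ShortComplex.mk (ModuleCat.ofHom j) (ModuleCat.ofHom p)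
      (by ext x; exact h.apply_apply_eq_zero x)).ShortExact where
  exact := (ShortComplex.ShortExact.moduleCat_exact_iff_function_exact _).mpr h
  mono_f := (ModuleCat.mono_iff_injective _).mpr hj
  epi_g := (ModuleCat.epi_iff_surjective _).mpr hp

variable (k) in
/-- For `0 → K → F → X → 0` with `F` projective, the connecting map
`Ext^n(K, Y) → Ext^{n+1}(X, Y)` is onto, and its kernel comes from `Ext^n(F, Y)`. -/
lemma exists_connecting [Module.Projective A F] {j : K →ₗ[A] F} {p : F →ₗ[A] X}
    (hj : Function.Injective j) (h : Function.Exact j p) (hp : Function.Surjective p)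
    (Y : ModuleCat.{u} A) (n : ℕ) :
    ∃ L : Abelian.Ext (ModuleCat.of A K) Y n →ₗ[k] Abelian.Ext (ModuleCat.of A X) Y (n + 1),
      Function.Surjective L ∧ ∀ x, L x = 0 ↔ ∃ y : Abelian.Ext (ModuleCat.of A F) Y n,
        (Abelian.Ext.mk₀ (ModuleCat.ofHom j)).comp y (zero_add n) = x := by
  have hS := shortExact_mk hj h hp
  have : Projective (ModuleCat.of A F) := (IsProjective.iff_projective F).1 inferInstance
  refine ⟨Abelian.Ext.precompOfLinear hS.extClass k Y (add_comm 1 n), fun x => ?_, fun x => ?_⟩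
  · exact Abelian.Ext.contravariant_sequence_exact₃ hS Y x
      (Abelian.Ext.eq_zero_of_projective (P := ModuleCat.of A F) _) (add_comm 1 n)
  · constructor
    · exact fun hx => Abelian.Ext.contravariant_sequence_exact₁ hS Y x (add_comm 1 n) hx
    · rintro ⟨y, rfl⟩
      exact hS.extClass_comp_assoc y (h := add_comm 1 n)

variable (k) in
/-- Dimension shifting along an exact sequence `G → F → H` with `G` projective. -/
lemma exists_connecting_ker [Module.Projective A G] {e : G →ₗ[A] F} {d : F →ₗ[A] H}
    (h : Function.Exact e d) (Y : ModuleCat.{u} A) (n : ℕ) :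
    ∃ L : Abelian.Ext (ModuleCat.of A e.ker) Y n →ₗ[k]
        Abelian.Ext (ModuleCat.of A d.ker) Y (n + 1),
      Function.Surjective L ∧ ∀ x, L x = 0 ↔ ∃ y : Abelian.Ext (ModuleCat.of A G) Y n,
        (Abelian.Ext.mk₀ (ModuleCat.ofHom e.ker.subtype)).comp y (zero_add n) = x := by
  refine exists_connecting k (p := e.codRestrict d.ker fun x => h.apply_apply_eq_zero x)
    e.ker.injective_subtype ?_ ?_ Y n
  · intro x
    have : x ∈ Set.range e.ker.subtype ↔ e x = 0 := by
      rw [← LinearMap.mem_ker]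
      exact ⟨fun ⟨y, hy⟩ => hy ▸ y.2, fun hx => ⟨⟨x, hx⟩, rfl⟩⟩
    rw [this, ← Subtype.coe_inj]
    rfl
  · rintro ⟨x, hx⟩
    obtain ⟨z, hz⟩ := (h x).1 hx
    exact ⟨z, Subtype.ext hz⟩

variable (k) in
lemma exists_connecting_ker_injective [Module.Projective A G] {e : G →ₗ[A] F} {d : F →ₗ[A] H}
    (h : Function.Exact e d) (Y : ModuleCat.{u} A) (n : ℕ) :
    ∃ L : Abelian.Ext (ModuleCat.of A e.ker) Y (n + 1) →ₗ[k]
        Abelian.Ext (ModuleCat.of A d.ker) Y (n + 1 + 1), Function.Injective L := by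
  have : Projective (ModuleCat.of A G) := (IsProjective.iff_projective G).1 inferInstance
  obtain ⟨L, -, hL⟩ := exists_connecting_ker k h Y (n + 1)
  refine ⟨L, (injective_iff_map_eq_zero L).2 fun x hx => ?_⟩
  obtain ⟨y, rfl⟩ := (hL x).1 hx
  rw [y.eq_zero_of_projective, Abelian.Ext.comp_zero]

variable (k) in
lemma exists_connecting_injective [Module.Projective A F] {p : F →ₗ[A] X}
    (hp : Function.Surjective p) (Y : ModuleCat.{u} A) (n : ℕ) :
    ∃ L : Abelian.Ext (ModuleCat.of A p.ker) Y (n + 1) →ₗ[k]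
        Abelian.Ext (ModuleCat.of A X) Y (n + 1 + 1), Function.Injective L := by
  have : Projective (ModuleCat.of A F) := (IsProjective.iff_projective F).1 inferInstance
  obtain ⟨L, -, hL⟩ := exists_connecting k p.ker.injective_subtype
    (LinearMap.exact_subtype_ker_map p) hp Y (n + 1)
  refine ⟨L, (injective_iff_map_eq_zero L).2 fun x hx => ?_⟩
  obtain ⟨y, rfl⟩ := (hL x).1 hx
  rw [y.eq_zero_of_projective, Abelian.Ext.comp_zero]

/-- A map that vanishes on the kernel of a surjection `q` factors through `q`. -/
lemma exists_comp_eq_of_ker_le {q : G →ₗ[A] K} (hq : Function.Surjective q) {y : G →ₗ[A] X}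
    (h : q.ker ≤ y.ker) : ∃ f : K →ₗ[A] X, ∀ z, f (q z) = y z := by
  refine ⟨q.ker.liftQ y h ∘ₗ (q.quotKerEquivOfSurjective hq).symm.toLinearMap, fun z => ?_⟩
  have : (q.quotKerEquivOfSurjective hq).symm (q z) = q.ker.mkQ z := by
    rw [LinearEquiv.symm_apply_eq]
    rfl
  rw [LinearMap.comp_apply, LinearEquiv.coe_coe, this, Submodule.mkQ_apply, Submodule.liftQ_apply]

end Shifting

/-! ### Functionals on free right modules -/

section Functionals

variable {R : Type u} [Ring R]

/-- A ring is free of rank one as a right module over itself. -/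
def rightRegularEquiv : Rᵐᵒᵖ ≃ₗ[Rᵐᵒᵖ] R where
  toFun := unop
  invFun := op
  map_add' _ _ := rfl
  map_smul' _ _ := rfl
  left_inv _ := rfl
  right_inv _ := rfl

instance projective_columns (b : ℕ) : Module.Projective Rᵐᵒᵖ (Fin b → R) :=
  Module.Projective.of_equiv
    (LinearEquiv.piCongrRight fun _ : Fin b => rightRegularEquiv (R := R))

/-- The functional on columns given by a row. -/
def dotMap {b : ℕ} (x : Fin b → R) : (Fin b → R) →ₗ[Rᵐᵒᵖ] R where
  toFun z := x ⬝ᵥ z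
  map_add' := dotProduct_add x
  map_smul' a z := by
    simp only [dotProduct, Pi.smul_apply, RingHom.id_apply, MulOpposite.smul_eq_mul_unop,
      Finset.sum_mul, mul_assoc]

lemma dotMap_apply {b : ℕ} (x z : Fin b → R) : dotMap x z = ∑ i, x i * z i := rfl

lemma dotMap_single {b : ℕ} (x : Fin b → R) (i : Fin b) : dotMap x (Pi.single i 1) = x i := by
  rw [dotMap_apply, Finset.sum_eq_single i]
  · rw [Pi.single_eq_same, mul_one]
  · intro j _ h
    rw [Pi.single_eq_of_ne h, mul_zero]
  · exact fun h => (h (Finset.mem_univ i)).elim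

lemma exists_eq_dotMap {b : ℕ} (g : (Fin b → R) →ₗ[Rᵐᵒᵖ] R) : ∃ x, g = dotMap x := by
  refine ⟨fun i => g (Pi.single i 1), LinearMap.ext fun z => ?_⟩
  have hz : z = ∑ i, op (z i) • (Pi.single i 1 : Fin b → R) := by
    ext j
    rw [Finset.sum_apply, Finset.sum_eq_single j]
    · simp
    · intro i _ h
      simp [Pi.single_eq_of_ne h.symm]
    · exact fun h => (h (Finset.mem_univ j)).elim
  conv_lhs => rw [hz, map_sum]
  rw [dotMap_apply]
  exact Finset.sum_congr rfl fun i _ => by rw [map_smul]; rfl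

lemma dotMap_matrixMap {b c : ℕ} (x : Fin b → R) (d : Matrix (Fin b) (Fin c) R) (z : Fin c → R) :
    dotMap x (matrixMap d z) = dotMap (Matrix.vecMul x d) z :=
  Matrix.dotProduct_mulVec x d z

/-- If the classes of a sequence of cocycles `y n` span a finite-dimensional space, then a
nontrivial linear combination of them is a coboundary. -/
lemma exists_vecMul_eq_sum {k : Type u} [Field k] [Algebra k R] {b c m : ℕ}
    {H : Type u} [AddCommGroup H] [Module Rᵐᵒᵖ H] {d : Matrix (Fin b) (Fin c) R}
    {D : (Fin b → R) →ₗ[Rᵐᵒᵖ] H} (hex : Function.Exact (matrixMap d) D)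
    {X : ModuleCat.{u} Rᵐᵒᵖ}
    (L : Abelian.Ext (ModuleCat.of Rᵐᵒᵖ D.ker) (rightRegular R) 0 →ₗ[k]
      Abelian.Ext X (rightRegular R) m)
    (hL : ∀ x, L x = 0 → ∃ y : Abelian.Ext (ModuleCat.of Rᵐᵒᵖ (Fin b → R)) (rightRegular R) 0,
      (Abelian.Ext.mk₀ (ModuleCat.ofHom D.ker.subtype)).comp y (zero_add 0) = x)
    (y : ℕ → Fin c → R) (hcoc : ∀ n z, matrixMap d z = 0 → dotMap (y n) z = 0)
    (hfin : FiniteDimensional k (Abelian.Ext X (rightRegular R) m)) :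
    ∃ (s : Finset ℕ) (a : ℕ → k) (n : ℕ) (x : Fin b → R), n ∈ s ∧ a n ≠ 0 ∧
      ∀ l, Matrix.vecMul x d l = ∑ i ∈ s, a i • y i l := by
  obtain ⟨q, hqd⟩ : ∃ q : (Fin c → R) →ₗ[Rᵐᵒᵖ] D.ker, ∀ z, (q z : Fin b → R) = matrixMap d z :=
    ⟨(matrixMap d).codRestrict D.ker fun z => hex.apply_apply_eq_zero z, fun z => rfl⟩
  have hq : Function.Surjective q := by
    rintro ⟨x, hx⟩
    obtain ⟨z, hz⟩ := (hex x).1 hx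
    exact ⟨z, Subtype.ext ((hqd z).trans hz)⟩
  have hfac : ∀ n, ∃ f : D.ker →ₗ[Rᵐᵒᵖ] R, ∀ z, f (q z) = dotMap (y n) z := by
    intro n
    refine exists_comp_eq_of_ker_le (A := Rᵐᵒᵖ) (y := dotMap (y n)) hq fun z hz => ?_
    refine hcoc n z ?_
    rw [← hqd, LinearMap.mem_ker.1 hz]
    rfl
  choose f hf using hfac
  let φ : ℕ → (ModuleCat.of Rᵐᵒᵖ D.ker ⟶ rightRegular R) := fun n => ModuleCat.ofHom (f n)
  have hli : ¬ LinearIndependent k fun n => L (Abelian.Ext.mk₀ (φ n)) := fun h => by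
    have := h.finite
    exact not_finite ℕ
  rw [linearIndependent_iff'] at hli
  push Not at hli
  obtain ⟨s, a, h0, n, hn, ha⟩ := hli
  have h1 : L (Abelian.Ext.mk₀ (∑ i ∈ s, a i • φ i)) = 0 := by
    have e : Abelian.Ext.mk₀ (∑ i ∈ s, a i • φ i) =
        ∑ i ∈ s, a i • Abelian.Ext.mk₀ (φ i) := by
      have := map_sum (Abelian.Ext.linearEquiv₀ (R := k)).symm (fun i => a i • φ i) s
      simp only [map_smul, Abelian.Ext.linearEquiv₀_symm_apply] at this
      exact this
    rw [e, map_sum, ← h0]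
    exact Finset.sum_congr rfl fun i _ => map_smul L _ _
  obtain ⟨g', hg'⟩ := hL _ h1
  obtain ⟨g, rfl⟩ := (Abelian.Ext.mk₀_bijective _ _).2 g'
  rw [Abelian.Ext.mk₀_comp_mk₀] at hg'
  have hg := (Abelian.Ext.mk₀_bijective _ _).1 hg'
  obtain ⟨x, hx⟩ := exists_eq_dotMap g.hom
  refine ⟨s, a, n, x, hn, ha, fun l => ?_⟩
  have h2 : dotMap x (matrixMap d (Pi.single l 1)) =
      (∑ i ∈ s, a i • φ i).hom (q (Pi.single l 1)) := by
    rw [← hg, ← hqd, ← hx]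
    rfl
  have h3 : ∀ i, (a i • φ i).hom (q (Pi.single l 1)) = a i • y i l := by
    intro i
    have : (a i • φ i).hom (q (Pi.single l 1)) =
        op (algebraMap k R (a i)) • f i (q (Pi.single l 1)) := rfl
    rw [this, hf, dotMap_single, Algebra.smul_def, Algebra.commutes]
    rfl
  rw [dotMap_matrixMap, dotMap_single, ModuleCat.hom_sum, LinearMap.sum_apply] at h2
  rw [h2]
  exact Finset.sum_congr rfl fun i _ => h3 i

end Functionals

section Resolution

variable {k : Type u} [Field k] {R : Type u} [Ring R] [Algebra k R]
  {X : Type u} [AddCommGroup X] [Module Rᵐᵒᵖ X] {b₀ b₁ b₂ b₃ b₄ : ℕ}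
  {p : (Fin b₀ → R) →ₗ[Rᵐᵒᵖ] X} {d₁ : Matrix (Fin b₀) (Fin b₁) R}
  {d₂ : Matrix (Fin b₁) (Fin b₂) R} {d₃ : Matrix (Fin b₂) (Fin b₃) R}
  {d₄ : Matrix (Fin b₃) (Fin b₄) R}

/-- If `Ext^2(X, R)` is finite-dimensional, then any infinite sequence of cocycles has a nontrivial
linear combination that is a coboundary. -/
lemma exists_vecMul_eq_sum_two (hp : Function.Surjective p)
    (h₀ : Function.Exact (matrixMap d₁) p) (h₁ : Function.Exact (matrixMap d₂) (matrixMap d₁))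
    (hfin : FiniteDimensional k (Abelian.Ext (ModuleCat.of Rᵐᵒᵖ X) (rightRegular R) 2))
    (y : ℕ → Fin b₂ → R) (hcoc : ∀ n z, matrixMap d₂ z = 0 → dotMap (y n) z = 0) :
    ∃ (s : Finset ℕ) (a : ℕ → k) (n : ℕ) (x : Fin b₁ → R), n ∈ s ∧ a n ≠ 0 ∧
      ∀ l, Matrix.vecMul x d₂ l = ∑ i ∈ s, a i • y i l := by
  obtain ⟨L₁, hL₁⟩ := exists_connecting_injective k hp (rightRegular R) 0
  obtain ⟨L₂, -, hL₂⟩ := exists_connecting_ker k h₀ (rightRegular R) 0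
  exact exists_vecMul_eq_sum h₁ (L₁ ∘ₗ L₂)
    (fun x hx => (hL₂ x).1 ((map_eq_zero_iff L₁ hL₁).1 hx)) y hcoc hfin

lemma exists_vecMul_eq_sum_three (hp : Function.Surjective p)
    (h₀ : Function.Exact (matrixMap d₁) p) (h₁ : Function.Exact (matrixMap d₂) (matrixMap d₁))
    (h₂ : Function.Exact (matrixMap d₃) (matrixMap d₂))
    (hfin : FiniteDimensional k (Abelian.Ext (ModuleCat.of Rᵐᵒᵖ X) (rightRegular R) 3))
    (y : ℕ → Fin b₃ → R) (hcoc : ∀ n z, matrixMap d₃ z = 0 → dotMap (y n) z = 0) :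
    ∃ (s : Finset ℕ) (a : ℕ → k) (n : ℕ) (x : Fin b₂ → R), n ∈ s ∧ a n ≠ 0 ∧
      ∀ l, Matrix.vecMul x d₃ l = ∑ i ∈ s, a i • y i l := by
  obtain ⟨L₁, hL₁⟩ := exists_connecting_injective k hp (rightRegular R) 1
  obtain ⟨L₂, hL₂⟩ := exists_connecting_ker_injective k h₀ (rightRegular R) 0
  obtain ⟨L₃, -, hL₃⟩ := exists_connecting_ker k h₁ (rightRegular R) 0
  exact exists_vecMul_eq_sum h₂ (L₁ ∘ₗ L₂ ∘ₗ L₃) (fun x hx => (hL₃ x).1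
    ((map_eq_zero_iff L₂ hL₂).1 ((map_eq_zero_iff L₁ hL₁).1 hx))) y hcoc hfin

lemma exists_vecMul_eq_sum_four (hp : Function.Surjective p)
    (h₀ : Function.Exact (matrixMap d₁) p) (h₁ : Function.Exact (matrixMap d₂) (matrixMap d₁))
    (h₂ : Function.Exact (matrixMap d₃) (matrixMap d₂))
    (h₃ : Function.Exact (matrixMap d₄) (matrixMap d₃))
    (hfin : FiniteDimensional k (Abelian.Ext (ModuleCat.of Rᵐᵒᵖ X) (rightRegular R) 4))
    (y : ℕ → Fin b₄ → R) (hcoc : ∀ n z, matrixMap d₄ z = 0 → dotMap (y n) z = 0) :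
    ∃ (s : Finset ℕ) (a : ℕ → k) (n : ℕ) (x : Fin b₃ → R), n ∈ s ∧ a n ≠ 0 ∧
      ∀ l, Matrix.vecMul x d₄ l = ∑ i ∈ s, a i • y i l := by
  obtain ⟨L₁, hL₁⟩ := exists_connecting_injective k hp (rightRegular R) 2
  obtain ⟨L₂, hL₂⟩ := exists_connecting_ker_injective k h₀ (rightRegular R) 1
  obtain ⟨L₃, hL₃⟩ := exists_connecting_ker_injective k h₁ (rightRegular R) 0
  obtain ⟨L₄, -, hL₄⟩ := exists_connecting_ker k h₂ (rightRegular R) 0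
  exact exists_vecMul_eq_sum h₃ (L₁ ∘ₗ L₂ ∘ₗ L₃ ∘ₗ L₄) (fun x hx => (hL₄ x).1
    ((map_eq_zero_iff L₃ hL₃).1 ((map_eq_zero_iff L₂ hL₂).1
      ((map_eq_zero_iff L₁ hL₁).1 hx)))) y hcoc hfin

/-- `Ext^1(X, R)` vanishes if every row killed by `d₂` is a multiple of the row `d₁`. -/
lemma subsingleton_ext_one (k : Type u) [Field k] [Algebra k R]
    {d₁ : Matrix (Fin 1) (Fin b₁) R} {p : (Fin 1 → R) →ₗ[Rᵐᵒᵖ] X} (hp : Function.Surjective p)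
    (h₀ : Function.Exact (matrixMap d₁) p) (h₁ : Function.Exact (matrixMap d₂) (matrixMap d₁))
    (h : ∀ x : Fin b₁ → R, Matrix.vecMul x d₂ = 0 → ∃ r, ∀ j, x j = r * d₁ 0 j) :
    Subsingleton (Abelian.Ext (ModuleCat.of Rᵐᵒᵖ X) (rightRegular R) 1) := by
  obtain ⟨L, hs, hL⟩ := exists_connecting k p.ker.injective_subtype
    (LinearMap.exact_subtype_ker_map p) hp (rightRegular R) 0
  refine subsingleton_of_forall_eq 0 fun x => ?_
  obtain ⟨x, rfl⟩ := hs x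
  obtain ⟨f, rfl⟩ := (Abelian.Ext.mk₀_bijective _ _).2 x
  rw [hL]
  obtain ⟨q, hqd⟩ : ∃ q : (Fin b₁ → R) →ₗ[Rᵐᵒᵖ] p.ker, ∀ z, (q z : Fin 1 → R) = matrixMap d₁ z :=
    ⟨(matrixMap d₁).codRestrict p.ker fun z => h₀.apply_apply_eq_zero z, fun z => rfl⟩
  obtain ⟨x, hx⟩ := exists_eq_dotMap (f.hom ∘ₗ q)
  have hx' : ∀ z, f.hom (q z) = dotMap x z := fun z => LinearMap.congr_fun hx z
  obtain ⟨r, hr⟩ := h x <| by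
    ext1 l
    rw [← dotMap_single (Matrix.vecMul x d₂) l, ← dotMap_matrixMap, ← hx']
    have : q (matrixMap d₂ (Pi.single l 1)) = 0 :=
      Subtype.ext ((hqd _).trans (h₁.apply_apply_eq_zero _))
    rw [this, map_zero]
    rfl
  let g : ModuleCat.of Rᵐᵒᵖ (Fin 1 → R) ⟶ rightRegular R := ModuleCat.ofHom (dotMap fun _ => r)
  refine ⟨Abelian.Ext.mk₀ g, ?_⟩
  rw [Abelian.Ext.mk₀_comp_mk₀]
  congr 1
  ext w
  obtain ⟨z, hz⟩ := (h₀ w.1).1 w.2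
  obtain rfl : q z = w := Subtype.ext ((hqd z).trans hz)
  refine Eq.trans ?_ (hx' z).symm
  refine (congrArg (dotMap fun _ => r) (hqd z)).trans ?_
  rw [dotMap_matrixMap]
  congr 2
  ext1 j
  rw [hr, Matrix.vecMul, dotProduct, Fin.sum_univ_one]

end Resolution

/-! ### The spaces `Ext^i_R(k, R)` -/

lemma vecMul_shapeN_zero {X : Type u} [Ring X] (x : Fin 6 → X) (z : Fin 10 → X) :
    Matrix.vecMul x (shapeN z) 0 = x 0 * z 8 + x 1 * z 9 := by
  simp [Matrix.vecMul, dotProduct, Fin.sum_univ_succ, shapeN]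

lemma vecMul_shapeM_zero {X : Type u} [Ring X] (x : Fin 4 → X) (z : Fin 10 → X) :
    Matrix.vecMul x (shapeM z) 0 = x 2 * z 8 + x 3 * z 9 := by
  simp [Matrix.vecMul, dotProduct, Fin.sum_univ_four, shapeM]

lemma shapeQ_zero {X : Type u} (r : Fin 4 → X) (j : Fin 4) : shapeQ r 0 j = r j := by
  fin_cases j <;> rfl

lemma matrixMap_shapeM_zero {X : Type u} [Ring X] (z : Fin 10 → X) (w : Fin 1 → X) :
    matrixMap (shapeM z) w 0 = 0 := by
  have h : matrixMap (shapeM z) w 0 = Matrix.mulVec (shapeM z) w 0 := rfl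
  rw [h]
  simp [Matrix.mulVec, dotProduct, shapeM]

section ExtOfR

variable {k : Type u} [Field k] [NeZero (2 : k)] {ρ θ : kˣ}

lemma projR_of_mem {n : ℕ} {x : algebraR ρ θ} (hx : x ∈ gradingR ρ θ n) :
    projR ρ θ n x = x := by
  refine ext_coeffR fun m => ?_
  by_cases h : (n : ℤ) = m
  · rw [← h, coeffR_projR_same]
  · rw [coeffR_projR_of_ne h, coeffR_of_mem_of_ne hx h]

lemma projR_of_mem_of_ne {m n : ℕ} (h : m ≠ n) {x : algebraR ρ θ} (hx : x ∈ gradingR ρ θ n) :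
    projR ρ θ m x = 0 := by
  refine ext_coeffR fun l => ?_
  rw [map_zero]
  by_cases hl : (m : ℤ) = l
  · subst hl
    rw [coeffR_projR_same, coeffR_of_mem_of_ne hx (by exact_mod_cast h.symm)]
  · exact coeffR_projR_of_ne hl x

lemma vecMul_projR {b c : ℕ} {d : Matrix (Fin b) (Fin c) (algebraR ρ θ)}
    (hd : ∀ i j, d i j ∈ gradingR ρ θ 1) (x : Fin b → algebraR ρ θ) (n : ℕ) (l : Fin c) :
    Matrix.vecMul (fun i => projR ρ θ n (x i)) d l = projR ρ θ (n + 1) (Matrix.vecMul x d l) := by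
  refine ext_coeffR_nat fun e => ?_
  rcases e with _ | e
  · rw [coeffR_projR_of_ne (by push_cast; omega), Matrix.vecMul, dotProduct, map_sum]
    refine Finset.sum_eq_zero fun i _ => ?_
    rw [coeffR_mul_right (hd i l), coeffR_of_neg (by norm_num), zero_mul]
  · rw [coeffR_vecMul hd]
    by_cases h : n = e
    · subst h
      rw [coeffR_projR_same, coeffR_vecMul hd]
      simp only [coeffR_projR_same]
    · rw [coeffR_projR_of_ne (by push_cast; omega)]
      have : (fun i => coeffR ρ θ e (projR ρ θ n (x i))) = 0 :=
        funext fun i => coeffR_projR_of_ne (by exact_mod_cast h) _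
      rw [this, map_zero, Pi.zero_apply]

/-- A nontrivial combination of homogeneous rows of distinct positive degrees, none of which is a
combination of the rows of a matrix with entries of degree one, is not such a combination. -/
lemma not_exists_vecMul_eq_sum {b c : ℕ} {d : Matrix (Fin b) (Fin c) (algebraR ρ θ)}
    (hd : ∀ i j, d i j ∈ gradingR ρ θ 1) {y : ℕ → Fin c → algebraR ρ θ}
    (hy : ∀ n j, y n j ∈ gradingR ρ θ (n + 1)) (hcob : ∀ n x, Matrix.vecMul x d ≠ y n) :
    ¬ ∃ (s : Finset ℕ) (a : ℕ → k) (n : ℕ) (x : Fin b → algebraR ρ θ), n ∈ s ∧ a n ≠ 0 ∧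
      ∀ l, Matrix.vecMul x d l = ∑ i ∈ s, a i • y i l := by
  rintro ⟨s, a, n, x, hn, ha, hx⟩
  refine hcob n ((a n)⁻¹ • fun i => projR ρ θ n (x i)) ?_
  ext1 l
  have h1 : Matrix.vecMul (fun i => projR ρ θ n (x i)) d l = a n • y n l := by
    rw [vecMul_projR hd, hx, map_sum, Finset.sum_eq_single n]
    · rw [map_smul, projR_of_mem (hy n l)]
    · intro i _ hi
      rw [map_smul, projR_of_mem_of_ne (by omega) (hy i l), smul_zero]
    · exact fun h => (h hn).elim
  rw [Matrix.smul_vecMul, Pi.smul_apply, h1, smul_smul, inv_mul_cancel₀ ha, one_smul]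

/-- The cocycles of `exists_ne_vecMul_matrixP` in distinct degrees are independent modulo
coboundaries. -/
lemma not_finiteDimensional_ext_two (hr : ∀ n, RanksAtLeast n ρ θ) :
    ¬ FiniteDimensional k (ExtTrivial (gradingR ρ θ) (rightRegular (algebraR ρ θ)) 2) := by
  obtain ⟨-, -, -, hPQ, hQ, hA⟩ := koszulComplexExact hr
  choose y hy hyN hyP using exists_ne_vecMul_matrixP ρ θ
  intro hfin
  refine not_exists_vecMul_eq_sum matrixP_mem hy (fun n => hyP n)
    (exists_vecMul_eq_sum_two hA hQ hPQ hfin y fun n z hz => ?_)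
  obtain ⟨w, rfl⟩ := (exact_NP hr z).1 hz
  rw [dotMap_matrixMap, hyN, dotMap_apply]
  exact Finset.sum_eq_zero fun i _ => zero_mul _

/-- For `f` outside the left ideal generated by `z₉` and `z₁₀`, the row `(f, 0, 0, 0)` is a cocycle
that is not a coboundary. -/
lemma not_finiteDimensional_ext_three (hr : ∀ n, RanksAtLeast n ρ θ) :
    ¬ FiniteDimensional k (ExtTrivial (gradingR ρ θ) (rightRegular (algebraR ρ θ)) 3) := by
  obtain ⟨-, -, hNP, hPQ, hQ, hA⟩ := koszulComplexExact hr
  choose f hf hne using exists_ne_mul_elementZ ρ θ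
  intro hfin
  refine not_exists_vecMul_eq_sum (matrixN_mem (ρ := ρ) (θ := θ)) (y := fun n => ![f n, 0, 0, 0])
    (fun n j => ?_) (fun n x hx => hne n (x 0) (x 1) ?_)
    (exists_vecMul_eq_sum_three hA hQ hPQ hNP hfin _ fun n z hz => ?_)
  · fin_cases j
    exacts [hf n, zero_mem _, zero_mem _, zero_mem _]
  · have h0 := congrFun hx 0
    rw [matrixN_eq, vecMul_shapeN_zero] at h0
    exact h0.symm
  · obtain ⟨w, rfl⟩ := (exact_MN hr z).1 hz
    rw [dotMap_apply, Fin.sum_univ_four, matrixM_eq, matrixMap_shapeM_zero]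
    simp

/-- In the last place all rows are cocycles, and the coboundaries form the left ideal generated by
`z₉` and `z₁₀`. -/
lemma not_finiteDimensional_ext_four (hr : ∀ n, RanksAtLeast n ρ θ) :
    ¬ FiniteDimensional k (ExtTrivial (gradingR ρ θ) (rightRegular (algebraR ρ θ)) 4) := by
  obtain ⟨hM, hMN, hNP, hPQ, hQ, hA⟩ := koszulComplexExact hr
  choose f hf hne using exists_ne_mul_elementZ ρ θ
  intro hfin
  refine not_exists_vecMul_eq_sum (matrixM_mem (ρ := ρ) (θ := θ)) (y := fun n _ => f n)
    (fun n _ => hf n) (fun n x hx => hne n (x 2) (x 3) ?_)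
    (exists_vecMul_eq_sum_four hA hQ hPQ hNP hMN hfin _ fun n z hz => ?_)
  · have h0 := congrFun hx 0
    rw [matrixM_eq, vecMul_shapeM_zero] at h0
    exact h0.symm
  · rw [hM (hz.trans (map_zero _).symm), map_zero]

lemma subsingleton_extTrivial_one (hr : ∀ n, RanksAtLeast n ρ θ) :
    Subsingleton (ExtTrivial (gradingR ρ θ) (rightRegular (algebraR ρ θ)) 1) := by
  obtain ⟨-, -, -, hPQ, hQ, hA⟩ := koszulComplexExact hr
  refine subsingleton_ext_one k hA hQ hPQ fun x hx => ?_
  obtain ⟨r, hr⟩ := exists_eq_mul_generatorR hr hx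
  refine ⟨r, fun j => (hr j).trans ?_⟩
  rw [matrixQ_eq, shapeQ_zero]

lemma eq_zero_of_mul_generatorR {a : algebraR ρ θ} (h : a * generatorR ρ θ 0 = 0) : a = 0 := by
  refine ext_coeffR fun n => ?_
  have h1 := congrArg (coeffR ρ θ (n + 1)) h
  rw [coeffR_mul_right (generatorR_mem 0), coeffR_generatorR, add_sub_cancel_right, map_zero] at h1
  simpa [coordE] using h1

/-- There are no nonzero maps from the trivial module to `R`, since right multiplication by `t` is
injective on `R`. -/
lemma subsingleton_extTrivial_zero :
    Subsingleton (ExtTrivial (gradingR ρ θ) (rightRegular (algebraR ρ θ)) 0) := by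
  have h : ∀ f : (algebraR ρ θ ⧸ augmentationIdeal (gradingR ρ θ)) →ₗ[(algebraR ρ θ)ᵐᵒᵖ]
      algebraR ρ θ, f = 0 := by
    intro f
    ext1
    ext1
    refine eq_zero_of_mul_generatorR ?_
    have h1 := map_smul (f ∘ₗ (augmentationIdeal (gradingR ρ θ)).mkQ) (op (generatorR ρ θ 0)) 1
    have h2 : (augmentationIdeal (gradingR ρ θ)).mkQ (op (generatorR ρ θ 0) • 1) = 0 := by
      rw [Submodule.mkQ_apply, Submodule.Quotient.mk_eq_zero]
      have h3 : op (generatorR ρ θ 0) • (1 : algebraR ρ θ) = generatorR ρ θ 0 := one_mul _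
      rw [h3]
      exact Submodule.subset_span ⟨1, le_rfl, generatorR_mem 0⟩
    rw [LinearMap.comp_apply, h2, map_zero] at h1
    exact h1.symm
  refine (Abelian.Ext.homEquiv₀ (X := trivialModule (gradingR ρ θ))
    (Y := rightRegular (algebraR ρ θ))).subsingleton_congr.2
      (subsingleton_of_forall_eq 0 fun f => ?_)
  exact ModuleCat.hom_ext (h f.hom)

end ExtOfR

/-! ### Resolutions of arbitrary modules from bimodule complexes -/

section TensorComplex

open scoped TensorProduct

variable {k : Type u} [Field k] {R : Type u} [Ring R] [Algebra k R] {M : Type u} [AddCommGroup M]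
  [Module k M] [Module Rᵐᵒᵖ M] [IsScalarTower k Rᵐᵒᵖ M] {a b c : ℕ}

/-- The elementary map `z ↦ (0, …, z j, …, 0)` with the entry at the place `i`. -/
def coordMap (R : Type u) [Ring R] {b c : ℕ} (i : Fin b) (j : Fin c) :
    (Fin c → R) →ₗ[Rᵐᵒᵖ] (Fin b → R) :=
  LinearMap.single Rᵐᵒᵖ (fun _ => R) i ∘ₗ LinearMap.proj j

variable (k M) in
/-- A matrix acting on `R ^ c ⊗ M` through the first factor. -/
def leftMap (d : Matrix (Fin b) (Fin c) R) :
    (Fin c → R) ⊗[k] M →ₗ[Rᵐᵒᵖ] (Fin b → R) ⊗[k] M :=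
  TensorProduct.AlgebraTensorModule.map (matrixMap d) LinearMap.id

variable (k M) in
/-- A matrix acting on `R ^ c ⊗ M` through the right action of its entries on `M`. -/
def actionMap (e : Matrix (Fin b) (Fin c) R) :
    (Fin c → R) ⊗[k] M →ₗ[Rᵐᵒᵖ] (Fin b → R) ⊗[k] M :=
  ∑ i, ∑ j, TensorProduct.AlgebraTensorModule.map (coordMap R i j)
    (Algebra.lsmul k k M (op (e i j)))

variable (k M) in
/-- The differential `d ⊗ 1 + 1 ⊗ e`: it is obtained from a map `R ⊗ k ^ c ⊗ R → R ⊗ k ^ b ⊗ R` of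
bimodules by tensoring with `M`. -/
def mixedMap (d e : Matrix (Fin b) (Fin c) R) :
    (Fin c → R) ⊗[k] M →ₗ[Rᵐᵒᵖ] (Fin b → R) ⊗[k] M :=
  leftMap k M d + actionMap k M e

omit [Module Rᵐᵒᵖ M] [IsScalarTower k Rᵐᵒᵖ M] in
lemma leftMap_tmul (d : Matrix (Fin b) (Fin c) R) (z : Fin c → R) (m : M) :
    leftMap k M d (z ⊗ₜ m) = matrixMap d z ⊗ₜ m := rfl

lemma actionMap_tmul (e : Matrix (Fin b) (Fin c) R) (z : Fin c → R) (m : M) :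
    actionMap k M e (z ⊗ₜ m) = ∑ i, ∑ j, Pi.single i (z j) ⊗ₜ[k] (op (e i j) • m) := by
  simp only [actionMap, LinearMap.sum_apply]
  rfl

lemma mixedMap_apply (d e : Matrix (Fin b) (Fin c) R) (x : (Fin c → R) ⊗[k] M) :
    mixedMap k M d e x = leftMap k M d x + actionMap k M e x := rfl

omit [IsScalarTower k Rᵐᵒᵖ M] in
lemma smul_op_smul (r s : R) (m : M) : op r • op s • m = op (s * r) • m := by
  rw [smul_smul]
  rfl

lemma actionMap_single (e : Matrix (Fin b) (Fin c) R) (j : Fin c) (r : R) (m : M) :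
    actionMap k M e (Pi.single j r ⊗ₜ m) = ∑ i, Pi.single i r ⊗ₜ[k] (op (e i j) • m) := by
  rw [actionMap_tmul]
  refine Finset.sum_congr rfl fun i _ => ?_
  rw [Finset.sum_eq_single j]
  · rw [Pi.single_eq_same]
  · intro l _ h
    rw [Pi.single_eq_of_ne h, Pi.single_zero, TensorProduct.zero_tmul]
  · exact fun h => (h (Finset.mem_univ j)).elim

omit [Module Rᵐᵒᵖ M] [IsScalarTower k Rᵐᵒᵖ M] in
lemma leftMap_single (d : Matrix (Fin b) (Fin c) R) (j : Fin c) (r : R) (m : M) :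
    leftMap k M d (Pi.single j r ⊗ₜ m) = ∑ i, Pi.single i (d i j * r) ⊗ₜ[k] m := by
  rw [leftMap_tmul, ← TensorProduct.sum_tmul]
  congr 1
  rw [Finset.univ_sum_single]
  exact Matrix.mulVec_single d j r

/-- The composite of two differentials vanishes when both matrix products vanish and the mixed
terms cancel in `R ⊗ R`. -/
lemma mixedMap_mixedMap {d e : Matrix (Fin a) (Fin b) R} {d' e' : Matrix (Fin b) (Fin c) R}
    (hd : d * d' = 0) (he : ∀ i j, ∑ l, e' l j * e i l = 0)
    (h : ∀ i j, ∑ l, (d i l ⊗ₜ[k] e' l j + d' l j ⊗ₜ[k] e i l) = 0)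
    (x : (Fin c → R) ⊗[k] M) : mixedMap k M d e (mixedMap k M d' e' x) = 0 := by
  induction x using TensorProduct.induction_on with
  | zero => simp
  | add x y hx hy => rw [map_add, map_add, hx, hy, add_zero]
  | tmul z m =>
    simp only [mixedMap_apply, map_add]
    have h1 : leftMap k M d (leftMap k M d' (z ⊗ₜ m)) = 0 := by
      have : matrixMap d (matrixMap d' z) = matrixMap (d * d') z := Matrix.mulVec_mulVec z d d'
      rw [leftMap_tmul, leftMap_tmul, this, hd]
      exact (congrArg (· ⊗ₜ m) (Matrix.zero_mulVec z)).trans (TensorProduct.zero_tmul _ _)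
    have h2 : actionMap k M e (actionMap k M e' (z ⊗ₜ m)) = 0 := by
      simp only [actionMap_tmul e', map_sum, actionMap_single, smul_op_smul]
      rw [Finset.sum_comm]
      refine Finset.sum_eq_zero fun j _ => ?_
      rw [Finset.sum_comm]
      refine Finset.sum_eq_zero fun i _ => ?_
      rw [← TensorProduct.tmul_sum, ← Finset.sum_smul, ← Finset.op_sum, he, op_zero, zero_smul,
        TensorProduct.tmul_zero]
    have h3 : leftMap k M d (actionMap k M e' (z ⊗ₜ m)) +
        actionMap k M e (leftMap k M d' (z ⊗ₜ m)) = 0 := by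
      have h4 : ∀ i j, ∑ l, (Pi.single i (d i l * z j) ⊗ₜ[k] (op (e' l j) • m) +
          (Pi.single i (d' l j * z j) : Fin a → R) ⊗ₜ[k] (op (e i l) • m)) = 0 := by
        intro i j
        have := congrArg (TensorProduct.map
          (LinearMap.single k (fun _ : Fin a => R) i ∘ₗ LinearMap.mulRight k (z j))
          ((LinearMap.toSpanSingleton Rᵐᵒᵖ M m).restrictScalars k ∘ₗ
            (opLinearEquiv k : R ≃ₗ[k] Rᵐᵒᵖ).toLinearMap)) (h i j)
        simp only [map_sum, map_add, TensorProduct.map_tmul, map_zero] at this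
        exact this
      have h5 : leftMap k M d (actionMap k M e' (z ⊗ₜ m)) =
          ∑ i, ∑ j, ∑ l, Pi.single i (d i l * z j) ⊗ₜ[k] (op (e' l j) • m) := by
        simp only [actionMap_tmul e', map_sum, leftMap_single]
        rw [Finset.sum_comm]
        simp only [Finset.sum_comm (s := (Finset.univ : Finset (Fin b)))]
        rw [Finset.sum_comm]
      have h6 : actionMap k M e (leftMap k M d' (z ⊗ₜ m)) =
          ∑ i, ∑ j, ∑ l, (Pi.single i (d' l j * z j) : Fin a → R) ⊗ₜ[k] (op (e i l) • m) := by
        rw [leftMap_tmul, actionMap_tmul]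
        refine Finset.sum_congr rfl fun i _ => ?_
        rw [Finset.sum_comm]
        refine Finset.sum_congr rfl fun l _ => ?_
        rw [← TensorProduct.sum_tmul]
        congr 1
        exact map_sum (LinearMap.single Rᵐᵒᵖ (fun _ : Fin a => R) i) (fun j => d' l j * z j)
          Finset.univ
      rw [h5, h6]
      simp only [← Finset.sum_add_distrib]
      exact Finset.sum_eq_zero fun i _ => Finset.sum_eq_zero fun j _ => h4 i j
    rw [h1, h2, zero_add, add_zero]
    rwa [add_comm] at h3

/-- Left multiplication by `r` raises degrees by one, where `π n` is the projection to the elements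
of degree `n`. -/
def RaisesDegree (π : ℕ → R →ₗ[k] R) (r : R) : Prop :=
  (∀ n x, π (n + 1) (r * x) = r * π n x) ∧ ∀ x, π 0 (r * x) = 0

variable (M) in
/-- The projection of `R ^ b ⊗ M` to its part of degree `n`. -/
def projTensor (π : ℕ → R →ₗ[k] R) (b n : ℕ) : (Fin b → R) ⊗[k] M →ₗ[k] (Fin b → R) ⊗[k] M :=
  ((π n).compLeft (Fin b)).rTensor M

variable {π : ℕ → R →ₗ[k] R}

omit [Module Rᵐᵒᵖ M] [IsScalarTower k Rᵐᵒᵖ M] in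
lemma projTensor_projTensor (h : ∀ m n x, π m (π n x) = if m = n then π n x else 0) (m n : ℕ)
    (x : (Fin b → R) ⊗[k] M) :
    projTensor M π b m (projTensor M π b n x) = if m = n then projTensor M π b n x else 0 := by
  induction x using TensorProduct.induction_on with
  | zero => simp
  | add x y hx hy =>
    simp only [map_add, hx, hy]
    split_ifs
    · rfl
    · rw [add_zero]
  | tmul z w =>
    have h1 : projTensor M π b m (projTensor M π b n (z ⊗ₜ w)) =
      (fun i => π m (π n (z i))) ⊗ₜ w := rfl
    simp only [h1, h]
    split_ifs
    · rfl
    · exact TensorProduct.zero_tmul _ _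

omit [Module Rᵐᵒᵖ M] [IsScalarTower k Rᵐᵒᵖ M] in
lemma exists_sum_projTensor (h : ∀ x, ∃ N, ∀ n, N ≤ n → ∑ m ∈ Finset.range n, π m x = x)
    (x : (Fin b → R) ⊗[k] M) :
    ∃ N, ∀ n, N ≤ n → ∑ m ∈ Finset.range n, projTensor M π b m x = x := by
  induction x using TensorProduct.induction_on with
  | zero => exact ⟨0, fun n _ => by simp⟩
  | add x y hx hy =>
    obtain ⟨N, hN⟩ := hx
    obtain ⟨N', hN'⟩ := hy
    refine ⟨max N N', fun n hn => ?_⟩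
    simp only [map_add, Finset.sum_add_distrib]
    rw [hN n (le_of_max_le_left hn), hN' n (le_of_max_le_right hn)]
  | tmul z m =>
    choose N hN using h
    refine ⟨Finset.univ.sup fun i => N (z i), fun n hn => ?_⟩
    have h1 : ∀ l, projTensor M π b l (z ⊗ₜ m) = (fun i => π l (z i)) ⊗ₜ m := fun l => rfl
    simp only [h1]
    rw [← TensorProduct.sum_tmul]
    congr 1
    ext i
    rw [Finset.sum_apply]
    exact hN (z i) n (le_trans (Finset.le_sup (f := fun i => N (z i)) (Finset.mem_univ i)) hn)

omit [Module Rᵐᵒᵖ M] [IsScalarTower k Rᵐᵒᵖ M] in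
lemma exists_projTensor_eq_zero (h : ∀ x, ∃ N, ∀ n, N ≤ n → ∑ m ∈ Finset.range n, π m x = x)
    (x : (Fin b → R) ⊗[k] M) : ∃ N, ∀ n, N ≤ n → projTensor M π b n x = 0 := by
  obtain ⟨N, hN⟩ := exists_sum_projTensor h x
  refine ⟨N, fun n hn => ?_⟩
  have := hN (n + 1) (by omega)
  rwa [Finset.sum_range_succ, hN n hn, add_eq_left] at this

omit [Module Rᵐᵒᵖ M] [IsScalarTower k Rᵐᵒᵖ M] in
lemma projTensor_succ_leftMap {d : Matrix (Fin b) (Fin c) R} (hd : ∀ i j, RaisesDegree π (d i j))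
    (n : ℕ) (x : (Fin c → R) ⊗[k] M) :
    projTensor M π b (n + 1) (leftMap k M d x) = leftMap k M d (projTensor M π c n x) := by
  induction x using TensorProduct.induction_on with
  | zero => simp
  | add x y hx hy => simp only [map_add, hx, hy]
  | tmul z m =>
    have h : (fun i => π (n + 1) (matrixMap d z i)) = matrixMap d fun j => π n (z j) := by
      ext1 i
      have h1 : ∀ z, matrixMap d z i = ∑ j, d i j * z j := fun z => rfl
      rw [h1, h1, map_sum]
      exact Finset.sum_congr rfl fun j _ => (hd i j).1 n _
    exact congrArg (· ⊗ₜ m) h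

omit [Module Rᵐᵒᵖ M] [IsScalarTower k Rᵐᵒᵖ M] in
lemma projTensor_zero_leftMap {d : Matrix (Fin b) (Fin c) R} (hd : ∀ i j, RaisesDegree π (d i j))
    (x : (Fin c → R) ⊗[k] M) : projTensor M π b 0 (leftMap k M d x) = 0 := by
  induction x using TensorProduct.induction_on with
  | zero => simp
  | add x y hx hy => simp only [map_add, hx, hy, add_zero]
  | tmul z m =>
    have h : (fun i => π 0 (matrixMap d z i)) = 0 := by
      ext1 i
      have h1 : ∀ z, matrixMap d z i = ∑ j, d i j * z j := fun z => rfl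
      rw [h1, map_sum]
      exact Finset.sum_eq_zero fun j _ => (hd i j).2 _
    exact (congrArg (· ⊗ₜ m) h).trans (TensorProduct.zero_tmul _ _)

lemma projTensor_actionMap (e : Matrix (Fin b) (Fin c) R) (n : ℕ) (x : (Fin c → R) ⊗[k] M) :
    projTensor M π b n (actionMap k M e x) = actionMap k M e (projTensor M π c n x) := by
  induction x using TensorProduct.induction_on with
  | zero => simp
  | add x y hx hy => simp only [map_add, hx, hy]
  | tmul z m =>
    have h0 : ∀ (b : ℕ) (z : Fin b → R) (m : M), projTensor M π b n (z ⊗ₜ m) =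
      (fun i => π n (z i)) ⊗ₜ m := fun b z m => rfl
    simp only [actionMap_tmul, map_sum, h0]
    refine Finset.sum_congr rfl fun i _ => Finset.sum_congr rfl fun j _ => ?_
    congr 1
    ext1 l
    rcases eq_or_ne l i with rfl | h
    · rw [Pi.single_eq_same, Pi.single_eq_same]
    · rw [Pi.single_eq_of_ne h, Pi.single_eq_of_ne h, map_zero]

omit [Module Rᵐᵒᵖ M] [IsScalarTower k Rᵐᵒᵖ M] in
variable (k M) in
lemma exact_leftMap {d : Matrix (Fin a) (Fin b) R} {d' : Matrix (Fin b) (Fin c) R}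
    (h : Function.Exact (matrixMap d') (matrixMap d)) :
    Function.Exact (leftMap k M d') (leftMap k M d) :=
  Module.Flat.rTensor_exact M (f := (matrixMap d').restrictScalars k)
    (g := (matrixMap d).restrictScalars k) h

omit [Module Rᵐᵒᵖ M] [IsScalarTower k Rᵐᵒᵖ M] in
variable (k M) in
lemma injective_leftMap {d : Matrix (Fin a) (Fin b) R} (h : Function.Injective (matrixMap d)) :
    Function.Injective (leftMap k M d) :=
  Module.Flat.rTensor_preserves_injective_linearMap (M := M) ((matrixMap d).restrictScalars k) h

/-- If `n` bounds the degrees that occur in a cycle `x` of `d ⊗ 1 + 1 ⊗ e`, then the part of degree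
`n` of `x` is a cycle of `d ⊗ 1`. -/
lemma leftMap_projTensor_eq_zero {d e : Matrix (Fin a) (Fin b) R}
    (hd : ∀ i j, RaisesDegree π (d i j)) {x : (Fin b → R) ⊗[k] M} (h : mixedMap k M d e x = 0)
    {n : ℕ} (hn : projTensor M π b (n + 1) x = 0) : leftMap k M d (projTensor M π b n x) = 0 := by
  have h' : leftMap k M d x = -actionMap k M e x := eq_neg_of_add_eq_zero_left h
  rw [← projTensor_succ_leftMap hd, h', map_neg,
    projTensor_actionMap, hn, map_zero, neg_zero]

/-- If the parts of degree one of the differentials form an exact complex, then so do the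
differentials: the part of highest degree of a cycle is a boundary. -/
lemma exact_mixedMap (hπ : ∀ m n x, π m (π n x) = if m = n then π n x else 0)
    (hπ' : ∀ x, ∃ N, ∀ n, N ≤ n → ∑ m ∈ Finset.range n, π m x = x)
    {d e : Matrix (Fin a) (Fin b) R} {d' e' : Matrix (Fin b) (Fin c) R}
    (hd : ∀ i j, RaisesDegree π (d i j)) (hd' : ∀ i j, RaisesDegree π (d' i j))
    (hex : Function.Exact (matrixMap d') (matrixMap d))
    (h0 : ∀ x, mixedMap k M d e (mixedMap k M d' e' x) = 0) :
    Function.Exact (mixedMap k M d' e') (mixedMap k M d e) := by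
  intro x
  refine ⟨fun hx => ?_, fun ⟨y, hy⟩ => hy ▸ h0 y⟩
  obtain ⟨N, hN⟩ := exists_projTensor_eq_zero hπ' x
  induction N generalizing x with
  | zero =>
    obtain ⟨n, hn⟩ := exists_sum_projTensor hπ' x
    refine ⟨0, ?_⟩
    rw [map_zero, ← hn n le_rfl]
    exact (Finset.sum_eq_zero fun m _ => hN m (Nat.zero_le _)).symm
  | succ n ih =>
    obtain ⟨y, hy⟩ := (exact_leftMap k M hex _).1
      (leftMap_projTensor_eq_zero hd hx (hN (n + 1) le_rfl))
    obtain ⟨y', hy', hy''⟩ : ∃ y', leftMap k M d' y' = projTensor M π b n x ∧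
        ∀ l, n ≤ l → projTensor M π c l y' = 0 := by
      rcases n with _ | n
      · refine ⟨0, ?_, fun l _ => map_zero _⟩
        rw [map_zero, ← projTensor_zero_leftMap hd' y, hy, projTensor_projTensor hπ, if_pos rfl]
      · refine ⟨projTensor M π c n y, ?_, fun l hl => ?_⟩
        · rw [← projTensor_succ_leftMap hd', hy, projTensor_projTensor hπ, if_pos rfl]
        · rw [projTensor_projTensor hπ, if_neg (by omega)]
    obtain ⟨w, hw⟩ := ih (x - mixedMap k M d' e' y') (by rw [map_sub, hx, h0, sub_zero])
      fun l hl => by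
        rw [mixedMap_apply, map_sub, map_add, hy', projTensor_actionMap, hy'' l hl, map_zero,
          add_zero, projTensor_projTensor hπ]
        split_ifs with h
        · rw [h, sub_self]
        · rw [hN l (by omega), sub_zero]
    exact ⟨w + y', by rw [map_add, hw, sub_add_cancel]⟩

lemma injective_mixedMap
    (hπ' : ∀ x, ∃ N, ∀ n, N ≤ n → ∑ m ∈ Finset.range n, π m x = x)
    {d e : Matrix (Fin a) (Fin b) R} (hd : ∀ i j, RaisesDegree π (d i j))
    (hinj : Function.Injective (matrixMap d)) : Function.Injective (mixedMap k M d e) := by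
  refine (injective_iff_map_eq_zero _).2 fun x hx => ?_
  obtain ⟨N, hN⟩ := exists_projTensor_eq_zero hπ' x
  induction N with
  | zero =>
    obtain ⟨n, hn⟩ := exists_sum_projTensor hπ' x
    rw [← hn n le_rfl]
    exact Finset.sum_eq_zero fun m _ => hN m (Nat.zero_le _)
  | succ n ih =>
    refine ih fun l hl => ?_
    rcases hl.eq_or_lt with rfl | h
    · exact injective_leftMap k M hinj
        ((leftMap_projTensor_eq_zero hd hx (hN (n + 1) le_rfl)).trans (map_zero _).symm)
    · exact hN l h

end TensorComplex

section TensorComplex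

open scoped TensorProduct

variable {k : Type u} [Field k] {R : Type u} [Ring R] [Algebra k R] {M : Type u} [AddCommGroup M]
  [Module k M] [Module Rᵐᵒᵖ M] [IsScalarTower k Rᵐᵒᵖ M]

variable (k R M) in
/-- The action map `R ⊗ M → M`. -/
def actionToModule : (Fin 1 → R) ⊗[k] M →ₗ[Rᵐᵒᵖ] M :=
  TensorProduct.AlgebraTensorModule.lift
    { toFun := fun z => Algebra.lsmul k k M (op (z 0))
      map_add' := fun y z => by
        ext m
        exact add_smul (op (y 0)) (op (z 0)) m
      map_smul' := fun r z => by
        ext m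
        exact (smul_smul r (op (z 0)) m).symm }

lemma actionToModule_tmul (z : Fin 1 → R) (m : M) :
    actionToModule k R M (z ⊗ₜ m) = op (z 0) • m := rfl

lemma surjective_actionToModule : Function.Surjective (actionToModule k R M) := fun m =>
  ⟨(fun _ => 1) ⊗ₜ m, by rw [actionToModule_tmul, op_one, one_smul]⟩

/-- When the `r_j` generate `R`, the kernel of `R ⊗ M → M` is generated by the elements
`r_j r ⊗ m - r ⊗ m r_j`. -/
lemma exact_actionToModule {c : ℕ} {d e : Matrix (Fin 1) (Fin c) R} (he : ∀ j, e 0 j = -d 0 j)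
    (hd : Algebra.adjoin k (Set.range (d 0)) = ⊤) :
    Function.Exact (mixedMap k M d e) (actionToModule k R M) := by
  have hsingle : ∀ (j : Fin c) (r : R) (m : M), mixedMap k M d e (Pi.single j r ⊗ₜ m) =
      (fun _ => d 0 j * r) ⊗ₜ m - (fun _ => r) ⊗ₜ (op (d 0 j) • m) := by
    intro j r m
    have h : ∀ r : R, (Pi.single 0 r : Fin 1 → R) = fun _ => r := fun r => by
      ext i
      rw [Subsingleton.elim i 0, Pi.single_eq_same]
    rw [mixedMap_apply, leftMap_single, actionMap_single, Fin.sum_univ_one, Fin.sum_univ_one, he,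
      h, h, MulOpposite.op_neg, neg_smul, TensorProduct.tmul_neg, sub_eq_add_neg]
  have hzero : ∀ x, actionToModule k R M (mixedMap k M d e x) = 0 := by
    intro x
    induction x using TensorProduct.induction_on with
    | zero => simp
    | add x y hx hy => rw [map_add, map_add, hx, hy, add_zero]
    | tmul z m =>
      have hz : z = ∑ j, Pi.single j (z j) := (Finset.univ_sum_single z).symm
      rw [hz, TensorProduct.sum_tmul, map_sum, map_sum]
      refine Finset.sum_eq_zero fun j _ => ?_
      rw [hsingle, map_sub, actionToModule_tmul, actionToModule_tmul, smul_op_smul, sub_self]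
  have hgen : ∀ (r : R) (m : M), (fun _ => r : Fin 1 → R) ⊗ₜ[k] m - (fun _ => 1) ⊗ₜ (op r • m) ∈
      LinearMap.range (mixedMap k M d e) := by
    intro r
    -- The elements whose left multiplication preserves the claim form a subalgebra.
    let P : R → Prop := fun r => ∀ m : M,
      (fun _ => r : Fin 1 → R) ⊗ₜ[k] m - (fun _ => 1) ⊗ₜ (op r • m) ∈
        LinearMap.range (mixedMap k M d e)
    have hadd : ∀ r s, P r → P s → P (r + s) := by
      intro r s hr hs m
      have := add_mem (hr m) (hs m)
      rw [sub_add_sub_comm, ← TensorProduct.add_tmul, ← TensorProduct.tmul_add, ← add_smul] at this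
      exact this
    have hsmul : ∀ (c : k) r, P r → P (c • r) := by
      intro c r hr m
      have h1 : (fun _ => c • r : Fin 1 → R) ⊗ₜ[k] m = (fun _ => r : Fin 1 → R) ⊗ₜ[k] (c • m) :=
        TensorProduct.smul_tmul c (fun _ => r : Fin 1 → R) m
      have h2 : op (c • r) • m = op r • c • m := by
        rw [op_smul, smul_assoc, smul_comm]
      rw [h1, h2]
      exact hr _
    have hmul : ∀ j s, P s → P (d 0 j * s) := by
      intro j s hs m
      have := add_mem (LinearMap.mem_range_self (mixedMap k M d e) (Pi.single j s ⊗ₜ m))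
        (hs (op (d 0 j) • m))
      rw [hsingle, sub_add_sub_cancel, smul_op_smul] at this
      exact this
    have hall : ∀ a s, P s → P (a * s) := by
      intro a
      have ha : a ∈ Algebra.adjoin k (Set.range (d 0)) := hd ▸ Algebra.mem_top
      induction ha using Algebra.adjoin_induction with
      | mem x hx =>
        obtain ⟨j, rfl⟩ := hx
        exact hmul j
      | algebraMap c =>
        intro s hs
        rw [← Algebra.smul_def]
        exact hsmul c s hs
      | add x y _ _ hx hy =>
        intro s hs
        rw [add_mul]
        exact hadd _ _ (hx s hs) (hy s hs)
      | mul x y _ _ hx hy =>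
        intro s hs
        rw [mul_assoc]
        exact hx _ (hy s hs)
    have hone : P 1 := fun m => by
      rw [op_one, one_smul, sub_self]
      exact zero_mem _
    have := hall r 1 hone
    rwa [mul_one] at this
  have hx : ∀ x, x - (fun _ => 1 : Fin 1 → R) ⊗ₜ[k] actionToModule k R M x ∈
      LinearMap.range (mixedMap k M d e) := by
    intro x
    induction x using TensorProduct.induction_on with
    | zero => simp
    | add x y hx hy =>
      have := add_mem hx hy
      rwa [sub_add_sub_comm, ← TensorProduct.tmul_add, ← map_add] at this
    | tmul z m =>
      have hz : z = fun _ => z 0 := funext fun i => by rw [Subsingleton.elim i 0]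
      have := hgen (z 0) m
      rw [← hz] at this
      exact this
  intro x
  refine ⟨fun h => ?_, fun ⟨y, hy⟩ => hy ▸ hzero y⟩
  have := hx x
  rw [h, TensorProduct.tmul_zero, sub_zero] at this
  exact this

end TensorComplex

section ProjectiveDimension

variable {A : Type u} [Ring A] {X F G H : Type u} [AddCommGroup X] [Module A X]
  [AddCommGroup F] [Module A F] [AddCommGroup G] [Module A G] [AddCommGroup H] [Module A H]

lemma hasProjectiveDimensionLT_of_projective [Module.Projective A F] (n : ℕ) :
    HasProjectiveDimensionLT (ModuleCat.of A F) (n + 1) := by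
  have : Projective (ModuleCat.of A F) := (IsProjective.iff_projective F).1 inferInstance
  infer_instance

lemma hasProjectiveDimensionLT_of_ker [Module.Projective A F] {p : F →ₗ[A] X}
    (hp : Function.Surjective p) (n : ℕ)
    (h : HasProjectiveDimensionLT (ModuleCat.of A p.ker) (n + 1)) :
    HasProjectiveDimensionLT (ModuleCat.of A X) (n + 2) :=
  (shortExact_mk p.ker.injective_subtype (LinearMap.exact_subtype_ker_map p)
    hp).hasProjectiveDimensionLT_X₃ (n + 1) h (hasProjectiveDimensionLT_of_projective (n + 1))

lemma hasProjectiveDimensionLT_ker [Module.Projective A G] {e : G →ₗ[A] F} {d : F →ₗ[A] H}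
    (hex : Function.Exact e d) (n : ℕ)
    (h : HasProjectiveDimensionLT (ModuleCat.of A e.ker) (n + 1)) :
    HasProjectiveDimensionLT (ModuleCat.of A d.ker) (n + 2) := by
  have hq : Function.Surjective
      (e.codRestrict d.ker fun x => LinearMap.mem_ker.2 (hex.apply_apply_eq_zero x)) := by
    rintro ⟨x, hx⟩
    obtain ⟨z, hz⟩ := (hex x).1 hx
    exact ⟨z, Subtype.ext hz⟩
  refine hasProjectiveDimensionLT_of_ker hq n ?_
  rwa [LinearMap.ker_codRestrict]

lemma hasProjectiveDimensionLT_ker_of_injective [Module.Projective A G] {e : G →ₗ[A] F}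
    {d : F →ₗ[A] H} (hex : Function.Exact e d) (he : Function.Injective e) :
    HasProjectiveDimensionLT (ModuleCat.of A d.ker) 1 := by
  let q : G →ₗ[A] d.ker :=
    e.codRestrict d.ker fun x => LinearMap.mem_ker.2 (hex.apply_apply_eq_zero x)
  have hq : Function.Bijective q := by
    refine ⟨fun x y hxy => he (congrArg Subtype.val hxy), ?_⟩
    rintro ⟨x, hx⟩
    obtain ⟨z, hz⟩ := (hex x).1 hx
    exact ⟨z, Subtype.ext hz⟩
  have : Module.Projective A d.ker := Module.Projective.of_equiv (LinearEquiv.ofBijective q hq)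
  exact hasProjectiveDimensionLT_of_projective 0

end ProjectiveDimension

section GlobalDimension

open scoped TensorProduct

variable {k : Type u} [Field k] {R : Type u} [Ring R] [Algebra k R] {b₁ b₂ b₃ b₄ : ℕ}

/-- Suppose that the maps `dᵢ ⊗ 1 + 1 ⊗ eᵢ` are the differentials of a complex of free bimodules
and that the `dᵢ` are those of a linear free resolution of the trivial right module.  Then tensoring
the complex of bimodules with a right module gives a free resolution of that module. -/
lemma hasProjectiveDimensionLT_five {π : ℕ → R →ₗ[k] R}
    (hπ : ∀ m n x, π m (π n x) = if m = n then π n x else 0)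
    (hπ' : ∀ x, ∃ N, ∀ n, N ≤ n → ∑ m ∈ Finset.range n, π m x = x)
    {d₁ e₁ : Matrix (Fin 1) (Fin b₁) R} {d₂ e₂ : Matrix (Fin b₁) (Fin b₂) R}
    {d₃ e₃ : Matrix (Fin b₂) (Fin b₃) R} {d₄ e₄ : Matrix (Fin b₃) (Fin b₄) R}
    (hd₁ : ∀ i j, RaisesDegree π (d₁ i j)) (hd₂ : ∀ i j, RaisesDegree π (d₂ i j))
    (hd₃ : ∀ i j, RaisesDegree π (d₃ i j)) (hd₄ : ∀ i j, RaisesDegree π (d₄ i j))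
    (hgen : Algebra.adjoin k (Set.range (d₁ 0)) = ⊤) (he₁ : ∀ j, e₁ 0 j = -d₁ 0 j)
    (hd₁₂ : Function.Exact (matrixMap d₂) (matrixMap d₁))
    (hd₂₃ : Function.Exact (matrixMap d₃) (matrixMap d₂))
    (hd₃₄ : Function.Exact (matrixMap d₄) (matrixMap d₃))
    (hinj : Function.Injective (matrixMap d₄))
    (h₁ : d₁ * d₂ = 0) (h₂ : d₂ * d₃ = 0) (h₃ : d₃ * d₄ = 0)
    (he₁₂ : ∀ i j, ∑ l, e₂ l j * e₁ i l = 0) (he₂₃ : ∀ i j, ∑ l, e₃ l j * e₂ i l = 0)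
    (he₃₄ : ∀ i j, ∑ l, e₄ l j * e₃ i l = 0)
    (hde₁₂ : ∀ i j, ∑ l, (d₁ i l ⊗ₜ[k] e₂ l j + d₂ l j ⊗ₜ[k] e₁ i l) = 0)
    (hde₂₃ : ∀ i j, ∑ l, (d₂ i l ⊗ₜ[k] e₃ l j + d₃ l j ⊗ₜ[k] e₂ i l) = 0)
    (hde₃₄ : ∀ i j, ∑ l, (d₃ i l ⊗ₜ[k] e₄ l j + d₄ l j ⊗ₜ[k] e₃ i l) = 0)
    (X : ModuleCat.{u} Rᵐᵒᵖ) : HasProjectiveDimensionLT X 5 := by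
  let : Module k X := Module.compHom X (algebraMap k Rᵐᵒᵖ)
  have : IsScalarTower k Rᵐᵒᵖ X := ⟨fun c r x => by
    rw [Algebra.smul_def, mul_smul]
    rfl⟩
  have x₁ := exact_actionToModule (M := X) he₁ hgen
  have x₂ := exact_mixedMap (M := X) hπ hπ' hd₁ hd₂ hd₁₂ (mixedMap_mixedMap h₁ he₁₂ hde₁₂)
  have x₃ := exact_mixedMap (M := X) hπ hπ' hd₂ hd₃ hd₂₃ (mixedMap_mixedMap h₂ he₂₃ hde₂₃)
  have x₄ := exact_mixedMap (M := X) hπ hπ' hd₃ hd₄ hd₃₄ (mixedMap_mixedMap h₃ he₃₄ hde₃₄)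
  exact hasProjectiveDimensionLT_of_ker surjective_actionToModule 3
    (hasProjectiveDimensionLT_ker x₁ 2 (hasProjectiveDimensionLT_ker x₂ 1
      (hasProjectiveDimensionLT_ker x₃ 0 (hasProjectiveDimensionLT_ker_of_injective x₄
        (injective_mixedMap hπ' hd₄ hinj)))))

end GlobalDimension

/-! ### The right global dimension of `R(τ)` -/

section SideMatrices

open scoped TensorProduct

variable {k : Type u} [Field k] {X Y : Type u} [AddCommGroup X] [Module k X]
  [AddCommGroup Y] [Module k Y] (ρ θ : kˣ)

/-- The linear forms from which the matrices of the left-hand differentials are built: with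
`x = (x₁, x₂, x₃, x₄)` they are `ζ x₁ + ε x₃`, `ε x₁ + ζ x₃`, `ζ x₂ + ε x₄`, `ε x₂ + ζ x₄`,
`δ x₁ + γ x₄` and `γ x₁ + δ x₄`. -/
def sideForm (x : Fin 4 → X) : Fin 6 → X :=
  let γ : k := ρ + 1
  let δ : k := ρ - 1
  let ε : k := θ + 1
  let ζ : k := θ - 1
  ![ζ • x 0 + ε • x 2, ε • x 0 + ζ • x 2, ζ • x 1 + ε • x 3, ε • x 1 + ζ • x 3,
    δ • x 0 + γ • x 3, γ • x 0 + δ • x 3]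

/-- The left-hand part of the first differential of the bimodule resolution. -/
def sideQ (x : Fin 4 → X) : Matrix (Fin 1) (Fin 4) X := !![-x 0, -x 1, -x 2, -x 3]

/-- The left-hand part of the second differential: the relations are `f_l = ∑ⱼ (sideP j l) xⱼ`. -/
def sideP (x : Fin 4 → X) : Matrix (Fin 4) (Fin 6) X :=
  let y := sideForm ρ θ x
  !![y 0, 0, y 2, 0, y 4, 0;
     0, y 0, 0, y 2, -y 5, 0;
     -y 1, 0, -y 3, 0, 0, y 4;
     0, -y 1, 0, -y 3, 0, -y 5]

/-- The left-hand part of the third differential. -/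
def sideN (x : Fin 4 → X) : Matrix (Fin 6) (Fin 4) X :=
  let γ : k := ρ + 1
  let δ : k := ρ - 1
  let ε : k := θ + 1
  let ζ : k := θ - 1
  let y := sideForm ρ θ x
  !![-(δ • y 1), -(δ • y 3), -y 4, 0;
     γ • y 1, γ • y 3, 0, -y 4;
     -(γ • y 0), -(γ • y 2), y 5, 0;
     δ • y 0, δ • y 2, 0, y 5;
     ε • y 0 + ζ • y 1, ε • y 2 + ζ • y 3, 0, 0;
     -(ζ • y 0) - ε • y 1, -(ζ • y 2) - ε • y 3, 0, 0]

/-- The left-hand part of the last differential. -/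
def sideM (x : Fin 4 → X) : Matrix (Fin 4) (Fin 1) X :=
  let y := sideForm ρ θ x
  !![y 4; -y 5; 0; 0]

lemma map_sideForm (f : X →ₗ[k] Y) (x : Fin 4 → X) (i : Fin 6) :
    f (sideForm ρ θ x i) = sideForm ρ θ (fun i => f (x i)) i := by
  fin_cases i <;> simp [sideForm]

lemma map_sideQ (f : X →ₗ[k] Y) (x : Fin 4 → X) :
    (sideQ x).map f = sideQ fun i => f (x i) := by
  ext i j
  fin_cases i; fin_cases j <;> exact map_neg f _

lemma map_sideP (f : X →ₗ[k] Y) (x : Fin 4 → X) :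
    (sideP ρ θ x).map f = sideP ρ θ fun i => f (x i) := by
  have h := map_sideForm ρ θ f x
  ext i j
  fin_cases i <;> fin_cases j <;> simp [sideP, h]

lemma map_sideN (f : X →ₗ[k] Y) (x : Fin 4 → X) :
    (sideN ρ θ x).map f = sideN ρ θ fun i => f (x i) := by
  have h := map_sideForm ρ θ f x
  ext i j
  fin_cases i <;> fin_cases j <;> simp [sideN, h]

lemma map_sideM (f : X →ₗ[k] Y) (x : Fin 4 → X) :
    (sideM ρ θ x).map f = sideM ρ θ fun i => f (x i) := by
  have h := map_sideForm ρ θ f x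
  ext i j
  fin_cases j; fin_cases i <;> simp [sideM, h]

variable {R : Type u} [Ring R] [Algebra k R] (x : Fin 4 → R)

/-- The mixed terms in the composite of the first two differentials cancel in `R ⊗ R`. -/
lemma shapeQ_tmul_sideP (i j) : ∑ l, (shapeQ x i l ⊗ₜ[k] sideP ρ θ x l j +
    shapeP (shapeZ ρ θ x) l j ⊗ₜ[k] sideQ x i l) = 0 := by
  fin_cases i; fin_cases j <;>
    simp [shapeQ, shapeP, shapeZ, sideQ, sideP, sideForm, Fin.sum_univ_four, TensorProduct.tmul_add,
      TensorProduct.tmul_neg, TensorProduct.sub_tmul, ← TensorProduct.smul_tmul',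
      TensorProduct.tmul_smul] <;> module

/-- The mixed terms in the composite of the second and the third differential cancel. -/
lemma shapeP_tmul_sideN (i j) : ∑ l, (shapeP (shapeZ ρ θ x) i l ⊗ₜ[k] sideN ρ θ x l j +
    shapeN (shapeZ ρ θ x) l j ⊗ₜ[k] sideP ρ θ x i l) = 0 := by
  fin_cases i <;> fin_cases j <;>
    simp [shapeN, shapeP, shapeZ, sideN, sideP, sideForm, Fin.sum_univ_six, TensorProduct.tmul_add,
      TensorProduct.add_tmul, TensorProduct.tmul_neg, TensorProduct.neg_tmul,
      TensorProduct.sub_tmul, TensorProduct.tmul_sub, ← TensorProduct.smul_tmul',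
      TensorProduct.tmul_smul] <;> module

/-- The mixed terms in the composite of the last two differentials cancel. -/
lemma shapeN_tmul_sideM (i j) : ∑ l, (shapeN (shapeZ ρ θ x) i l ⊗ₜ[k] sideM ρ θ x l j +
    shapeM (shapeZ ρ θ x) l j ⊗ₜ[k] sideN ρ θ x i l) = 0 := by
  fin_cases j; fin_cases i <;>
    simp [shapeN, shapeM, shapeZ, sideN, sideM, sideForm, Fin.sum_univ_four, TensorProduct.tmul_add,
      TensorProduct.add_tmul, TensorProduct.tmul_neg, TensorProduct.neg_tmul,
      TensorProduct.sub_tmul, TensorProduct.tmul_sub, ← TensorProduct.smul_tmul',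
      TensorProduct.tmul_smul] <;> module

end SideMatrices

section SideCoefficients

variable {k : Type u} [Field k] [NeZero (2 : k)] (ρ θ : kˣ)

omit [NeZero (2 : k)] in
lemma plus_smul (c : kˣ) (x : FunctionField k) : ((c : k) + 1) • x = cplus c * x :=
  Algebra.smul_def _ x

omit [NeZero (2 : k)] in
lemma minus_smul (c : kˣ) (x : FunctionField k) : ((c : k) - 1) • x = cminus c * x :=
  Algebra.smul_def _ x

omit [NeZero (2 : k)] in
lemma sideForm_eq (a b : FunctionField k) : sideForm ρ θ ![1, a, b, a * b] =
    ![cminus θ + cplus θ * b, cplus θ + cminus θ * b, a * (cminus θ + cplus θ * b),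
      a * (cplus θ + cminus θ * b), cminus ρ + cplus ρ * (a * b),
      cplus ρ + cminus ρ * (a * b)] := by
  ext i
  fin_cases i <;> simp [sideForm, Algebra.smul_def, cplus, cminus] <;> ring

lemma map_phi_coordE : (fun i => phi ρ θ (coordE k i)) =
    ![1, phi ρ θ (coordU k), phi ρ θ (coordV k), phi ρ θ (coordU k) * phi ρ θ (coordV k)] := by
  ext i
  fin_cases i <;> simp [coordE]

/-- The left-hand forms on coefficients, with `u`, `v` expressed through `φ(u)`, `φ(v)` where this
makes the products of consecutive matrices visibly zero. -/
lemma sideForm_coordE : sideForm ρ θ (coordE k) =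
    ![phi ρ θ (coordV k) * (cplus θ + cminus θ * coordV k), cplus θ + cminus θ * coordV k,
      coordU k * (phi ρ θ (coordV k) * (cplus θ + cminus θ * coordV k)),
      coordU k * (cplus θ + cminus θ * coordV k),
      phi ρ θ (coordU k) * (cplus ρ + cminus ρ * (coordU k * coordV k)),
      cplus ρ + cminus ρ * (coordU k * coordV k)] := by
  have hu : phi ρ θ (coordU k) * (cplus ρ + cminus ρ * (coordU k * coordV k)) =
      cminus ρ + cplus ρ * (coordU k * coordV k) := by
    linear_combination phi_u_eq ρ θ
  have hv : phi ρ θ (coordV k) * (cplus θ + cminus θ * coordV k) =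
      cminus θ + cplus θ * coordV k := by
    linear_combination phi_v_eq ρ θ
  rw [hu, hv, coordE, sideForm_eq]

variable {ρ θ}

lemma coeffMatrix_sideQ : coeffMatrix (sideQ (generatorR ρ θ)) = sideQ (coordE k) := by
  refine (map_sideQ (k := k) (coeffR ρ θ 1) (generatorR ρ θ)).trans ?_
  simp only [coeffR_generatorR]

lemma coeffMatrix_sideP : coeffMatrix (sideP ρ θ (generatorR ρ θ)) = sideP ρ θ (coordE k) := by
  refine (map_sideP ρ θ (coeffR ρ θ 1) (generatorR ρ θ)).trans ?_
  simp only [coeffR_generatorR]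

lemma coeffMatrix_sideN : coeffMatrix (sideN ρ θ (generatorR ρ θ)) = sideN ρ θ (coordE k) := by
  refine (map_sideN ρ θ (coeffR ρ θ 1) (generatorR ρ θ)).trans ?_
  simp only [coeffR_generatorR]

lemma coeffMatrix_sideM : coeffMatrix (sideM ρ θ (generatorR ρ θ)) = sideM ρ θ (coordE k) := by
  refine (map_sideM ρ θ (coeffR ρ θ 1) (generatorR ρ θ)).trans ?_
  simp only [coeffR_generatorR]

/-- The generators, as elements of the piece of degree one. -/
def generatorPiece (ρ θ : kˣ) (i : Fin 4) : gradingR ρ θ 1 := ⟨generatorR ρ θ i, generatorR_mem i⟩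

lemma sideQ_mem (i j) : sideQ (generatorR ρ θ) i j ∈ gradingR ρ θ 1 := by
  have h := congrFun (congrFun (map_sideQ (k := k) (gradingR ρ θ 1).subtype
    (generatorPiece ρ θ)) i) j
  exact h ▸ (sideQ (generatorPiece ρ θ) i j).2

lemma sideP_mem (i j) : sideP ρ θ (generatorR ρ θ) i j ∈ gradingR ρ θ 1 := by
  have h := congrFun (congrFun (map_sideP ρ θ (gradingR ρ θ 1).subtype (generatorPiece ρ θ)) i) j
  exact h ▸ (sideP ρ θ (generatorPiece ρ θ) i j).2

lemma sideN_mem (i j) : sideN ρ θ (generatorR ρ θ) i j ∈ gradingR ρ θ 1 := by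
  have h := congrFun (congrFun (map_sideN ρ θ (gradingR ρ θ 1).subtype (generatorPiece ρ θ)) i) j
  exact h ▸ (sideN ρ θ (generatorPiece ρ θ) i j).2

lemma sideM_mem (i j) : sideM ρ θ (generatorR ρ θ) i j ∈ gradingR ρ θ 1 := by
  have h := congrFun (congrFun (map_sideM ρ θ (gradingR ρ θ 1).subtype (generatorPiece ρ θ)) i) j
  exact h ▸ (sideM ρ θ (generatorPiece ρ θ) i j).2

lemma coeffP_mul_coeffQ_side :
    (sideP ρ θ (coordE k)).transpose * ((sideQ (coordE k)).transpose).map (phi ρ θ) = 0 := by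
  have h : (sideQ (coordE k)).map (phi ρ θ) = sideQ fun i => phi ρ θ (coordE k i) :=
    map_sideQ (phi ρ θ).toLinearMap _
  rw [Matrix.transpose_map, h, map_phi_coordE]
  ext i j
  fin_cases j; fin_cases i <;>
    simp only [sideP, sideQ, sideForm_coordE] <;>
    simp [Matrix.mul_apply, Fin.sum_univ_succ] <;> ring

lemma coeffN_mul_coeffP_side :
    (sideN ρ θ (coordE k)).transpose * ((sideP ρ θ (coordE k)).transpose).map (phi ρ θ) = 0 := by
  have h : (sideP ρ θ (coordE k)).map (phi ρ θ) = sideP ρ θ fun i => phi ρ θ (coordE k i) :=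
    map_sideP ρ θ (phi ρ θ).toLinearMap _
  rw [Matrix.transpose_map, h, map_phi_coordE]
  ext i j
  fin_cases i <;> fin_cases j <;>
    simp only [sideP, sideN, sideForm_coordE, sideForm_eq, plus_smul, minus_smul] <;>
    simp [Matrix.mul_apply, Fin.sum_univ_succ] <;> ring

lemma coeffM_mul_coeffN_side :
    (sideM ρ θ (coordE k)).transpose * ((sideN ρ θ (coordE k)).transpose).map (phi ρ θ) = 0 := by
  have h : (sideN ρ θ (coordE k)).map (phi ρ θ) = sideN ρ θ fun i => phi ρ θ (coordE k i) :=
    map_sideN ρ θ (phi ρ θ).toLinearMap _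
  rw [Matrix.transpose_map, h, map_phi_coordE]
  ext i j
  fin_cases i; fin_cases j <;>
    simp only [sideM, sideN, sideForm_coordE, sideForm_eq, plus_smul, minus_smul] <;>
    simp [Matrix.mul_apply, Fin.sum_univ_succ] <;> ring

variable (ρ θ)

lemma adjoin_generatorR : Algebra.adjoin k (Set.range (generatorR ρ θ)) = ⊤ := by
  set S := Algebra.adjoin k (Set.range (generatorR ρ θ)) with hS
  have hle : algebraR ρ θ ≤ S.map (algebraR ρ θ).val := by
    refine Algebra.adjoin_le ?_
    rintro _ ⟨f, hf, rfl⟩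
    rw [SetLike.mem_coe]
    refine Submodule.span_induction (p := fun f _ =>
      monomial (phi ρ θ) 1 f ∈ S.map (algebraR ρ θ).val) ?_ ?_ ?_ ?_ hf
    · have h : ∀ i, monomial (phi ρ θ) 1 (coordE k i) ∈ S.map (algebraR ρ θ).val := fun i =>
        ⟨generatorR ρ θ i, Algebra.subset_adjoin ⟨i, rfl⟩, rfl⟩
      rintro x (rfl | rfl | rfl | rfl)
      exacts [h 0, h 1, h 2, h 3]
    · rw [monomial_zero]
      exact zero_mem _
    · intro x y _ _ hx hy
      rw [monomial_add]
      exact add_mem hx hy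
    · intro c x _ hx
      rw [monomial_smul]
      exact Subalgebra.smul_mem _ hx c
  refine eq_top_iff.2 fun x _ => ?_
  obtain ⟨y, hy, hyx⟩ := hle x.2
  rwa [← Subtype.ext (a1 := y) (a2 := x) hyx]

variable {ρ θ}

lemma raisesDegree_of_mem {r : algebraR ρ θ} (hr : r ∈ gradingR ρ θ 1) :
    RaisesDegree (projR ρ θ) r := by
  have h : ∀ (n : ℕ) (m : ℤ) (x : algebraR ρ θ), (n : ℤ) + 1 = m →
      coeffR ρ θ m (r * x) = coeffR ρ θ m (r * projR ρ θ n x) := by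
    rintro n m x rfl
    rw [coeffR_mul_left hr, coeffR_mul_left hr, add_sub_cancel_right, coeffR_projR_same]
  refine ⟨fun n x => ext_coeffR fun m => ?_, fun x => ext_coeffR fun m => ?_⟩
  · by_cases hm : ((n + 1 : ℕ) : ℤ) = m
    · rw [← h n m x (by push_cast at hm; exact hm), ← hm, coeffR_projR_same]
    · rw [coeffR_projR_of_ne hm, coeffR_mul_left hr,
        coeffR_projR_of_ne (by push_cast at hm; omega), map_zero, mul_zero]
  · by_cases hm : ((0 : ℕ) : ℤ) = m
    · rw [← hm, coeffR_projR_same, coeffR_mul_left hr,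
        coeffR_of_neg (n := ((0 : ℕ) : ℤ) - 1) (by norm_num), map_zero,
        mul_zero, map_zero]
    · rw [coeffR_projR_of_ne hm, map_zero]

lemma projR_projR (m n : ℕ) (x : algebraR ρ θ) :
    projR ρ θ m (projR ρ θ n x) = if m = n then projR ρ θ n x else 0 := by
  split_ifs with h
  · rw [h, projR_of_mem (projR_mem n x)]
  · exact projR_of_mem_of_ne h (projR_mem n x)

lemma sum_mul_eq_zero_of_transpose {R : Type u} [Ring R] {a b c : ℕ} {e : Matrix (Fin a) (Fin b) R}
    {e' : Matrix (Fin b) (Fin c) R} (h : e'.transpose * e.transpose = 0) (i j) :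
    ∑ l, e' l j * e i l = 0 :=
  congrFun (congrFun h j) i

lemma transpose_sideP_mul_sideQ :
    (sideP ρ θ (generatorR ρ θ)).transpose * (sideQ (generatorR ρ θ)).transpose = 0 :=
  mul_eq_zero_of_coeffMatrix (fun i j => sideP_mem j i) (fun i j => sideQ_mem j i) <| by
    rw [← coeffP_mul_coeffQ_side, ← coeffMatrix_sideP, ← coeffMatrix_sideQ (θ := θ)]
    rfl

lemma transpose_sideN_mul_sideP :
    (sideN ρ θ (generatorR ρ θ)).transpose * (sideP ρ θ (generatorR ρ θ)).transpose = 0 :=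
  mul_eq_zero_of_coeffMatrix (fun i j => sideN_mem j i) (fun i j => sideP_mem j i) <| by
    rw [← coeffN_mul_coeffP_side, ← coeffMatrix_sideP, ← coeffMatrix_sideN]
    rfl

lemma transpose_sideM_mul_sideN :
    (sideM ρ θ (generatorR ρ θ)).transpose * (sideN ρ θ (generatorR ρ θ)).transpose = 0 :=
  mul_eq_zero_of_coeffMatrix (fun i j => sideM_mem j i) (fun i j => sideN_mem j i) <| by
    rw [← coeffM_mul_coeffN_side, ← coeffMatrix_sideM, ← coeffMatrix_sideN]
    rfl

lemma sideQ_zero {X : Type u} [AddCommGroup X] (x : Fin 4 → X) (j : Fin 4) :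
    sideQ x 0 j = -shapeQ x 0 j := by
  fin_cases j <;> rfl

end SideCoefficients

section RightGlobalDimension

variable {k : Type u} [Field k] [NeZero (2 : k)] {ρ θ : kˣ}

open scoped TensorProduct in
lemma matrixQ_tmul_sideP (i j) :
    ∑ l, (matrixQ ρ θ i l ⊗ₜ[k] sideP ρ θ (generatorR ρ θ) l j +
      matrixP ρ θ l j ⊗ₜ[k] sideQ (generatorR ρ θ) i l) = 0 := by
  rw [matrixQ_eq, matrixP_eq, elementZ_eq]
  exact shapeQ_tmul_sideP ρ θ _ i j

open scoped TensorProduct in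
lemma matrixP_tmul_sideN (i j) :
    ∑ l, (matrixP ρ θ i l ⊗ₜ[k] sideN ρ θ (generatorR ρ θ) l j +
      matrixN ρ θ l j ⊗ₜ[k] sideP ρ θ (generatorR ρ θ) i l) = 0 := by
  rw [matrixP_eq, matrixN_eq, elementZ_eq]
  exact shapeP_tmul_sideN ρ θ _ i j

open scoped TensorProduct in
lemma matrixN_tmul_sideM (i j) :
    ∑ l, (matrixN ρ θ i l ⊗ₜ[k] sideM ρ θ (generatorR ρ θ) l j +
      matrixM ρ θ l j ⊗ₜ[k] sideN ρ θ (generatorR ρ θ) i l) = 0 := by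
  rw [matrixN_eq, matrixM_eq, elementZ_eq]
  exact shapeN_tmul_sideM ρ θ _ i j

lemma hasProjectiveDimensionLT_algebraR (hr : ∀ n, RanksAtLeast n ρ θ)
    (X : ModuleCat.{u} (algebraR ρ θ)ᵐᵒᵖ) : HasProjectiveDimensionLT X 5 := by
  have hgen : Algebra.adjoin k (Set.range (matrixQ ρ θ 0)) = ⊤ := by
    have : matrixQ ρ θ 0 = generatorR ρ θ := funext fun j => by rw [matrixQ_eq, shapeQ_zero]
    rw [this, adjoin_generatorR]
  refine hasProjectiveDimensionLT_five (k := k) (R := algebraR ρ θ) (π := projR ρ θ)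
    (d₁ := matrixQ ρ θ) (e₁ := sideQ (generatorR ρ θ))
    (d₂ := matrixP ρ θ) (e₂ := sideP ρ θ (generatorR ρ θ))
    (d₃ := matrixN ρ θ) (e₃ := sideN ρ θ (generatorR ρ θ))
    (d₄ := matrixM ρ θ) (e₄ := sideM ρ θ (generatorR ρ θ))
    (projR_projR (ρ := ρ) (θ := θ)) (fun x => ?_)
    (fun i j => raisesDegree_of_mem (matrixQ_mem i j))
    (fun i j => raisesDegree_of_mem (matrixP_mem i j))
    (fun i j => raisesDegree_of_mem (matrixN_mem i j))
    (fun i j => raisesDegree_of_mem (matrixM_mem i j))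
    hgen (fun j => ?_) (exact_PQ hr) (exact_NP hr) (exact_MN hr)
    (injective_M hr) matrixQ_mul_matrixP matrixP_mul_matrixN
    matrixN_mul_matrixM
    (sum_mul_eq_zero_of_transpose transpose_sideP_mul_sideQ)
    (sum_mul_eq_zero_of_transpose transpose_sideN_mul_sideP)
    (sum_mul_eq_zero_of_transpose transpose_sideM_mul_sideN) matrixQ_tmul_sideP
    matrixP_tmul_sideN matrixN_tmul_sideM X
  · obtain ⟨N, hN⟩ := exists_eq_sum_projR x
    exact ⟨N, fun n hn => (hN n hn).symm⟩
  · rw [sideQ_zero]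
    rfl

/-- The bound four is attained by the trivial module, as `Ext^4(k, R)` is nonzero. -/
lemma rightGlobalDimension_algebraR (hr : ∀ n, RanksAtLeast n ρ θ) :
    projectiveDimension (trivialModule (gradingR ρ θ)) = 4 ∧
      rightGlobalDimension (algebraR ρ θ) = 4 := by
  have h1 : ∀ X : ModuleCat.{u} (algebraR ρ θ)ᵐᵒᵖ, projectiveDimension X ≤ 4 := fun X =>
    (projectiveDimension_le_iff X 4).2 (hasProjectiveDimensionLT_algebraR hr X)
  have h2 : 4 ≤ projectiveDimension (trivialModule (gradingR ρ θ)) := by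
    refine (projectiveDimension_ge_iff _ 4).2 fun h => ?_
    have hsub : Subsingleton
        (ExtTrivial (gradingR ρ θ) (rightRegular (algebraR ρ θ)) 4) :=
      subsingleton_of_forall_eq 0 fun e => e.eq_zero_of_hasProjectiveDimensionLT 4 le_rfl
    exact not_finiteDimensional_ext_four hr inferInstance
  exact ⟨le_antisymm (h1 _) h2, le_antisymm (iSup_le h1) (h2.trans (le_iSup _ _))⟩

end RightGlobalDimension

/-! ### The left global dimension of `R(τ)` -/

section Opposite

attribute [local instance] RingHomInvPair.of_ringEquiv in
lemma projectiveDimension_of_ringEquiv {A B : Type u} [Ring A] [Ring B] (e : A ≃+* B)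
    (X : ModuleCat.{u} A) :
      ∃ Y : ModuleCat.{u} B, projectiveDimension X = projectiveDimension Y := by
  let _ : Module B X := Module.compHom X e.symm.toRingHom
  let e' : X ≃ₛₗ[RingHomClass.toRingHom e] ModuleCat.of B X :=
    { AddEquiv.refl X with
      map_smul' := fun a x => by
        change a • x = e.symm (e a) • x
        rw [e.symm_apply_apply] }
  exact ⟨ModuleCat.of B X, ModuleCat.projectiveDimension_eq_of_semiLinearEquiv e e'⟩

lemma leftGlobalDimension_eq_rightGlobalDimension {R R' : Type u} [Ring R] [Ring R']
    (e : R ≃+* R'ᵐᵒᵖ) : leftGlobalDimension R = rightGlobalDimension R' := by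
  refine le_antisymm (iSup_le fun X => ?_) (iSup_le fun X => ?_)
  · obtain ⟨Y, hY⟩ := projectiveDimension_of_ringEquiv e X
    exact hY.le.trans (le_iSup (fun Y : ModuleCat.{u} R'ᵐᵒᵖ => projectiveDimension Y) Y)
  · obtain ⟨Y, hY⟩ := projectiveDimension_of_ringEquiv e.symm X
    exact hY.le.trans (le_iSup (fun Y : ModuleCat.{u} R => projectiveDimension Y) Y)

variable {k : Type u} [Field k]

lemma unop_unop_eq {A B : Type u} {ι : Type} [Ring A] [Algebra k A] [Ring B] [Algebra k B]
    {a : ι → A} (ha : Algebra.adjoin k (Set.range a) = ⊤) (F : A →ₐ[k] Bᵐᵒᵖ) (G : B →ₐ[k] Aᵐᵒᵖ)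
    (h : ∀ i, unop (G (unop (F (a i)))) = a i) (x : A) : unop (G (unop (F x))) = x := by
  have : ((AlgEquiv.opOp k A).symm.toAlgHom.comp ((AlgHom.op G).comp F)) = AlgHom.id k A := by
    refine AlgHom.ext_of_adjoin_eq_top ha ?_
    rintro _ ⟨i, rfl⟩
    exact h i
  exact AlgHom.congr_fun this x

/-- Antihomomorphisms `A → B` and `B → A` that are inverse to each other identify `A` with the
opposite of `B`. -/
lemma nonempty_ringEquiv_opposite {A B : Type u} [Ring A] [Algebra k A] [Ring B] [Algebra k B]
    (F : A →ₐ[k] Bᵐᵒᵖ) (G : B →ₐ[k] Aᵐᵒᵖ) (hFG : ∀ x, unop (G (unop (F x))) = x)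
    (hGF : ∀ x, unop (F (unop (G x))) = x) : Nonempty (A ≃+* Bᵐᵒᵖ) := by
  refine ⟨RingEquiv.ofBijective F ⟨fun x y hxy => ?_, fun y => ⟨unop (G (unop y)), ?_⟩⟩⟩
  · rw [← hFG x, ← hFG y, hxy]
  · exact unop_injective (hGF (unop y))

variable {X Y : Type u} [AddCommGroup X] [Module k X] [AddCommGroup Y] [Module k Y] (ρ θ : kˣ)

/-- The linear substitution that reverses multiplication: on coefficients it is
`4⁻¹ (δ + γ u) (ε + ζ v)`, `4⁻¹ (γ + δ u) (ε + ζ v)`, `4⁻¹ (δ + γ u) (ζ + ε v)`,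
`4⁻¹ (γ + δ u) (ζ + ε v)`. -/
def mirrorForm (r : Fin 4 → X) : Fin 4 → X :=
  let γ : k := ρ + 1
  let δ : k := ρ - 1
  let ε : k := θ + 1
  let ζ : k := θ - 1
  ![(4 : k)⁻¹ • ((δ * ε) • r 0 + (γ * ε) • r 1 + (δ * ζ) • r 2 + (γ * ζ) • r 3),
    (4 : k)⁻¹ • ((γ * ε) • r 0 + (δ * ε) • r 1 + (γ * ζ) • r 2 + (δ * ζ) • r 3),
    (4 : k)⁻¹ • ((δ * ζ) • r 0 + (γ * ζ) • r 1 + (δ * ε) • r 2 + (γ * ε) • r 3),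
    (4 : k)⁻¹ • ((γ * ζ) • r 0 + (δ * ζ) • r 1 + (γ * ε) • r 2 + (δ * ε) • r 3)]

lemma map_mirrorForm (f : X →ₗ[k] Y) (r : Fin 4 → X) (i : Fin 4) :
    f (mirrorForm ρ θ r i) = mirrorForm ρ θ (fun i => f (r i)) i := by
  fin_cases i <;> simp [mirrorForm]

variable {ρ θ} [NeZero (2 : k)]

/-- The mirror substitutions for inverse parameters are inverse to each other. -/
lemma mirrorForm_mirrorForm {ρ' θ' : kˣ} (hρ : ρ * ρ' = 1) (hθ : θ * θ' = 1) (r : Fin 4 → X)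
    (i : Fin 4) : mirrorForm ρ θ (mirrorForm ρ' θ' r) i = r i := by
  have h4 : (4 : k) ≠ 0 := four_ne_zero_of_two
  have h2 : (2 : k) ≠ 0 := NeZero.ne _
  have hρ0 : (ρ : k) ≠ 0 := ρ.ne_zero
  have hθ0 : (θ : k) ≠ 0 := θ.ne_zero
  obtain rfl : ρ' = ρ⁻¹ := eq_inv_of_mul_eq_one_right hρ
  obtain rfl : θ' = θ⁻¹ := eq_inv_of_mul_eq_one_right hθ
  fin_cases i <;> simp only [mirrorForm, Units.val_inv_eq_inv_val] <;> simp <;> match_scalars <;>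
    field_simp <;> ring

variable (ρ θ) in
omit [NeZero (2 : k)] in
lemma mirrorForm_eq (a b : FunctionField k) : mirrorForm ρ θ ![1, a, b, a * b] =
    fun i => algebraMap k (FunctionField k) 4⁻¹ * ![
      (cminus ρ + cplus ρ * a) * (cplus θ + cminus θ * b),
      (cplus ρ + cminus ρ * a) * (cplus θ + cminus θ * b),
      (cminus ρ + cplus ρ * a) * (cminus θ + cplus θ * b),
      (cplus ρ + cminus ρ * a) * (cminus θ + cplus θ * b)] i := by
  ext i
  fin_cases i <;> simp only [mirrorForm, Algebra.smul_def, cplus, cminus, map_mul] <;>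
    simp [-mul_eq_mul_left_iff] <;> ring

variable {ρ' θ' : kˣ}

lemma mirror_phi_u (hρ : ρ * ρ' = 1) : cminus ρ + cplus ρ * phi ρ' θ' (coordU k) =
    coordU k * coordV k * (cplus ρ + cminus ρ * phi ρ' θ' (coordU k)) := by
  have h : algebraMap k (FunctionField k) ρ * algebraMap k _ ρ' = 1 := by
    rw [← map_mul, ← Units.val_mul, hρ, Units.val_one, map_one]
  have h1 := phi_u_eq ρ' θ'
  simp only [cplus, cminus, map_add, map_sub, map_one] at h1 ⊢
  linear_combination algebraMap k (FunctionField k) ρ * h1 -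
    (phi ρ' θ' (coordU k) * (coordU k * coordV k) + phi ρ' θ' (coordU k) -
      coordU k * coordV k - 1) * h

lemma mirror_phi_v (hθ : θ * θ' = 1) : cminus θ + cplus θ * phi ρ' θ' (coordV k) =
    coordV k * (cplus θ + cminus θ * phi ρ' θ' (coordV k)) := by
  have h : algebraMap k (FunctionField k) θ * algebraMap k _ θ' = 1 := by
    rw [← map_mul, ← Units.val_mul, hθ, Units.val_one, map_one]
  have h1 := phi_v_eq ρ' θ'
  simp only [cplus, cminus, map_add, map_sub, map_one] at h1 ⊢
  linear_combination algebraMap k (FunctionField k) θ * h1 -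
    (phi ρ' θ' (coordV k) * coordV k + phi ρ' θ' (coordV k) - coordV k - 1) * h

/-- The elements obtained from the generators of `R(ρ', θ')` by the mirror substitution. -/
def mirrorR (ρ θ ρ' θ' : kˣ) : Fin 4 → algebraR ρ' θ' := mirrorForm ρ θ (generatorR ρ' θ')

lemma mirrorR_mem (i : Fin 4) : mirrorR ρ θ ρ' θ' i ∈ gradingR ρ' θ' 1 := by
  have h := map_mirrorForm ρ θ (gradingR ρ' θ' 1).subtype (generatorPiece ρ' θ') i
  change mirrorForm ρ θ (generatorR ρ' θ') i ∈ gradingR ρ' θ' 1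
  exact h ▸ (mirrorForm ρ θ (generatorPiece ρ' θ') i).2

lemma coeffR_mirrorR (i : Fin 4) :
    coeffR ρ' θ' 1 (mirrorR ρ θ ρ' θ' i) = mirrorForm ρ θ (coordE k) i := by
  refine (map_mirrorForm ρ θ (coeffR ρ' θ' 1) (generatorR ρ' θ') i).trans ?_
  simp only [coeffR_generatorR]

lemma sum_shapeP_mul_phi_mirrorForm (hρ : ρ * ρ' = 1) (hθ : θ * θ' = 1) (l : Fin 6) :
    ∑ j, shapeP (shapeZ ρ θ (mirrorForm ρ θ (coordE k))) j l *
      phi ρ' θ' (mirrorForm ρ θ (coordE k) j) = 0 := by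
  have h : ∀ j, phi ρ' θ' (mirrorForm ρ θ (coordE k) j) =
      mirrorForm ρ θ (fun i => phi ρ' θ' (coordE k i)) j :=
    map_mirrorForm ρ θ (phi ρ' θ').toLinearMap (coordE k)
  simp only [h, map_phi_coordE]
  rw [coordE]
  simp only [mirrorForm_eq, mirror_phi_u hρ, mirror_phi_v hθ]
  fin_cases l <;> simp only [shapeZ, plus_smul, minus_smul] <;>
    simp [shapeP, Fin.sum_univ_four] <;> ring

lemma sum_shapeP_mul_mirrorR (hρ : ρ * ρ' = 1) (hθ : θ * θ' = 1) (l : Fin 6) :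
    ∑ j, shapeP (shapeZ ρ θ (mirrorR ρ θ ρ' θ')) j l * mirrorR ρ θ ρ' θ' j = 0 := by
  let B : Matrix (Fin 4) (Fin 1) (algebraR ρ' θ') := Matrix.of fun j _ => mirrorR ρ θ ρ' θ' j
  have hP : coeffMatrix (shapeP (shapeZ ρ θ (mirrorR ρ θ ρ' θ'))) =
      shapeP (shapeZ ρ θ (mirrorForm ρ θ (coordE k))) := by
    refine (shapeP_map _ (map_zero _) _).trans ?_
    congr 1
    ext1 i
    refine (map_shapeZ ρ θ (coeffR ρ' θ' 1) (mirrorR ρ θ ρ' θ') i).trans ?_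
    simp only [coeffR_mirrorR]
  have h : (shapeP (shapeZ ρ θ (mirrorR ρ θ ρ' θ'))).transpose * B = 0 := by
    refine mul_eq_zero_of_coeffMatrix (fun i j => ?_) (fun i _ => mirrorR_mem i) ?_
    · exact shapeP_forall (· ∈ gradingR ρ' θ' 1) (zero_mem _)
        (shapeZ_mem ρ θ (gradingR ρ' θ' 1) mirrorR_mem) j i
    · ext i j
      rw [Matrix.mul_apply]
      refine Eq.trans ?_ (sum_shapeP_mul_phi_mirrorForm hρ hθ i)
      refine Finset.sum_congr rfl fun l _ => ?_
      rw [← hP, ← coeffR_mirrorR (ρ' := ρ') (θ' := θ')]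
      rfl
  exact congrFun (congrFun h l) 0

/-- The homomorphism from `S(ρ, θ)` to the opposite of `R(ρ⁻¹, θ⁻¹)` given by the mirror
substitution. -/
def homMirror (hρ : ρ * ρ' = 1) (hθ : θ * θ' = 1) : algebraS ρ θ →ₐ[k] (algebraR ρ' θ')ᵐᵒᵖ :=
  liftS ρ θ (fun i => op (mirrorR ρ θ ρ' θ' i)) fun l => by
    have hP : ∀ j, shapeP (shapeZ ρ θ fun i => op (mirrorR ρ θ ρ' θ' i)) j l =
        op (shapeP (shapeZ ρ θ (mirrorR ρ θ ρ' θ')) j l) := by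
      intro j
      have h1 : (fun i => op (shapeZ ρ θ (mirrorR ρ θ ρ' θ') i)) =
          shapeZ ρ θ fun i => op (mirrorR ρ θ ρ' θ' i) := funext fun i =>
        map_shapeZ ρ θ (opLinearEquiv k : algebraR ρ' θ' ≃ₗ[k] _).toLinearMap _ i
      rw [← h1]
      exact (congrFun (congrFun (shapeP_map op op_zero (shapeZ ρ θ (mirrorR ρ θ ρ' θ'))) j) l).symm
    simp only [hP, ← op_mul]
    rw [← Finset.op_sum, sum_shapeP_mul_mirrorR hρ hθ, op_zero]

lemma exists_algHom_mirror (hr : ∀ n, RanksAtLeast n ρ θ) (hρ : ρ * ρ' = 1) (hθ : θ * θ' = 1) :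
    ∃ F : algebraR ρ θ →ₐ[k] (algebraR ρ' θ')ᵐᵒᵖ, ∀ i, F (generatorR ρ θ i) =
      op (mirrorR ρ θ ρ' θ' i) := by
  obtain ⟨e, he⟩ := exists_algEquiv hr
  refine ⟨(homMirror hρ hθ).comp e.symm.toAlgHom, fun i => ?_⟩
  have h : e.symm (generatorR ρ θ i) = generatorS ρ θ i := by
    rw [← he, e.symm_apply_apply]
  exact (congrArg (homMirror hρ hθ) h).trans (liftS_generatorS ρ θ _ _ i)

/-- If an antihomomorphism takes the `b i` to the mirror combinations of the `a i`, then it takes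
the mirror combinations of the `b i` to the `a i`. -/
lemma unop_mirror {A : Type u} [Ring A] [Algebra k A] (hρ : ρ * ρ' = 1) (hθ : θ * θ' = 1)
    {B : Type u} [Ring B] [Algebra k B] (G : B →ₐ[k] Aᵐᵒᵖ) {a : Fin 4 → A} {b : Fin 4 → B}
    (hG : ∀ i, G (b i) = op (mirrorForm ρ' θ' a i)) (i : Fin 4) :
    unop (G (mirrorForm ρ θ b i)) = a i := by
  have h := map_mirrorForm ρ θ ((opLinearEquiv k).symm.toLinearMap ∘ₗ G.toLinearMap) b i
  refine h.trans ?_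
  have h1 : (fun i => ((opLinearEquiv k).symm.toLinearMap ∘ₗ G.toLinearMap) (b i)) =
      mirrorForm ρ' θ' a := funext fun i => congrArg unop (hG i)
  rw [h1, mirrorForm_mirrorForm hρ hθ]

/-- `R(ρ⁻¹, θ⁻¹)` is the opposite algebra of `R(ρ, θ)`. -/
lemma exists_ringEquiv_opposite (hr : ∀ n, RanksAtLeast n ρ θ) (hr' : ∀ n, RanksAtLeast n ρ' θ')
    (hρ : ρ * ρ' = 1) (hθ : θ * θ' = 1) :
    Nonempty (algebraR ρ θ ≃+* (algebraR ρ' θ')ᵐᵒᵖ) := by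
  obtain ⟨F, hF⟩ := exists_algHom_mirror hr hρ hθ
  have hρ' : ρ' * ρ = 1 := (mul_comm ρ' ρ).trans hρ
  have hθ' : θ' * θ = 1 := (mul_comm θ' θ).trans hθ
  obtain ⟨G, hG⟩ := exists_algHom_mirror hr' hρ' hθ'
  have hFG : ∀ x, unop (G (unop (F x))) = x :=
    unop_unop_eq (A := algebraR ρ θ) (B := algebraR ρ' θ') (adjoin_generatorR ρ θ) F G fun i =>
      (congrArg (fun y => unop (G (unop y))) (hF i)).trans (unop_mirror hρ hθ G hG i)
  have hGF : ∀ x, unop (F (unop (G x))) = x :=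
    unop_unop_eq (A := algebraR ρ' θ') (B := algebraR ρ θ) (adjoin_generatorR ρ' θ') G F fun i =>
      (congrArg (fun y => unop (F (unop y))) (hG i)).trans
        (unop_mirror hρ' hθ' F hF i)
  exact nonempty_ringEquiv_opposite F G hFG hGF

lemma leftGlobalDimension_algebraR (hr : ∀ n, RanksAtLeast n ρ θ)
    (hr' : ∀ n, RanksAtLeast n ρ⁻¹ θ⁻¹) : leftGlobalDimension (algebraR ρ θ) = 4 := by
  obtain ⟨e⟩ := exists_ringEquiv_opposite hr hr' (mul_inv_cancel ρ) (mul_inv_cancel θ)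
  rw [leftGlobalDimension_eq_rightGlobalDimension e, (rightGlobalDimension_algebraR hr').2]

end Opposite

/-! ### Failure of the Gorenstein and the `χ` conditions -/

section Consequences

variable {k : Type u} [Field k] {R : Type u} [Ring R] [Algebra k R] {𝒜 : ℕ → Submodule k R}

/-- The grading of `R` by the natural numbers, extended by zero to the integers, is a grading of
the right module `R`. -/
lemma isGradable_rightRegular (h : IsConnectedGraded 𝒜) : IsGradable 𝒜 (rightRegular R) := by
  let ℬ : ℤ → Submodule k R := fun i => if 0 ≤ i then 𝒜 i.toNat else ⊥
  have hℬ : ∀ n : ℕ, ℬ n = 𝒜 n := fun n => by simp [ℬ]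
  have hneg : ∀ i : ℤ, ¬ 0 ≤ i → ℬ i = ⊥ := fun i hi => if_neg hi
  have hint : DirectSum.IsInternal ℬ := by
    refine DirectSum.isInternal_submodule_of_iSupIndep_of_iSup_eq_top (fun i => ?_) ?_
    · by_cases hi : 0 ≤ i
      · lift i to ℕ using hi
        rw [hℬ]
        refine (h.internal.submodule_iSupIndep i).mono_right (iSup₂_le fun j hj => ?_)
        by_cases hj0 : 0 ≤ j
        · lift j to ℕ using hj0
          rw [hℬ]
          exact le_iSup₂_of_le j (by exact_mod_cast hj) le_rfl
        · rw [hneg j hj0]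
          exact bot_le
      · rw [hneg i hi]
        exact disjoint_bot_left
    · refine top_le_iff.1 (h.internal.submodule_iSup_eq_top.symm.le.trans ?_)
      exact iSup_le fun n => (hℬ n).symm.le.trans (le_iSup ℬ n)
  refine ⟨fun i => (ℬ i).toAddSubgroup, hint, fun n i a x ha hx => ?_⟩
  replace hx : (show R from x) ∈ ℬ i := hx
  by_cases hi : 0 ≤ i
  · lift i to ℕ using hi
    rw [hℬ] at hx
    have h1 := h.mul_mem i n x a hx ha
    rw [← hℬ] at h1
    exact_mod_cast h1
  · rw [hneg i hi] at hx
    have hx0 : x = 0 := hx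
    rw [hx0, smul_zero]
    exact zero_mem _

lemma not_satisfiesChi (h : IsConnectedGraded 𝒜) {i : ℕ}
    (hi : ¬ FiniteDimensional k (ExtTrivial 𝒜 (rightRegular R) i)) : ¬ SatisfiesChi 𝒜 i := by
  intro hchi
  exact hi (hchi _ (Module.Finite.equiv (rightRegularEquiv (R := R))) (isGradable_rightRegular h) i
    le_rfl)

/-- The Gorenstein condition allows a single nonzero `Ext^i(k, R)`. -/
lemma not_isASGorenstein {i j : ℕ} (hij : i ≠ j)
    (hi : Nontrivial (ExtTrivial 𝒜 (rightRegular R) i))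
    (hj : Nontrivial (ExtTrivial 𝒜 (rightRegular R) j)) : ¬ IsASGorenstein 𝒜 := by
  rintro ⟨d, -, -, hd, -⟩
  by_cases h : i = d
  · exact not_subsingleton _ (hd j (h ▸ hij.symm))
  · exact not_subsingleton _ (hd i h)

lemma not_isASRegular (h : ¬ IsASGorenstein 𝒜) : ¬ IsASRegular 𝒜 :=
  fun ⟨d, hd, _⟩ => h ⟨d, hd⟩

lemma nontrivial_of_not_finiteDimensional {V : Type*} [AddCommGroup V] [Module k V]
    (h : ¬ FiniteDimensional k V) : Nontrivial V := by
  by_contra hV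
  rw [not_nontrivial_iff_subsingleton] at hV
  exact h inferInstance

lemma depth_eq {M : ModuleCat.{u} Rᵐᵒᵖ} {n : ℕ} (hn : Nontrivial (ExtTrivial 𝒜 M n))
    (hlt : ∀ i < n, Subsingleton (ExtTrivial 𝒜 M i)) : depth 𝒜 M = n := by
  refine le_antisymm (sInf_le ⟨n, rfl, hn⟩) (le_sInf ?_)
  rintro _ ⟨i, rfl, hi⟩
  by_contra h
  have := hlt i (by exact_mod_cast not_le.1 h)
  exact not_subsingleton _ this

lemma depth_trivialModule (h : augmentationIdeal 𝒜 ≠ ⊤) : depth 𝒜 (trivialModule 𝒜) = 0 := by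
  refine depth_eq (n := 0) ?_ fun i hi => (Nat.not_lt_zero i hi).elim
  have : Nontrivial (trivialModule 𝒜) := Submodule.Quotient.nontrivial_iff.2 h
  have hid : (𝟙 (trivialModule 𝒜)) ≠ 0 := by
    obtain ⟨x, hx⟩ := exists_ne (0 : trivialModule 𝒜)
    intro h0
    exact hx (congrArg (fun f : trivialModule 𝒜 ⟶ trivialModule 𝒜 => f.hom x) h0)
  have : Nontrivial (trivialModule 𝒜 ⟶ trivialModule 𝒜) := ⟨⟨_, _, hid⟩⟩
  exact (Abelian.Ext.homEquiv₀ (X := trivialModule 𝒜) (Y := trivialModule 𝒜)).nontrivial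

end Consequences

lemma augmentationIdeal_ne_top {k : Type u} [Field k] [NeZero (2 : k)] (ρ θ : kˣ) :
    augmentationIdeal (gradingR ρ θ) ≠ ⊤ := by
  intro h
  have h1 : (1 : algebraR ρ θ) ∈ augmentationIdeal (gradingR ρ θ) := h ▸ Submodule.mem_top
  rw [mem_augmentationIdeal_iff, coeffR_one] at h1
  exact one_ne_zero h1

end BirationalSurface

end

open BirationalSurface in
theorem mainTheorem3 {k : Type u} [Field k] [IsAlgClosed k] [Uncountable k] [NeZero (2 : k)] :
    ∃ U : Set (kˣ × kˣ),
      IsGeneralSubset U ∧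
      (1, 1) ∈ U ∧
      (∀ ρ θ : kˣ, AlgebraicIndependent (⊥ : Subfield k) ![(ρ : k), (θ : k)] → (ρ, θ) ∈ U) ∧
      ∀ ρ θ : kˣ, (ρ, θ) ∈ U →
        -- the algebra: exact complex, Koszul, global dimension, Hilbert series, presentation
        (IsConnectedGraded (gradingR ρ θ) ∧
          KoszulComplexExact ρ θ ∧
          IsKoszul (gradingR ρ θ) ∧
          rightGlobalDimension (algebraR ρ θ) = 4 ∧
          leftGlobalDimension (algebraR ρ θ) = 4 ∧
          hilbertSeries (gradingR ρ θ) = ((1 - PowerSeries.X) ^ 4)⁻¹ ∧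
          ∃ e : algebraS ρ θ ≃ₐ[k] algebraR ρ θ,
            ∀ i, e (generatorS ρ θ i) = generatorR ρ θ i) ∧
        -- `Ext^1`
        Subsingleton (ExtTrivial (gradingR ρ θ) (rightRegular (algebraR ρ θ)) 1) ∧
        -- `Ext^2`, `Ext^3`, `Ext^4`
        (∀ i ∈ ({2, 3, 4} : Set ℕ),
          ¬ FiniteDimensional k (ExtTrivial (gradingR ρ θ) (rightRegular (algebraR ρ θ)) i)) ∧
        -- consequences
        (¬ IsASGorenstein (gradingR ρ θ) ∧
          ¬ IsASRegular (gradingR ρ θ) ∧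
          ¬ SatisfiesChi (gradingR ρ θ) 2 ∧
          depth (gradingR ρ θ) (rightRegular (algebraR ρ θ)) = 2 ∧
          depth (gradingR ρ θ) (trivialModule (gradingR ρ θ)) = 0 ∧
          projectiveDimension (trivialModule (gradingR ρ θ)) = 4 ∧
          ¬ AuslanderBuchsbaumFormula (gradingR ρ θ) (trivialModule (gradingR ρ θ))) := by
  obtain ⟨U, hU, h1, hind, hr⟩ := exists_isGeneralSubset
    (fun n (p : kˣ × kˣ) => RanksAtLeast n p.1 p.2) holdsNearOne_ranksAtLeast
  refine ⟨U, hU, h1, hind, fun ρ θ hp => ?_⟩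
  have hr₁ : ∀ n, RanksAtLeast n ρ θ := fun n => (hr _ hp n).1
  have hr₂ : ∀ n, RanksAtLeast n ρ⁻¹ θ⁻¹ := fun n => (hr _ hp n).2
  have hgr := isConnectedGraded_gradingR ρ θ
  obtain ⟨hpd, hgl⟩ := rightGlobalDimension_algebraR hr₁
  have e2 := not_finiteDimensional_ext_two hr₁
  have e3 := not_finiteDimensional_ext_three hr₁
  have e4 := not_finiteDimensional_ext_four hr₁
  have n2 := nontrivial_of_not_finiteDimensional e2
  have n3 := nontrivial_of_not_finiteDimensional e3
  have hG : ¬ IsASGorenstein (gradingR ρ θ) := not_isASGorenstein (by norm_num) n2 n3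
  have hd : depth (gradingR ρ θ) (rightRegular (algebraR ρ θ)) = 2 :=
    depth_eq n2 fun i hi => by
      interval_cases i
      exacts [subsingleton_extTrivial_zero, subsingleton_extTrivial_one hr₁]
  have hd0 := depth_trivialModule (augmentationIdeal_ne_top ρ θ)
  refine ⟨⟨hgr, koszulComplexExact hr₁, isKoszul hr₁, hgl, leftGlobalDimension_algebraR hr₁ hr₂,
    hilbertSeries_gradingR hr₁, exists_algEquiv hr₁⟩, subsingleton_extTrivial_one hr₁, ?_,
    hG, not_isASRegular hG, not_satisfiesChi hgr e2, hd, hd0, hpd, ?_⟩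
  · rintro i (rfl | rfl | rfl)
    exacts [e2, e3, e4]
  · rw [AuslanderBuchsbaumFormula, hpd, hd, hd0]
    decide
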